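/- Let $h, m \geq 0$ and let $\alpha:\mathbb{Z}^h \to \Sigma_m$ be monotypical, i.e. exactly one subgroup of $\mathbb{Z}^h$ occurs as the stabilizer of a point of the $\mathbb{Z}^h$-set $\{1,\dots,m\}$ classified by $\alpha$ (so $m\ge 1$). Let $A = \operatorname{im}\alpha$, $l = m/|A|$ and $A^* = \operatorname{Hom}(A,\mathbb{Q}/\mathbb{Z})$, embedded in $(\mathbb{Q}/\mathbb{Z})^h$ as the dual of $\alpha:\mathbb{Z}^h\twoheadrightarrow A$. Schemes are regarded as functors of points on commutative rings. Consider: * $R(G)$, the complex representation ring of a finite group $G$; the ideal $I_{tr}\subseteq R(A\wr\Sigma_l)$ generated by the images of the transfers from $R(A\wr(\Sigma_i\times\Sigma_{l-i}))$, $0<i<l$; and the map $N_A:\operatorname{Spec}(R(A\wr\Sigma_l)/I_{tr})\to\operatorname{Spec}R(A)$ induced by the homomorphism $A\wr\Sigma_l\to A$, $(a_1,\dots,a_l;\sigma)\mapsto a_1\cdots a_l$. * $\chi_A:\operatorname{Spec}R(A)\to\operatorname{Hom}(A^*,\mathbb{G}_m)$, which restricts a ring homomorphism $R(A)\to K$ to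 the classes of the one-dimensional representations $a\mapsto e^{2\pi i\psi(a)}$, $\psi\in A^*$. * $\operatorname{Sub}_m^{A^*}(\mathbb{G}_m\oplus(\mathbb{Q}/\mathbb{Z})^h)$, the functor sending a commutative ring $K$ to the set of closed subgroup schemes $H$ of $\mathbb{G}_m\oplus(\mathbb{Q}/\mathbb{Z})^h$ over $K$ that are finite and locally free of rank $m$ over $K$ and whose projection to $(\mathbb{Q}/\mathbb{Z})^h$ is the constant subgroup $A^*$. * $c_{m,A}$, which sends $\varphi:A^*\to K^\times$ to the pull-back of $(u,x)\mapsto(u^l,x)$ along $(\varphi,\mathrm{incl}):A^*\to\mathbb{G}_m\oplus(\mathbb{Q}/\mathbb{Z})^h$, i.e. to the subgroup $\{(u,x): x\in A^*,\ u^l=\varphi(x)\}$. * For $w\in A\wr\Sigma_l$ whose image in $\Sigma_l$ is an $l$-cycle, let $B_w$ be the image of the map $\mathbb{Z}\oplus\mathbb{Z}^h\to\Sigma_{|A|l}$ given by the action of $w$ on $A\times\{1,\dots,l\}$ and by the action of $\mathbb{Z}^h$ through $\alpha$ and the diagonal action of $A$. Let $B_w^*\subset\mathbb{Q}/\mathbb{Z}\oplus(\mathbb{Q}/\mathbb{Z})^h$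 be the image of its Pontryagin dual, and identify $\mathbb{Q}/\mathbb{Z}$ with the roots of unity in $\mathbb{C}^\times$ by $q\mapsto e^{2\pi i q}$. Then: 1. $N_A$ and $\chi_A$ are isomorphisms, $c_{m,A}$ is a well-defined isomorphism $\operatorname{Hom}(A^*,\mathbb{G}_m)\to\operatorname{Sub}_m^{A^*}(\mathbb{G}_m\oplus(\mathbb{Q}/\mathbb{Z})^h)$, and $\operatorname{Sub}_m^{A^*}(\mathbb{G}_m\oplus(\mathbb{Q}/\mathbb{Z})^h)$ is affine. 2. For every such $w$, $B_w^*$ is the group of torsion complex points of exactly one $H_w\in\operatorname{Sub}_m^{A^*}(\mathbb{G}_m\oplus(\mathbb{Q}/\mathbb{Z})^h)(\mathbb{C})$. There is a unique ring homomorphism $$g_{m,A}:\Gamma\operatorname{Sub}_m^{A^*}(\mathbb{G}_m\oplus(\mathbb{Q}/\mathbb{Z})^h)\to R(A\wr\Sigma_l)/I_{tr}$$ such that, for every function $f$ and every such $w$, the value at $w$ of the class function $g_{m,A}(f)$ (which is well defined modulo $I_{tr}$) is $f(H_w)$. It is injective. 3. With $g_{m,A}^*:\operatorname{Spec}(R(A\wr\Sigma_l)/I_{tr})\to\operatorname{Sub}_m^{A^*}(\mathbb{G}_m\oplus(\mathbb{Q}/\mathbb{Z})^h)$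 the map of schemes induced by $g_{m,A}$, the square commutes: $$c_{m,A}\circ\chi_A\circ N_A = g_{m,A}^*.$$ -/

import Mathlib

open CategoryTheory
open scoped LaurentPolynomial Pointwise TensorProduct

noncomputable section

namespace HeightOne

/-! ### The group `ℚ/ℤ`, Pontryagin duals -/

/-- The group `ℚ/ℤ`. -/
abbrev QZ : Type := AddCircle (1 : ℚ)

/-- The homomorphism `ℚ → ℂˣ`, `q ↦ exp (2πiq)`. -/
def expRat : ℚ →+ Additive ℂˣ where
  toFun q := Additive.ofMul
    (Units.mk0 (Complex.exp (2 * Real.pi * Complex.I * (q : ℂ))) (Complex.exp_ne_zero _))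
  map_zero' := by
    rw [← ofMul_one]
    congr 1
    ext
    simp
  map_add' a b := by
    rw [← ofMul_mul]
    congr 1
    ext
    simp [mul_add, Complex.exp_add]

/-- The embedding `ℚ/ℤ → ℂˣ`, `q ↦ exp (2πiq)`, onto the roots of unity. -/
def expQZ : Multiplicative QZ →* ℂˣ :=
  AddMonoidHom.toMultiplicativeLeft
    (QuotientAddGroup.lift (AddSubgroup.zmultiples (1 : ℚ)) expRat (by
      intro x hx
      obtain ⟨n, rfl⟩ := AddSubgroup.mem_zmultiples_iff.1 hx
      rw [AddMonoidHom.mem_ker, map_zsmul]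
      have h1 : expRat 1 = 0 := by
        rw [← ofMul_one]
        change Additive.ofMul _ = _
        congr 1
        ext
        simp [Complex.exp_two_pi_mul_I]
      rw [h1, smul_zero]))

/-- The Pontryagin dual `A^* = Hom(A, ℚ/ℤ)` (written multiplicatively) of a finite abelian group. -/
abbrev Dual (A : Type) [Group A] : Type := A →* Multiplicative QZ

/-- The map `A^* → (ℤ^ι)^* = (ℚ/ℤ)^ι` dual to a homomorphism `p : ℤ^ι → A`. -/
def dualMap {ι : Type} [DecidableEq ι] {A : Type} [Group A] (p : Multiplicative (ι → ℤ) →* A) :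
    Additive (Dual A) →+ (ι → QZ) where
  toFun χ i := Multiplicative.toAdd ((Additive.toMul χ) (p (Multiplicative.ofAdd (Pi.single i 1))))
  map_zero' := by ext i; simp
  map_add' χ ψ := by ext i; simp

/-! ### Monotypical maps -/

/-- `α : ℤ^h → Σ_m` is monotypical if exactly one type occurs in the `ℤ^h`-set `{1,…,m}`, that is,
if exactly one subgroup of `ℤ^h` occurs as the stabilizer of a point. -/
def IsMonotypical {h m : ℕ} (α : Multiplicative (Fin h → ℤ) →* Equiv.Perm (Fin m)) : Prop :=
  (Set.range fun x : Fin m =>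
    (MulAction.stabilizer (Equiv.Perm (Fin m)) x).comap α).ncard = 1

/-- The image of a homomorphism from `ℤ^h` is an abelian group. -/
instance imageCommGroup {h m : ℕ} (α : Multiplicative (Fin h → ℤ) →* Equiv.Perm (Fin m)) :
    CommGroup α.range where
  mul_comm := by
    rintro ⟨_, a, rfl⟩ ⟨_, b, rfl⟩
    ext1
    simp only [Subgroup.coe_mul, ← map_mul, mul_comm]

/-! ### Representation rings and transfers -/

/-- The complex representation ring `R(G)` of a finite group, as the ring of virtual characters. -/
def RepRing (G : Type) [Group G] : Subring (G → ℂ) :=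
  Subring.closure {χ | ∃ (V : Type) (_ : AddCommGroup V) (_ : Module ℂ V)
    (_ : FiniteDimensional ℂ V) (ρ : Representation ℂ G V), χ = ρ.character}

/-- Restriction of functions along a map of sets, as a ring homomorphism. -/
def precomp {G H : Type} (f : G → H) : (H → ℂ) →+* (G → ℂ) where
  toFun r g := r (f g)
  map_one' := rfl
  map_mul' _ _ := rfl
  map_zero' := rfl
  map_add' _ _ := rfl

/-- The pull-back `R(H) → R(G)` along a group homomorphism `f : G → H`. -/
def RepRing.pullback {G H : Type} [Group G] [Group H] (f : G →* H) : RepRing H →+* RepRing G :=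
  (precomp f).restrict (RepRing H) (RepRing G) (by
    intro r hr
    have : RepRing H ≤ (RepRing G).comap (precomp f) := by
      refine Subring.closure_le.2 ?_
      rintro _ ⟨V, _, _, _, ρ, rfl⟩
      exact Subring.subset_closure ⟨V, _, _, inferInstance, ρ.comp f, rfl⟩
    exact this hr)

/-- Induction of (class) functions from a subgroup `H` of a finite group `G`. On characters it is
the character of the induced representation, and so on representation rings it is the transfer. -/
def induce {G : Type} [Group G] (H : Subgroup G) (f : H → ℂ) (g : G) : ℂ :=
  open Classical in
  (Nat.card H : ℂ)⁻¹ * ∑ᶠ x : G, if hx : x⁻¹ * g * x ∈ H then f ⟨x⁻¹ * g * x, hx⟩ else 0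

/-! ### Wreath products -/

/-- The wreath product `A ≀ Σ_l = A^l ⋊ Σ_l`; here `(σ • a) i = a (σ⁻¹ i)`. -/
abbrev Wreath (A : Type) [CommGroup A] (l : ℕ) : Type :=
  (Fin l → A) ⋊[mulAutArrow (G := Equiv.Perm (Fin l)) (A := Fin l) (M := A)] Equiv.Perm (Fin l)

variable {A : Type} [CommGroup A] {l : ℕ}

/-- The map `N_A : A ≀ Σ_l → A` induced by the multiplication map `A^l → A`. -/
def wreathNorm (A : Type) [CommGroup A] (l : ℕ) : Wreath A l →* A where
  toFun w := ∏ i, w.left i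
  map_one' := by simp
  map_mul' v w := by
    simp only [SemidirectProduct.mul_left, Pi.mul_apply, Finset.prod_mul_distrib]
    congr 1
    exact Equiv.prod_comp (v.right⁻¹ : Equiv.Perm (Fin l)) w.left

/-- The subgroup `A ≀ (Σ_i × Σ_{l-i})` of `A ≀ Σ_l`: the permutation part preserves the set of the
first `i` points. -/
def wreathYoung (A : Type) [CommGroup A] (l i : ℕ) : Subgroup (Wreath A l) :=
  (MulAction.stabilizer (Equiv.Perm (Fin l)) {k : Fin l | (k : ℕ) < i}).comap
    SemidirectProduct.rightHom

/-- The transfer ideal `I_tr` of `R(A ≀ Σ_l)`: generated by the images of the transfers from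
`R(A ≀ (Σ_i × Σ_{l-i}))`, `0 < i < l`. -/
def transferIdeal (A : Type) [CommGroup A] (l : ℕ) : Ideal (RepRing (Wreath A l)) :=
  Ideal.span {F | ∃ i : ℕ, 0 < i ∧ i < l ∧ ∃ f : RepRing (wreathYoung A l i),
    (F : Wreath A l → ℂ) = induce (wreathYoung A l i) f}

/-- The ring `R(A ≀ Σ_l) / I_tr`. -/
abbrev RepQuot (A : Type) [CommGroup A] (l : ℕ) : Type :=
  RepRing (Wreath A l) ⧸ transferIdeal A l

/-- The ring homomorphism `R(A) → R(A ≀ Σ_l) / I_tr` induced by `N_A`. -/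
def normPullback (A : Type) [CommGroup A] (l : ℕ) : RepRing A →+* RepQuot A l :=
  (Ideal.Quotient.mk _).comp (RepRing.pullback (wreathNorm A l))

/-- `w ∈ A ≀ Σ_l` lies over an `l`-cycle of `Σ_l`. -/
def OverLongCycle (w : Wreath A l) : Prop := w.right.IsCycleOn Set.univ

theorem induce_eq_zero {i : ℕ} (h0 : 0 < i) (hi : i < l) {w : Wreath A l} (hw : OverLongCycle w)
    (f : wreathYoung A l i → ℂ) : induce (wreathYoung A l i) f w = 0 := by
  have key : ∀ x : Wreath A l, x⁻¹ * w * x ∉ wreathYoung A l i := by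
    intro x hx
    set v : Wreath A l := x⁻¹ * w * x with hv
    have hl : 0 < l := h0.trans hi
    have hst : ∀ n : ℤ, (v ^ n).right • {k : Fin l | (k : ℕ) < i} = {k : Fin l | (k : ℕ) < i} :=
      fun n => (Subgroup.zpow_mem _ hx n : v ^ n ∈ wreathYoung A l i)
    obtain ⟨n, hn⟩ := hw.2 (Set.mem_univ (x.right ⟨0, hl⟩)) (Set.mem_univ (x.right ⟨i, hi⟩))
    have h1 : (v ^ n).right = x.right⁻¹ * w.right ^ n * x.right := by
      change SemidirectProduct.rightHom (v ^ n) = _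
      rw [map_zpow, hv]
      simp only [map_mul, map_inv]
      simpa using conj_zpow (i := n) (a := x.right⁻¹) (b := w.right)
    have h2 : (v ^ n).right ⟨0, hl⟩ = ⟨i, hi⟩ := by
      rw [h1]
      simp [hn]
    have h3 : (⟨i, hi⟩ : Fin l) ∈ {k : Fin l | (k : ℕ) < i} := by
      rw [← hst n, ← h2]
      exact Set.smul_mem_smul_set (show (0 : ℕ) < i from h0)
    exact lt_irrefl _ (show i < i from h3)
  simp [induce, key]

/-- Evaluation of virtual characters at an element over an `l`-cycle; it is well defined modulo
the transfer ideal. These are the complex points of `Spec (R(A ≀ Σ_l) / I_tr)`. -/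
def evalAt (w : Wreath A l) (hw : OverLongCycle w) : RepQuot A l →+* ℂ :=
  Ideal.Quotient.lift (transferIdeal A l)
    ((Pi.evalRingHom (fun _ : Wreath A l => ℂ) w).comp (RepRing (Wreath A l)).subtype) (by
      intro F hF
      have : transferIdeal A l ≤ RingHom.ker
          ((Pi.evalRingHom (fun _ : Wreath A l => ℂ) w).comp (RepRing (Wreath A l)).subtype) := by
        refine Ideal.span_le.2 ?_
        rintro F ⟨i, h0, hi, f, hf⟩
        simp [RingHom.mem_ker, hf, induce_eq_zero h0 hi hw]
      exact this hF)

/-! ### The subgroup of `(ℚ/ℤ)^{1+h}` attached to an element of `A ≀ Σ_l` -/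

/-- The embedding `s : A ≀ Σ_l → Σ_{|A|l}`, as an action on `A × {1,…,l}`. -/
def wreathPerm (A : Type) [CommGroup A] (l : ℕ) : Wreath A l →* Equiv.Perm (A × Fin l) :=
  MonoidHom.toHomPerm
    { toFun := fun w x => (w.left (w.right x.2) * x.1, w.right x.2)
      map_one' := by
        funext x
        refine Prod.ext ?_ ?_
        · simp only [SemidirectProduct.one_left, SemidirectProduct.one_right, Pi.one_apply, one_mul]
          rfl
        · rfl
      map_mul' := by
        intro v w
        funext x
        refine Prod.ext ?_ ?_
        · simp only [SemidirectProduct.mul_left, SemidirectProduct.mul_right, Pi.mul_apply,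
            mul_assoc]
          refine congrArg (v.left (v.right (w.right x.2)) * ·) (congrArg (· * x.1) ?_)
          exact congrArg w.left (Equiv.symm_apply_apply v.right (w.right x.2))
        · rfl }

/-- The diagonal map `z : A → A ≀ Σ_l`. -/
def wreathDiag (A : Type) [CommGroup A] (l : ℕ) : A →* Wreath A l :=
  SemidirectProduct.inl.comp (Pi.constMonoidHom (Fin l) A)

theorem wreathDiag_comm (a : A) (w : Wreath A l) : Commute (wreathDiag A l a) w := by
  refine SemidirectProduct.ext ?_ ?_
  · ext i
    simp only [wreathDiag, MonoidHom.comp_apply, SemidirectProduct.mul_left, Pi.mul_apply,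
      SemidirectProduct.left_inl, SemidirectProduct.right_inl, map_one, MulAut.one_apply]
    exact mul_comm _ _
  · simp [wreathDiag]

/-- For `w ∈ A ≀ Σ_l` and `p : ℤ^h → A`, the map `ℤ^{1+h} = ℤ ⊕ ℤ^h → Σ_{|A|l}` that is given by
the permutation `s(w)` on `ℤ` and by `s ∘ z ∘ p` on `ℤ^h`. -/
def wreathTuple {h : ℕ} (p : Multiplicative (Fin h → ℤ) →* A) (w : Wreath A l) :
    Multiplicative (Fin (h + 1) → ℤ) →* Equiv.Perm (A × Fin l) :=
  (wreathPerm A l).comp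
    { toFun := fun v => w ^ (Multiplicative.toAdd v 0) *
        wreathDiag A l (p (Multiplicative.ofAdd (Fin.tail (Multiplicative.toAdd v))))
      map_one' := by
        have : Fin.tail (0 : Fin (h + 1) → ℤ) = 0 := rfl
        simp [this]
      map_mul' := by
        intro u v
        have : Fin.tail (Multiplicative.toAdd u + Multiplicative.toAdd v) =
          Fin.tail (Multiplicative.toAdd u) + Fin.tail (Multiplicative.toAdd v) := rfl
        simp only [toAdd_mul, this, ofAdd_add, map_mul, Pi.add_apply, zpow_add]
        simp only [mul_assoc]
        congr 1
        rw [← mul_assoc, ← mul_assoc]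
        congr 1
        exact ((wreathDiag_comm _ _).zpow_right _).eq.symm }

/-- The image in `(ℚ/ℤ)^{1+h}` of the Pontryagin dual `B^*` of the image `B` of
`ℤ^{1+h} → Σ_{|A|l}`. -/
def cycleSubgroup {h : ℕ} (p : Multiplicative (Fin h → ℤ) →* A) (w : Wreath A l) :
    AddSubgroup (Fin (h + 1) → QZ) :=
  (dualMap (wreathTuple p w).rangeRestrict).range

/-! ### Functors of points -/

/-- The affine scheme `Spec R`, as a functor of points. -/
def SpecFunctor (R : Type) [CommRing R] : CommRingCat.{0} ⥤ Type where
  obj K := R →+* K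
  map θ := TypeCat.ofHom fun φ => θ.hom.comp φ

/-- The map of affine schemes induced by a ring homomorphism. -/
def specMap {R S : Type} [CommRing R] [CommRing S] (f : R →+* S) :
    SpecFunctor S ⟶ SpecFunctor R where
  app K := TypeCat.ofHom fun φ : S →+* K => φ.comp f

/-- The scheme `Hom(M, 𝔾_m)`, as a functor of points. -/
def HomGm (M : Type) [CommGroup M] : CommRingCat.{0} ⥤ Type where
  obj K := M →* Kˣ
  map θ := TypeCat.ofHom fun φ => (Units.map (θ.hom : _ →* _)).comp φ

/-- The ring `ΓX` of functions on a functor of points `X`: natural transformations from `X` to the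
affine line. -/
def Gam (X : CommRingCat.{0} ⥤ Type) : Subring ((K : CommRingCat.{0}) → X.obj K → K) where
  carrier := {f | ∀ (K K' : CommRingCat.{0}) (θ : K ⟶ K') (x : X.obj K),
    f K' (X.map θ x) = θ.hom (f K x)}
  mul_mem' ha hb K K' θ x := by simp [ha K K' θ x, hb K K' θ x]
  one_mem' K K' θ x := by simp
  add_mem' ha hb K K' θ x := by simp [ha K K' θ x, hb K K' θ x]
  zero_mem' K K' θ x := by simp
  neg_mem' ha K K' θ x := by simp [ha K K' θ x]

/-- Evaluation of functions at a point. -/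
def evalPoint {X : CommRingCat.{0} ⥤ Type} {K : CommRingCat.{0}} (x : X.obj K) :
    Gam X →+* K where
  toFun f := f.1 K x
  map_one' := rfl
  map_mul' _ _ := rfl
  map_zero' := rfl
  map_add' _ _ := rfl

/-- `X` is affine: the canonical map `X → Spec ΓX` is an isomorphism. -/
def IsAffineFunctor (X : CommRingCat.{0} ⥤ Type) : Prop :=
  ∀ K : CommRingCat.{0}, Function.Bijective fun x : X.obj K => evalPoint x

/-! ### The map `χ_A` -/

/-- The class in `R(A)` of the one-dimensional representation with a given character. -/
def charClass (A : Type) [CommGroup A] : Dual A →* RepRing A where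
  toFun χ := ⟨fun a => (expQZ (χ a) : ℂ), Subring.subset_closure
    ⟨ℂ, inferInstance, inferInstance, inferInstance,
      (Algebra.lmul ℂ ℂ : ℂ →* Module.End ℂ ℂ).comp ((Units.coeHom ℂ).comp (expQZ.comp χ)), by
        ext a
        have h1 : ((Algebra.lmul ℂ ℂ : ℂ →* Module.End ℂ ℂ).comp
            ((Units.coeHom ℂ).comp (expQZ.comp χ))) a
            = (expQZ (χ a) : ℂ) • (LinearMap.id : ℂ →ₗ[ℂ] ℂ) := by
          ext
          simp
        rw [Representation.character, h1]
        simp⟩⟩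
  map_one' := by ext a; simp
  map_mul' χ ψ := by ext a; simp

/-- `χ_A : Spec R(A) → Hom(A^*, 𝔾_m)`: a homomorphism `R(A) → K` is restricted to the classes of
the one-dimensional representations. -/
def chiMap (A : Type) [CommGroup A] : SpecFunctor (RepRing A) ⟶ HomGm (Dual A) where
  app K := TypeCat.ofHom fun φ : RepRing A →+* K =>
    (((φ : RepRing A →* K).comp (charClass A)).toHomUnits : Dual A →* Kˣ)
  naturality K K' θ := by
    ext φ
    rfl

/-! ### Finite subgroups of `𝔾_m ⊕ (ℚ/ℤ)^h` -/

/-- The `S`-points of the closed subscheme of `𝔾_m` over `K` with ideal `J ⊆ K[T, T⁻¹]`. -/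
def points {K : Type} [CommRing K] (J : Ideal K[T;T⁻¹]) (S : Type) [CommRing S] [Algebra K S] :
    Set Sˣ :=
  {u | ∀ f ∈ J, LaurentPolynomial.eval₂ (algebraMap K S) u f = 0}

/-- A closed subscheme of `𝔾_m ⊕ (ℚ/ℤ)^h = ∐_x 𝔾_m` over `K` is a family of ideals `I x` of
`K[T, T⁻¹]`, indexed by `x ∈ (ℚ/ℤ)^h`. It is a subgroup of order `m` if it is finite and locally
free of degree `m` over `K`, and if its points form a subgroup. -/
structure IsSubgroupOfOrder {h : ℕ} (K : Type) [CommRing K] (m : ℕ)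
    (I : (Fin h → QZ) → Ideal K[T;T⁻¹]) : Prop where
  finite_support : {x | I x ≠ ⊤}.Finite
  finite : ∀ x, Module.Finite K (K[T;T⁻¹] ⧸ I x)
  projective : ∀ x, Module.Projective K (K[T;T⁻¹] ⧸ I x)
  degree : ∀ q : PrimeSpectrum K, ∑ᶠ x, Module.rankAtStalk (K[T;T⁻¹] ⧸ I x) q = m
  one_mem : ∀ (S : Type) [CommRing S] [Algebra K S], (1 : Sˣ) ∈ points (I 0) S
  mul_mem : ∀ (S : Type) [CommRing S] [Algebra K S] (x y : Fin h → QZ) (u v : Sˣ),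
    u ∈ points (I x) S → v ∈ points (I y) S → u * v ∈ points (I (x + y)) S
  inv_mem : ∀ (S : Type) [CommRing S] [Algebra K S] (x : Fin h → QZ) (u : Sˣ),
    u ∈ points (I x) S → u⁻¹ ∈ points (I (-x)) S

/-- The projection of the closed subscheme `I` to `(ℚ/ℤ)^h` is the constant subgroup `L`: nothing
lies over the complement of `L`, and the fibres over the points of `L` are faithfully flat. -/
structure HasProjection {h : ℕ} (K : Type) [CommRing K] (L : AddSubgroup (Fin h → QZ))
    (I : (Fin h → QZ) → Ideal K[T;T⁻¹]) : Prop where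
  eq_top : ∀ x, x ∉ L → I x = ⊤
  faithfullyFlat : ∀ x, x ∈ L → Module.FaithfullyFlat K (K[T;T⁻¹] ⧸ I x)

/-- Base change of an ideal of `K[T, T⁻¹]`. -/
def idealMap {K K' : Type} [CommRing K] [CommRing K'] (θ : K →+* K') (J : Ideal K[T;T⁻¹]) :
    Ideal K'[T;T⁻¹] :=
  J.map (AddMonoidAlgebra.mapRingHom ℤ θ)

/-- The ring of functions on a base change is the base change of the ring of functions. -/
def quotBaseChange (K K' : Type) [CommRing K] [CommRing K'] [Algebra K K'] (J : Ideal K[T;T⁻¹]) :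
    K' ⊗[K] (K[T;T⁻¹] ⧸ J) ≃ₗ[K'] (K'[T;T⁻¹] ⧸ idealMap (algebraMap K K') J) :=
  ((Algebra.TensorProduct.tensorQuotientEquiv (R := K) K' K[T;T⁻¹] K' J).trans
    (Ideal.quotientEquivAlg _ _ (AddMonoidAlgebra.scalarTensorEquiv K K') (by
      have h1 : AddMonoidAlgebra.mapRingHom ℤ (algebraMap K K') =
          ((AddMonoidAlgebra.scalarTensorEquiv K K' : K' ⊗[K] K[T;T⁻¹] ≃ₐ[K'] K'[T;T⁻¹]) :
            K' ⊗[K] K[T;T⁻¹] →+* K'[T;T⁻¹]).comp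
            (Algebra.TensorProduct.includeRight (R := K) (A := K') (B := K[T;T⁻¹]) :
              K[T;T⁻¹] →+* K' ⊗[K] K[T;T⁻¹]) := by
        ext x <;> simp
      rw [idealMap, h1, ← Ideal.map_map]
      rfl))).toLinearEquiv

theorem eval₂_mapRingHom {K K' S : Type} [CommRing K] [CommRing K'] [CommRing S] (θ : K →+* K')
    (g : K' →+* S) (u : Sˣ) :
    (LaurentPolynomial.eval₂ g u).comp (AddMonoidAlgebra.mapRingHom ℤ θ) =
      LaurentPolynomial.eval₂ (g.comp θ) u := by
  refine RingHom.ext fun f => ?_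
  induction f using LaurentPolynomial.induction_on' with
  | add p q hp hq => simp only [map_add, hp, hq]
  | C_mul_T n a =>
    rw [LaurentPolynomial.eval₂_C_mul_T, ← LaurentPolynomial.single_eq_C_mul_T, RingHom.comp_apply,
      AddMonoidAlgebra.mapRingHom_single, LaurentPolynomial.single_eq_C_mul_T,
      LaurentPolynomial.eval₂_C_mul_T]
    rfl

theorem mem_points_idealMap {K K' : Type} [CommRing K] [CommRing K'] [Algebra K K']
    (J : Ideal K[T;T⁻¹]) (S : Type) [CommRing S] [Algebra K S] [Algebra K' S]
    [IsScalarTower K K' S] (u : Sˣ) :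
    u ∈ points (idealMap (algebraMap K K') J) S ↔ u ∈ points J S := by
  have h1 : ∀ (F : Type) [CommRing F] [Algebra F S] (J : Ideal F[T;T⁻¹]), u ∈ points J S ↔
      J ≤ RingHom.ker (LaurentPolynomial.eval₂ (algebraMap F S) u) := fun _ _ _ _ => Iff.rfl
  rw [h1, h1, idealMap, Ideal.map_le_iff_le_comap, RingHom.comap_ker, eval₂_mapRingHom,
    ← IsScalarTower.algebraMap_eq]

theorem IsSubgroupOfOrder.baseChange {h : ℕ} {K K' : Type} [CommRing K] [CommRing K'] {m : ℕ}
    {I : (Fin h → QZ) → Ideal K[T;T⁻¹]} (hI : IsSubgroupOfOrder K m I) (θ : K →+* K') :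
    IsSubgroupOfOrder K' m fun x => idealMap θ (I x) := by
  let : Algebra K K' := θ.toAlgebra
  have hfin := hI.finite
  have hproj := hI.projective
  refine ⟨hI.finite_support.subset fun x hx hx' => hx ?_, fun x => ?_, fun x => ?_, fun q => ?_,
    fun S _ _ => ?_, fun S _ _ x y u v hu hv => ?_, fun S _ _ x u hu => ?_⟩
  · rw [hx', idealMap, Ideal.map_top]
  · exact Module.Finite.equiv (quotBaseChange K K' (I x))
  · exact Module.Projective.of_equiv (quotBaseChange K K' (I x))
  · rw [← hI.degree (q.comap θ)]
    refine finsum_congr fun x => ?_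
    exact (congrFun (Module.rankAtStalk_eq_of_equiv (quotBaseChange K K' (I x))) q).symm.trans
      (Module.rankAtStalk_baseChange q)
  all_goals
    let : Algebra K S := ((algebraMap K' S).comp θ).toAlgebra
    have : IsScalarTower K K' S := IsScalarTower.of_algebraMap_eq fun _ => rfl
  · exact (mem_points_idealMap (I 0) S 1).2 (hI.one_mem S)
  · exact (mem_points_idealMap _ S _).2 (hI.mul_mem S x y u v
      ((mem_points_idealMap _ S _).1 hu) ((mem_points_idealMap _ S _).1 hv))
  · exact (mem_points_idealMap _ S _).2 (hI.inv_mem S x u ((mem_points_idealMap _ S _).1 hu))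

theorem HasProjection.baseChange {h : ℕ} {K K' : Type} [CommRing K] [CommRing K']
    {L : AddSubgroup (Fin h → QZ)} {I : (Fin h → QZ) → Ideal K[T;T⁻¹]}
    (hI : HasProjection K L I) (θ : K →+* K') : HasProjection K' L fun x => idealMap θ (I x) := by
  let : Algebra K K' := θ.toAlgebra
  refine ⟨fun x hx => ?_, fun x hx => ?_⟩
  · rw [hI.eq_top x hx, idealMap, Ideal.map_top]
  · have := hI.faithfullyFlat x hx
    exact Module.FaithfullyFlat.of_linearEquiv _ _ (quotBaseChange K K' (I x)).symm

theorem idealMap_id {K : Type} [CommRing K] (J : Ideal K[T;T⁻¹]) :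
    idealMap (RingHom.id K) J = J := by
  rw [idealMap, AddMonoidAlgebra.mapRingHom_id]
  exact Ideal.map_id J

theorem idealMap_comp {K K' K'' : Type} [CommRing K] [CommRing K'] [CommRing K''] (θ : K →+* K')
    (η : K' →+* K'') (J : Ideal K[T;T⁻¹]) : idealMap (η.comp θ) J = idealMap η (idealMap θ J) := by
  rw [idealMap, idealMap, idealMap, AddMonoidAlgebra.mapRingHom_comp, Ideal.map_map]

/-- The scheme `Sub_m^L(𝔾_m ⊕ (ℚ/ℤ)^h)`, as a functor of points: a ring `K` is sent to the set of
subgroups of order `m` of `𝔾_m ⊕ (ℚ/ℤ)^h` over `K` whose projection to `(ℚ/ℤ)^h` is `L`. -/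
def SubFunctor {h : ℕ} (m : ℕ) (L : AddSubgroup (Fin h → QZ)) : CommRingCat.{0} ⥤ Type where
  obj K := {I : (Fin h → QZ) → Ideal K[T;T⁻¹] // IsSubgroupOfOrder K m I ∧ HasProjection K L I}
  map θ := TypeCat.ofHom fun H =>
    ⟨fun x => idealMap θ.hom (H.1 x), H.2.1.baseChange θ.hom, H.2.2.baseChange θ.hom⟩
  map_id K := by
    refine ConcreteCategory.hom_ext _ _ fun H => ?_
    exact Subtype.ext (funext fun x => idealMap_id _)
  map_comp θ η := by
    refine ConcreteCategory.hom_ext _ _ fun H => ?_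
    exact Subtype.ext (funext fun x => idealMap_comp _ _ _)

/-! ### The map `c_{m,A}` -/

/-- For `p : ℤ^h → A` onto and `φ : A^* → 𝔾_m` over `K`, the pull-back along
`(φ, p^*) : A^* → 𝔾_m ⊕ (ℚ/ℤ)^h` of the map `(u, x) ↦ (u^l, x)` from `𝔾_m ⊕ (ℚ/ℤ)^h` to itself,
that is, the closed subscheme of the `(u, x)` with `x = p^*(χ)` and `u^l = φ(χ)` for some
`χ ∈ A^*`. -/
def pullbackSubscheme {h : ℕ} {A : Type} [CommGroup A] (p : Multiplicative (Fin h → ℤ) →* A)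
    (l : ℕ) {K : Type} [CommRing K] (φ : Dual A →* Kˣ) (x : Fin h → QZ) : Ideal K[T;T⁻¹] :=
  ⨅ (χ : Dual A) (_ : dualMap p (Additive.ofMul χ) = x),
    Ideal.span {LaurentPolynomial.T (l : ℤ) - LaurentPolynomial.C (φ χ : K)}

/-! ### The map `g_{m,A}` -/

/-- The subset of `(ℚ/ℤ)^{1+h}` of the torsion complex points of a closed subscheme
of `𝔾_m ⊕ (ℚ/ℤ)^h` over `ℂ`, where `ℚ/ℤ` is identified with the torsion of `𝔾_m(ℂ) = ℂˣ`. -/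
def complexPoints {h : ℕ} (I : (Fin h → QZ) → Ideal ℂ[T;T⁻¹]) : Set (Fin (h + 1) → QZ) :=
  {y | expQZ (Multiplicative.ofAdd (y 0)) ∈ points (I (Fin.tail y)) ℂ}

/-- `H` is the complex point of `Sub_m^{A^*}(𝔾_m ⊕ (ℚ/ℤ)^h)` that corresponds to `w ∈ A ≀ Σ_l`:
the constant subgroup `B^*`. -/
def IsPointOf {h m : ℕ} {L : AddSubgroup (Fin h → QZ)} {A : Type} [CommGroup A] {l : ℕ}
    (p : Multiplicative (Fin h → ℤ) →* A) (w : Wreath A l)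
    (H : (SubFunctor m L).obj (CommRingCat.of ℂ)) : Prop :=
  complexPoints H.1 = cycleSubgroup p w

/-- `g : Γ Sub_m^{A^*}(𝔾_m ⊕ (ℚ/ℤ)^h) → R(A ≀ Σ_l) / I_tr` is the character-theoretic map: as a
class function on the elements `w` over `l`-cycles, `g f` is `w ↦ f (B^*)`, where `B` is the image
of the map `ℤ^{1+h} → Σ_{|A|l}` given by `w`. -/
def IsCharacterMap {h m l : ℕ} {A : Type} [CommGroup A] (p : Multiplicative (Fin h → ℤ) →* A)
    (g : Gam (SubFunctor m (dualMap p).range) →+* RepQuot A l) : Prop :=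
  ∀ (w : Wreath A l) (hw : OverLongCycle w)
    (H : (SubFunctor m (dualMap p).range).obj (CommRingCat.of ℂ)), IsPointOf p w H →
      ∀ f : Gam (SubFunctor m (dualMap p).range), evalAt w hw (g f) = evalPoint H f

end HeightOne

end

/-! Every corner of the square is the spectrum of `ℤ[A^*]`, and the proof finds this ring in each of
them.

Representation side. Restrict a representation of `A ≀ Σ_l` to `A^l` and split it into isotypic
parts. These are indexed by `l`-tuples of characters of `A`, which `Σ_l` permutes. Choose for each
tuple one of its values, depending only on the set of values; the coordinates with this value form a
nonempty set that moves equivariantly. The parts whose set has `k` elements, `0 < k < l`, together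
form a representation induced from `A ≀ (Σ_k × Σ_{l-k})`, so they lie in `I_tr`. The remaining
tuples are constant, and a constant tuple `ψ` contributes `ψ(N w)` times a virtual character of
`Σ_l` (`repRing_wreath_le_normSpan`). The ring `R(Σ_l)` is spanned by the products of the sign with
the permutation characters on functions with prescribed fibre sizes: the Frobenius characteristic
embeds it into the integral symmetric polynomials, which the elementary ones generate
(`repRing_perm_le_closure`). Such a product is a transfer if some fibre size lies strictly between
`0` and `l`, and otherwise it is a multiple of the sign. Hence `1` is `c` times the sign modulo
transfers, with `c = ±1` because transfers vanish at `l`-cycles, and everything is pulled back from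
`R(A)`. The pull-back is injective since each element of `A` is the norm of an element over an
`l`-cycle. Finally `R(A) = ℤ[A^*]`.

Subgroup side. Let `H` be a subgroup of order `l|A|` over `A^*`. Translation by the tautological
point shows that its fibres all have rank `l`, so `1, T, …, T^{l-1}` is a basis of each ring of
functions (`powMap_bijective`). Write `T^l = ∑ c_i(χ) T^i` over `χ`. Compatibility with
multiplication gives `c_i(χ) c_j(ψ) = δ_ij c_i(χψ)` (`coeff_mul_coeff`). Over `χ = 1` the `c_i` are
orthogonal idempotents with sum `1`, and since `T` is a unit only `c_0` survives. So `T^l = c_0(χ)`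
on every fibre and `c_0` is a homomorphism: `H` is a pull-back (`exists_eq_pullbackSubscheme`).

Comparison. If `w` lies over an `l`-cycle, then `w^l` is the diagonal element `N(w)`. So `B_w` is
`A` with an `l`-th root of `N(w)` adjoined, and `B_w^*` consists of the torsion points of the
pull-back along evaluation at `N(w)` (`isPointOf_iff`). With `g` defined by going around the square,
its value at `w` is therefore the prescribed one. -/

namespace HeightOne

/-! ### Virtual characters -/

theorem character_mem_repRing {G V : Type} [Group G] [AddCommGroup V] [Module ℂ V]
    [FiniteDimensional ℂ V] (ρ : Representation ℂ G V) : ρ.character ∈ RepRing G :=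
  Subring.subset_closure ⟨V, inferInstance, inferInstance, inferInstance, ρ, rfl⟩

/-- Induction principle: virtual characters are integral combinations of characters. -/
theorem repRing_le_of_character_mem {G : Type} [Group G] (M : AddSubgroup (G → ℂ))
    (hM : ∀ (V : Type) [AddCommGroup V] [Module ℂ V] [FiniteDimensional ℂ V]
      (ρ : Representation ℂ G V), ρ.character ∈ M) {F : G → ℂ} (hF : F ∈ RepRing G) : F ∈ M := by
  rw [RepRing, Subring.mem_closure_iff] at hF
  refine (AddSubgroup.closure_le M).2 ?_ hF
  -- Tensor products make the set of characters closed under multiplication, so the subring it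
  -- generates is just the additive group it generates.
  have h1 : ∀ F ∈ Submonoid.closure {χ | ∃ (V : Type) (_ : AddCommGroup V) (_ : Module ℂ V)
      (_ : FiniteDimensional ℂ V) (ρ : Representation ℂ G V), χ = ρ.character},
      ∃ (V : Type) (_ : AddCommGroup V) (_ : Module ℂ V)
      (_ : FiniteDimensional ℂ V) (ρ : Representation ℂ G V), F = ρ.character := by
    intro F hF
    induction hF using Submonoid.closure_induction with
    | mem x hx => exact hx
    | one =>
      refine ⟨ℂ, inferInstance, inferInstance, inferInstance, 1, ?_⟩
      ext g
      simp [Representation.character]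
    | mul x y _ _ hx hy =>
      obtain ⟨V, _, _, _, ρ, rfl⟩ := hx
      obtain ⟨W, _, _, _, σ, rfl⟩ := hy
      exact ⟨V ⊗[ℂ] W, inferInstance, inferInstance, inferInstance,
        Representation.tprod ρ σ, (Representation.char_tensor ρ σ).symm⟩
  intro F hF
  obtain ⟨V, _, _, _, ρ, rfl⟩ := h1 F hF
  exact hM V ρ

theorem repRing_conj {G : Type} [Group G] {F : G → ℂ} (hF : F ∈ RepRing G) (x g : G) :
    F (x * g * x⁻¹) = F g := by
  let M : AddSubgroup (G → ℂ) :=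
    { carrier := {F | F (x * g * x⁻¹) = F g}
      add_mem' := fun {a b} ha hb => by
        simp only [Set.mem_ofPred_eq, Pi.add_apply] at ha hb ⊢
        rw [ha, hb]
      zero_mem' := rfl
      neg_mem' := fun {a} ha => by
        simp only [Set.mem_ofPred_eq, Pi.neg_apply] at ha ⊢
        rw [ha] }
  exact repRing_le_of_character_mem M (fun V _ _ _ ρ => ρ.char_conj g x) hF

/-- For a character the integer is the dimension of the invariants. The integrality of the Frobenius
characteristic and of the multiplicities in `R(A)` both come from here. -/
theorem exists_sum_eq_card_mul {G : Type} [Group G] [Fintype G] {F : G → ℂ}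
    (hF : F ∈ RepRing G) : ∃ k : ℤ, ∑ g, F g = (Fintype.card G : ℂ) * k := by
  let M : AddSubgroup (G → ℂ) :=
    { carrier := {F | ∃ k : ℤ, ∑ g, F g = (Fintype.card G : ℂ) * k}
      add_mem' := by
        rintro a b ⟨k, hk⟩ ⟨n, hn⟩
        exact ⟨k + n, by simp [Finset.sum_add_distrib, hk, hn, mul_add]⟩
      zero_mem' := ⟨0, by simp⟩
      neg_mem' := by
        rintro a ⟨k, hk⟩
        exact ⟨-k, by simp [hk]⟩ }
  refine repRing_le_of_character_mem M (fun V _ _ _ ρ => ?_) hF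
  have h0 : (Nat.card G : ℂ) ≠ 0 := by simp [Nat.card_eq_fintype_card, Fintype.card_ne_zero]
  have : Invertible (Nat.card G : ℂ) := invertibleOfNonzero h0
  refine ⟨(Module.finrank ℂ (Representation.invariants ρ) : ℕ), ?_⟩
  have h1 := Representation.card_inv_mul_sum_char_eq_finrank ρ
  rw [inv_mul_eq_iff_eq_mul₀ h0] at h1
  rw [h1, Nat.card_eq_fintype_card]
  simp

/-- The trace of a representation on the image of a commuting projection. -/
theorem trace_mul_idempotent_mem_repRing {G V : Type} [Group G] [AddCommGroup V] [Module ℂ V]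
    [FiniteDimensional ℂ V] (ρ : Representation ℂ G V) (P : Module.End ℂ V) (hP : P * P = P)
    (hρ : ∀ g, ρ g * P = P * ρ g) :
    (fun g => LinearMap.trace ℂ V (ρ g * P)) ∈ RepRing G := by
  have hP' : ∀ v, P (P v) = P v := fun v => LinearMap.congr_fun hP v
  have hρ' : ∀ g v, ρ g (P v) = P (ρ g v) := fun g v => LinearMap.congr_fun (hρ g) v
  let ρ' : Representation ℂ G (LinearMap.range P) :=
    { toFun := fun g => P.rangeRestrict ∘ₗ ρ g ∘ₗ (LinearMap.range P).subtype
      map_one' := by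
        ext ⟨_, v, rfl⟩
        simp [hP']
      map_mul' := by
        intro a b
        ext ⟨_, v, rfl⟩
        simp [hP', hρ'] }
  have h1 : (fun g => LinearMap.trace ℂ V (ρ g * P)) = ρ'.character := by
    ext g
    -- `P` factors through its range, and cyclicity of the trace moves the inclusion to the other
    -- end.
    have h2 := LinearMap.trace_comp_comm' (R := ℂ) (P.rangeRestrict ∘ₗ ρ g)
      ((LinearMap.range P).subtype)
    rw [hρ g]
    exact h2
  rw [h1]
  exact character_mem_repRing ρ'

/-- Fixed point counts are characters of permutation representations. -/
theorem card_fixed_mem_repRing {G Ω : Type} [Group G] [Fintype Ω] [DecidableEq Ω]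
    (φ : G →* Equiv.Perm Ω) :
    (fun g => ((Finset.univ.filter fun ω => φ g ω = ω).card : ℂ)) ∈ RepRing G := by
  let ρ : Representation ℂ G (Ω → ℂ) :=
    { toFun := fun g => LinearMap.funLeft ℂ ℂ ⇑(φ g)⁻¹
      map_one' := by ext; simp
      map_mul' := by intro a b; ext; simp [LinearMap.funLeft] }
  convert character_mem_repRing ρ using 1
  ext g
  rw [Representation.character, LinearMap.trace_eq_matrix_trace ℂ (Pi.basisFun ℂ Ω), Matrix.trace]
  simp only [Matrix.diag, LinearMap.toMatrix_apply, Pi.basisFun_apply, Pi.basisFun_repr]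
  rw [Finset.card_filter]
  push_cast
  refine Finset.sum_congr rfl fun ω _ => ?_
  change _ = (Pi.single ω (1 : ℂ) : Ω → ℂ) ((φ g)⁻¹ ω)
  rw [Pi.single_apply]
  refine if_congr ?_ rfl rfl
  rw [Equiv.Perm.inv_eq_iff_eq, eq_comm]

theorem coe_hom_mem_repRing {G : Type} [Group G] (χ : G →* ℂ) : ⇑χ ∈ RepRing G := by
  let ρ : Representation ℂ G ℂ := (Algebra.lmul ℂ ℂ : ℂ →* Module.End ℂ ℂ).comp χ
  convert character_mem_repRing ρ using 1
  ext g
  have h1 : ρ g = χ g • (LinearMap.id : ℂ →ₗ[ℂ] ℂ) := by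
    ext
    simp [ρ]
  rw [Representation.character, h1]
  simp

theorem comp_mem_repRing {G H : Type} [Group G] [Group H] (f : G →* H) {F : H → ℂ}
    (hF : F ∈ RepRing H) : (fun g => F (f g)) ∈ RepRing G :=
  (RepRing.pullback f ⟨F, hF⟩).2

/-! ### Induction along a transitive action -/

/-- Group the sum that defines induction by the point `π x • ω₀`: each point of the orbit comes from
`|H|` elements `x`, which cancels the normalising factor. Transfers are recognised in this form, as
equivariant sums over fixed points. -/
theorem induce_eq_sum_fixed {G P Ω : Type} [Group G] [Finite G] [Group P] [MulAction P Ω]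
    [Fintype Ω] [DecidableEq Ω] (π : G →* P) (ω₀ : Ω) (H : Subgroup G)
    (hH : ∀ x, x ∈ H ↔ π x • ω₀ = ω₀) (t : G → Ω → ℂ)
    (ht : ∀ x g ω, t (x * g * x⁻¹) (π x • ω) = t g ω) (g : G) :
    induce H (fun h => t h ω₀) g =
      open Classical in ∑ ω with (∃ x, π x • ω₀ = ω) ∧ π g • ω = ω, t g ω := by
  classical
  have := Fintype.ofFinite G
  set u : Ω → ℂ := fun ω => if π g • ω = ω then t g ω else 0 with hu
  have h1 : ∀ x : G, (if _hx : x⁻¹ * g * x ∈ H then t (x⁻¹ * g * x) ω₀ else 0) =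
      u (π x • ω₀) := by
    intro x
    have h2 : x⁻¹ * g * x ∈ H ↔ π g • π x • ω₀ = π x • ω₀ := by
      rw [hH, map_mul, map_mul, map_inv, mul_smul, mul_smul, inv_smul_eq_iff]
    have h3 : t (x⁻¹ * g * x) ω₀ = t g (π x • ω₀) := by
      rw [← ht x (x⁻¹ * g * x) ω₀]
      congr 1
      group
    simp only [hu, h2, h3, dite_eq_ite]
  have h4 : ∑ x : G, u (π x • ω₀) =
      ∑ ω, (Finset.univ.filter fun x => π x • ω₀ = ω).card * u ω := by
    rw [← Finset.sum_fiberwise (s := Finset.univ) (g := fun x : G => π x • ω₀)]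
    refine Finset.sum_congr rfl fun ω _ => ?_
    rw [← nsmul_eq_mul]
    refine Finset.sum_eq_card_nsmul fun x hx => ?_
    rw [(Finset.mem_filter.1 hx).2]
  have h5 : ∀ ω, ((Finset.univ.filter fun x => π x • ω₀ = ω).card : ℂ) =
      if ∃ x, π x • ω₀ = ω then (Nat.card H : ℂ) else 0 := by
    intro ω
    split_ifs with hx
    · obtain ⟨x, rfl⟩ := hx
      rw [Nat.card_eq_fintype_card, Fintype.card_subtype]
      congr 1
      refine Finset.card_bij' (fun y _ => x⁻¹ * y) (fun y _ => x * y) ?_ ?_ ?_ ?_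
      · intro y hy
        simp only [Finset.mem_filter, Finset.mem_univ, true_and] at hy ⊢
        rw [hH, map_mul, mul_smul, hy, map_inv, inv_smul_smul]
      · intro y hy
        simp only [Finset.mem_filter, Finset.mem_univ, true_and] at hy ⊢
        rw [map_mul, mul_smul, (hH y).1 hy]
      · intro y _
        simp
      · intro y _
        simp
    · rw [Nat.cast_eq_zero, Finset.card_eq_zero, Finset.filter_eq_empty_iff]
      exact fun x _ h => hx ⟨x, h⟩
  have h0 : (Nat.card H : ℂ) ≠ 0 := by
    rw [Nat.cast_ne_zero]
    exact Nat.card_pos.ne'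
  rw [induce, finsum_eq_sum_of_fintype]
  have h6 : ∑ x : G, (if hx : x⁻¹ * g * x ∈ H then
      (fun h : H => t h ω₀) ⟨x⁻¹ * g * x, hx⟩ else 0) = ∑ x : G, u (π x • ω₀) :=
    Finset.sum_congr rfl fun x _ => h1 x
  rw [inv_mul_eq_iff_eq_mul₀ h0]
  refine Eq.trans ?_ (h6.trans (h4.trans ?_))
  · exact Finset.sum_congr rfl fun x _ => by congr
  · rw [Finset.mul_sum, Finset.sum_filter]
    refine Finset.sum_congr rfl fun ω _ => ?_
    rw [h5]
    by_cases ha : ∃ x, π x • ω₀ = ω <;> by_cases hb : π g • ω = ω <;> simp [hu, ha, hb]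

end HeightOne

namespace HeightOne

/-! ### Virtual characters of symmetric groups -/

open Classical in
theorem card_fixed_filter_mem_repRing {G Ω : Type} [Group G] [Fintype Ω]
    (φ : G →* Equiv.Perm Ω) (c : Ω → Prop) (hc : ∀ g ω, c (φ g ω) ↔ c ω) :
    (fun g => ((Finset.univ.filter fun ω => c ω ∧ φ g ω = ω).card : ℂ)) ∈ RepRing G := by
  let ψ : G →* Equiv.Perm {ω // c ω} :=
    { toFun := fun g => (φ g).subtypePerm (hc g)
      map_one' := by ext; simp
      map_mul' := by intro a b; ext x; simp; rfl }
  convert card_fixed_mem_repRing ψ using 1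
  ext g
  congr 1
  rw [← Finset.card_map (Function.Embedding.subtype c)]
  congr 1
  ext ω
  simp only [Finset.mem_filter, Finset.mem_univ, true_and, Finset.mem_map,
    Function.Embedding.subtype_apply, Subtype.exists, exists_and_right, exists_eq_right, ψ,
    MonoidHom.coe_mk, OneHom.coe_mk, Equiv.Perm.subtypePerm_apply]
  constructor
  · rintro ⟨h1, h2⟩
    exact ⟨h1, Finset.mem_filter.2 ⟨Finset.mem_univ _, Subtype.ext h2⟩⟩
  · rintro ⟨h1, h2⟩
    exact ⟨h1, congrArg Subtype.val (Finset.mem_filter.1 h2).2⟩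

/-- The action of permutations on functions. -/
def permArrow (n : ℕ) (J : Type) : Equiv.Perm (Fin n) →* Equiv.Perm (Fin n → J) where
  toFun σ := Equiv.arrowCongr σ (Equiv.refl J)
  map_one' := rfl
  map_mul' _ _ := rfl

theorem permArrow_apply {n : ℕ} {J : Type} (σ : Equiv.Perm (Fin n)) (f : Fin n → J) (x : Fin n) :
    permArrow n J σ f x = f (σ.symm x) := rfl

theorem permArrow_eq_iff {n : ℕ} {J : Type} (σ : Equiv.Perm (Fin n)) (f : Fin n → J) :
    permArrow n J σ f = f ↔ ∀ x, f (σ x) = f x := by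
  rw [funext_iff]
  constructor
  · intro h x
    have := h (σ x)
    simpa [permArrow_apply] using this.symm
  · intro h x
    have := h (σ.symm x)
    simpa [permArrow_apply] using this.symm

open Classical in
/-- The sign character times the permutation character on functions with fibres of prescribed
sizes. -/
noncomputable def signedYoung (n : ℕ) {J : Type} (ν : J → ℕ) [Fintype J]
    (w : Equiv.Perm (Fin n)) : ℂ :=
  ((Equiv.Perm.sign w : ℤ) : ℂ) *
    (Finset.univ.filter fun g : Fin n → J =>
      (∀ j, (Finset.univ.filter fun x => g x = j).card = ν j) ∧ ∀ x, g (w x) = g x).card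

/-- The sign character. -/
def signHom (n : ℕ) : Equiv.Perm (Fin n) →* ℂ :=
  ((Int.castRingHom ℂ : ℤ →* ℂ).comp (Units.coeHom ℤ)).comp Equiv.Perm.sign

theorem signHom_apply (n : ℕ) (w : Equiv.Perm (Fin n)) :
    signHom n w = ((Equiv.Perm.sign w : ℤ) : ℂ) := rfl

open Classical in
theorem card_fiber_permArrow {n : ℕ} {J : Type} (σ : Equiv.Perm (Fin n)) (g : Fin n → J) (j : J) :
    (Finset.univ.filter fun x => permArrow n J σ g x = j).card =
      (Finset.univ.filter fun x => g x = j).card := by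
  refine Finset.card_equiv σ.symm fun x => ?_
  rw [Finset.mem_filter, Finset.mem_filter, permArrow_apply]
  simp

theorem signedYoung_mem_repRing (n : ℕ) {J : Type} (ν : J → ℕ) [Fintype J] :
    signedYoung n ν ∈ RepRing (Equiv.Perm (Fin n)) := by
  classical
  have h1 := card_fixed_filter_mem_repRing (permArrow n J)
    (fun g => ∀ j, (Finset.univ.filter fun x => g x = j).card = ν j)
    (fun σ g => by simp only [card_fiber_permArrow])
  convert (RepRing _).mul_mem (coe_hom_mem_repRing (signHom n)) h1 using 1
  ext w
  simp only [signedYoung, Pi.mul_apply, permArrow_eq_iff, signHom_apply]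

/-! ### The Frobenius characteristic -/

open MvPolynomial in
/-- The Frobenius characteristic of a function on the symmetric group, up to the factor `n!`. -/
noncomputable def frob (n : ℕ) : (Equiv.Perm (Fin n) → ℂ) →ₗ[ℂ] MvPolynomial (Fin n) ℂ where
  toFun F := ∑ w, ∑ f : Fin n → Fin n with ∀ x, f (w x) = f x, F w • ∏ x, X (f x)
  map_add' F F' := by simp only [Pi.add_apply, add_smul, Finset.sum_add_distrib]
  map_smul' c F := by simp only [Pi.smul_apply, smul_assoc, Finset.smul_sum, RingHom.id_apply]

open MvPolynomial

theorem frob_apply (n : ℕ) (F : Equiv.Perm (Fin n) → ℂ) : frob n F =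
    ∑ w, ∑ f : Fin n → Fin n with ∀ x, f (w x) = f x, F w • ∏ x, X (f x) := rfl

theorem prod_X_eq_monomial {n : ℕ} (f : Fin n → Fin n) :
    (∏ x, X (f x) : MvPolynomial (Fin n) ℂ) = monomial (∑ x, Finsupp.single (f x) 1) 1 := by
  rw [monomial_sum_one]
  rfl

theorem coeff_frob (n : ℕ) (F : Equiv.Perm (Fin n) → ℂ) (μ : Fin n →₀ ℕ) :
    coeff μ (frob n F) = ∑ w, F w * (Finset.univ.filter fun f : Fin n → Fin n =>
      (∑ x, Finsupp.single (f x) 1 = μ) ∧ ∀ x, f (w x) = f x).card := by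
  rw [frob_apply, coeff_sum]
  refine Finset.sum_congr rfl fun w _ => ?_
  rw [coeff_sum]
  simp only [coeff_smul, prod_X_eq_monomial, coeff_monomial, smul_eq_mul]
  rw [← Finset.mul_sum, Finset.sum_boole, Finset.filter_filter]
  simp only [and_comm]

/-- Each coefficient is the sum over the group of `F` times a permutation character, that of the
functions with given content, hence `n!` times an integer. -/
theorem exists_frob_eq_map {n : ℕ} {F : Equiv.Perm (Fin n) → ℂ}
    (hF : F ∈ RepRing (Equiv.Perm (Fin n))) :
    ∃ p : MvPolynomial (Fin n) ℤ, frob n F = (n.factorial : ℂ) • map (Int.castRingHom ℂ) p := by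
  have h1 : ∀ μ, ∃ k : ℤ, coeff μ (frob n F) = (n.factorial : ℂ) * k := by
    intro μ
    classical
    have h2 := card_fixed_filter_mem_repRing (permArrow n (Fin n))
      (fun f => ∑ x, Finsupp.single (f x) 1 = μ) (fun σ f => by
        rw [← Equiv.sum_comp σ]
        simp [permArrow_apply])
    obtain ⟨k, hk⟩ := exists_sum_eq_card_mul ((RepRing _).mul_mem hF h2)
    refine ⟨k, ?_⟩
    rw [Fintype.card_perm, Fintype.card_fin] at hk
    rw [coeff_frob, ← hk]
    refine Finset.sum_congr rfl fun w _ => ?_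
    simp only [Pi.mul_apply, permArrow_eq_iff]
  choose k hk using h1
  refine ⟨∑ μ ∈ (frob n F).support, monomial μ (k μ), ?_⟩
  rw [map_sum, Finset.smul_sum]
  conv_lhs => rw [(frob n F).as_sum]
  refine Finset.sum_congr rfl fun μ _ => ?_
  rw [map_monomial, smul_monomial, hk]
  simp

theorem isSymmetric_frob (n : ℕ) (F : Equiv.Perm (Fin n) → ℂ) : (frob n F).IsSymmetric := by
  intro e
  rw [frob_apply, map_sum]
  refine Finset.sum_congr rfl fun w _ => ?_
  rw [map_sum]
  refine Finset.sum_bij' (fun f _ => e ∘ f) (fun f _ => e.symm ∘ f) ?_ ?_ ?_ ?_ ?_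
  · intro f hf
    simpa using hf
  · intro f hf
    simpa using hf
  · intro f _
    ext; simp
  · intro f _
    ext; simp
  · intro f _
    rw [map_smul, map_prod]
    simp

theorem isHomogeneous_frob (n : ℕ) (F : Equiv.Perm (Fin n) → ℂ) :
    (frob n F).IsHomogeneous n := by
  rw [frob_apply]
  refine IsHomogeneous.sum _ _ _ fun w _ => IsHomogeneous.sum _ _ _ fun f _ => ?_
  rw [smul_eq_C_mul]
  have h1 := IsHomogeneous.prod (Finset.univ : Finset (Fin n))
    (fun x => (X (f x) : MvPolynomial (Fin n) ℂ)) (fun _ => 1) (fun x _ => isHomogeneous_X _ _)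
  simp only [Finset.sum_const, Finset.card_univ, Fintype.card_fin, smul_eq_mul, mul_one] at h1
  simpa using (isHomogeneous_C (Fin n) (F w)).mul h1

theorem isHomogeneous_esymm' (n k : ℕ) : (esymm (Fin n) ℂ k).IsHomogeneous k := by
  refine IsHomogeneous.sum _ _ _ fun t ht => ?_
  have h1 := IsHomogeneous.prod t
    (fun x => (X x : MvPolynomial (Fin n) ℂ)) (fun _ => 1) (fun x _ => isHomogeneous_X _ _)
  simpa [(Finset.mem_powersetCard.1 ht).2] using h1

/-- Signs cancel over the subgroup of permutations that preserve a function, unless the function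
is injective. -/
theorem sum_sign_preserving {n : ℕ} {Y : Type} [DecidableEq Y] (h : Fin n → Y) :
    (∑ w : Equiv.Perm (Fin n) with ∀ x, h (w x) = h x, ((Equiv.Perm.sign w : ℤ) : ℂ)) =
      if Function.Injective h then 1 else 0 := by
  split_ifs with hh
  · have h1 : (Finset.univ.filter fun w : Equiv.Perm (Fin n) => ∀ x, h (w x) = h x) = {1} := by
      ext w
      simp only [Finset.mem_filter, Finset.mem_univ, true_and, Finset.mem_singleton]
      refine ⟨fun hw => Equiv.ext fun x => hh (hw x), ?_⟩
      rintro rfl x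
      rfl
    rw [h1]
    simp
  · rw [Function.Injective] at hh
    push Not at hh
    obtain ⟨a, b, hab, hne⟩ := hh
    have hs : ∀ x, h (Equiv.swap a b x) = h x := by
      intro x
      rcases Equiv.swap_apply_def a b x with h1
      rw [h1]
      split_ifs with h2 h3
      · rw [h2, hab]
      · rw [h3, hab]
      · rfl
    -- Multiplication by the transposition of two points with equal values is a sign-reversing
    -- involution without fixed points.
    refine Finset.sum_involution (fun w _ => w * Equiv.swap a b) ?_ ?_ ?_ ?_
    · intro w _
      simp [Equiv.Perm.sign_swap hne]
    · intro w _ _ h1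
      exact hne (Equiv.swap_eq_one_iff.1 (mul_eq_left.1 h1))
    · intro w hw
      simp only [Finset.mem_filter, Finset.mem_univ, true_and] at hw ⊢
      intro x
      rw [Equiv.Perm.mul_apply, hw, hs]
    · intro w _
      simp [mul_assoc]

theorem card_injective_image_eq {n : ℕ} {Y : Type} [Fintype Y] [DecidableEq Y] (U : Finset Y)
    (hU : U.card = n) : (Finset.univ.filter fun h : Fin n → Y =>
      Function.Injective h ∧ Finset.univ.image h = U).card = n.factorial := by
  have h0 : Fintype.card (Fin n) = Fintype.card U := by simp [hU]
  have h1 := Fintype.card_equiv (Fintype.equivOfCardEq h0)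
  rw [Fintype.card_fin] at h1
  rw [← h1, ← Finset.card_univ]
  refine Finset.card_bij'
    (fun h hh => Equiv.ofBijective (fun x => (⟨h x, by
      rw [← (Finset.mem_filter.1 hh).2.2]; simp⟩ : U)) ?_)
    (fun e _ x => (e x : Y)) ?_ ?_ ?_ ?_
  · rw [Fintype.bijective_iff_injective_and_card]
    exact ⟨fun a b hab => (Finset.mem_filter.1 hh).2.1 (congrArg Subtype.val hab), h0⟩
  · intro h hh
    exact Finset.mem_univ _
  · intro e _
    simp only [Finset.mem_filter, Finset.mem_univ, true_and]
    refine ⟨Subtype.val_injective.comp e.injective, ?_⟩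
    ext y
    simp only [Finset.mem_image, Finset.mem_univ, true_and]
    refine ⟨?_, fun hy => ⟨e.symm ⟨y, hy⟩, by simp⟩⟩
    rintro ⟨x, rfl⟩
    exact (e x).2
  · intro h hh
    rfl
  · intro e _
    ext
    rfl

end HeightOne

namespace HeightOne

/-! ### Signed Young characters and elementary symmetric polynomials -/

open MvPolynomial

open Classical in
theorem prod_esymm_eq_sum {n : ℕ} {J : Type} [Fintype J] (ν : J → ℕ) :
    (∏ j, esymm (Fin n) ℂ (ν j)) =
      ∑ T : J → Finset (Fin n) with ∀ j, (T j).card = ν j, ∏ j, ∏ i ∈ T j, X i := by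
  simp only [esymm]
  rw [Finset.prod_univ_sum]
  refine Finset.sum_congr ?_ fun _ _ => rfl
  ext T
  simp

-- An injective `h` amounts to a choice, for each colour `j`, of a set `T j` of `ν j` indices, and
-- an enumeration of the `n` pairs `(i, j)` with `i ∈ T j`. Each family `T` has `n!` enumerations
-- and contributes one monomial of the product.
open Classical in
theorem sum_injective_eq {n : ℕ} {J : Type} [Fintype J] (ν : J → ℕ) (hν : ∑ j, ν j = n) :
    (∑ h : Fin n → Fin n × J with Function.Injective h ∧
      ∀ j, (Finset.univ.filter fun x => (h x).2 = j).card = ν j,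
        ∏ x, (X (h x).1 : MvPolynomial (Fin n) ℂ)) =
      (n.factorial : ℂ) • ∏ j, esymm (Fin n) ℂ (ν j) := by
  rw [prod_esymm_eq_sum, Finset.smul_sum]
  let τ : (Fin n → Fin n × J) → J → Finset (Fin n) :=
    fun h j => (Finset.univ.filter fun x => (h x).2 = j).image fun x => (h x).1
  have hτcard : ∀ h, Function.Injective h → ∀ j,
      (τ h j).card = (Finset.univ.filter fun x => (h x).2 = j).card := by
    intro h hh j
    refine Finset.card_image_of_injOn fun x hx y hy hxy => hh (Prod.ext hxy ?_)
    simp only [Finset.coe_filter, Finset.mem_univ, true_and] at hx hy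
    exact hx.trans hy.symm
  rw [← Finset.sum_fiberwise_of_maps_to (g := τ)
    (t := Finset.univ.filter fun T : J → Finset (Fin n) => ∀ j, (T j).card = ν j)]
  · refine Finset.sum_congr rfl fun T hT => ?_
    simp only [Finset.mem_filter, Finset.mem_univ, true_and] at hT
    let U : Finset (Fin n × J) := Finset.univ.filter fun y => y.1 ∈ T y.2
    have hU : ∀ φ : Fin n × J → MvPolynomial (Fin n) ℂ,
        ∏ y ∈ U, φ y = ∏ j, ∏ i ∈ T j, φ (i, j) := by
      intro φ
      rw [Finset.prod_filter, Fintype.prod_prod_type_right]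
      refine Finset.prod_congr rfl fun j _ => ?_
      rw [← Finset.prod_filter]
      refine Finset.prod_congr ?_ fun _ _ => rfl
      ext
      simp
    have hUcard : U.card = n := by
      refine Eq.trans ?_ hν
      rw [Finset.card_filter, Fintype.sum_prod_type_right]
      refine Finset.sum_congr rfl fun j _ => ?_
      rw [← Finset.card_filter, ← hT j]
      congr 1
      ext
      simp
    have hfib : ((Finset.univ.filter fun h : Fin n → Fin n × J => Function.Injective h ∧
        ∀ j, (Finset.univ.filter fun x => (h x).2 = j).card = ν j).filter fun h => τ h = T) =
        Finset.univ.filter fun h => Function.Injective h ∧ Finset.univ.image h = U := by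
      ext h
      simp only [Finset.mem_filter, Finset.mem_univ, true_and]
      constructor
      · rintro ⟨⟨hh, _⟩, rfl⟩
        refine ⟨hh, ?_⟩
        ext ⟨i, j⟩
        simp [U, τ, Prod.ext_iff, and_comm]
      · rintro ⟨hh, hU'⟩
        have hτ : τ h = T := by
          ext j i
          have h1 : (i, j) ∈ U ↔ (i, j) ∈ Finset.univ.image h := by rw [hU']
          simp only [U, Finset.mem_filter, Finset.mem_univ, true_and, Finset.mem_image,
            Prod.ext_iff] at h1
          simp [τ, h1, and_comm]
        exact ⟨⟨hh, fun j => by rw [← hτcard h hh, hτ, hT]⟩, hτ⟩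
    rw [hfib]
    have hconst : ∀ h ∈ Finset.univ.filter fun h : Fin n → Fin n × J =>
        Function.Injective h ∧ Finset.univ.image h = U,
        ∏ x, (X (h x).1 : MvPolynomial (Fin n) ℂ) = ∏ j, ∏ i ∈ T j, X i := by
      intro h hh
      obtain ⟨hh, hU'⟩ := (Finset.mem_filter.1 hh).2
      rw [← hU (fun y => X y.1), ← hU', Finset.prod_image fun x _ y _ hxy => hh hxy]
    rw [Finset.sum_eq_card_nsmul hconst, card_injective_image_eq U hUcard, Nat.cast_smul_eq_nsmul]
  · intro h hh
    simp only [Finset.mem_filter, Finset.mem_univ, true_and] at hh ⊢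
    exact fun j => (hτcard h hh.1 j).trans (hh.2 j)

/-- Sum over `w` first: for fixed `f` and `g` the signs cancel unless `x ↦ (f x, g x)` is injective,
which leaves the sum of `sum_injective_eq`. If the parts do not add up to `n`, no function has these
fibre sizes and the product of elementary polynomials has the wrong degree, so both sides vanish. -/
theorem frob_signedYoung (n : ℕ) {J : Type} [Fintype J] (ν : J → ℕ) :
    frob n (signedYoung n ν) =
      (n.factorial : ℂ) • homogeneousComponent n (∏ j, esymm (Fin n) ℂ (ν j)) := by
  classical
  have hhom : (∏ j, esymm (Fin n) ℂ (ν j)).IsHomogeneous (∑ j, ν j) :=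
    IsHomogeneous.prod _ _ _ fun j _ => isHomogeneous_esymm' n (ν j)
  by_cases hν : ∑ j, ν j = n
  · rw [homogeneousComponent_of_mem (m := n) (by rwa [hν] at hhom), if_pos rfl,
      ← sum_injective_eq ν hν, frob_apply]
    have h1 : ∀ (w : Equiv.Perm (Fin n)) (f : Fin n → Fin n),
        (signedYoung n ν w • ∏ x, X (f x) : MvPolynomial (Fin n) ℂ) =
        ∑ g : Fin n → J with (∀ j, (Finset.univ.filter fun x => g x = j).card = ν j),
          (if ∀ x, g (w x) = g x then ((Equiv.Perm.sign w : ℤ) : ℂ) else 0) • ∏ x, X (f x) := by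
      intro w f
      rw [← Finset.sum_smul, ← Finset.sum_filter, Finset.filter_filter, Finset.sum_const,
        nsmul_eq_mul, mul_comm]
      rfl
    have h2 : (∑ w : Equiv.Perm (Fin n), ∑ f : Fin n → Fin n with ∀ x, f (w x) = f x,
        (signedYoung n ν w • ∏ x, X (f x) : MvPolynomial (Fin n) ℂ)) =
        ∑ f : Fin n → Fin n,
          ∑ g : Fin n → J with (∀ j, (Finset.univ.filter fun x => g x = j).card = ν j),
          (∑ w : Equiv.Perm (Fin n) with ∀ x, (f (w x), g (w x)) = (f x, g x),
            ((Equiv.Perm.sign w : ℤ) : ℂ)) • ∏ x, X (f x) := by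
      simp only [Finset.sum_filter (s := (Finset.univ : Finset (Fin n → Fin n)))]
      rw [Finset.sum_comm]
      refine Finset.sum_congr rfl fun f _ => ?_
      simp only [h1]
      rw [← Finset.sum_filter, Finset.sum_comm]
      refine Finset.sum_congr rfl fun g _ => ?_
      rw [← Finset.sum_smul, ← Finset.sum_filter, Finset.filter_filter]
      simp only [Prod.mk.injEq, forall_and]
    rw [h2, Finset.sum_filter, ← Equiv.sum_comp (Equiv.arrowProdEquivProdArrow _ _ _).symm,
      Fintype.sum_prod_type]
    refine Finset.sum_congr rfl fun f _ => ?_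
    rw [Finset.sum_filter]
    refine Finset.sum_congr rfl fun g _ => ?_
    rw [sum_sign_preserving (fun x => (f x, g x))]
    change _ = if Function.Injective (fun x => (f x, g x)) ∧
      (∀ j, (Finset.univ.filter fun x => g x = j).card = ν j) then (∏ x, X (f x)) else 0
    by_cases ha : Function.Injective (fun x => (f x, g x)) <;>
      by_cases hb : ∀ j, (Finset.univ.filter fun x => g x = j).card = ν j <;> simp [ha, hb]
  · rw [homogeneousComponent_of_mem hhom, if_neg (Ne.symm hν), smul_zero]
    have h1 : signedYoung n ν = 0 := by
      ext w
      rw [signedYoung, Finset.filter_eq_empty_iff.2, Finset.card_empty, Nat.cast_zero, mul_zero]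
      · rfl
      · rintro g - ⟨hg, -⟩
        refine hν ?_
        simp only [← hg]
        rw [← Finset.card_eq_sum_card_fiberwise (f := g) (t := Finset.univ)
          (fun x _ => Finset.mem_coe.2 (Finset.mem_univ _)), Finset.card_univ, Fintype.card_fin]
    rw [h1, map_zero]

/-- The cycle type records the sizes of the supports of the cycles, and these supports are the
nontrivial classes of `SameCycle`. Distinct cycles have distinct supports, so the set of supports
loses no multiplicity. -/
theorem cycleType_eq_of_sameCycle_iff {n : ℕ} {v w : Equiv.Perm (Fin n)}
    (h : ∀ x y, v.SameCycle x y ↔ w.SameCycle x y) : v.cycleType = w.cycleType := by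
  have hsupp : ∀ u : Equiv.Perm (Fin n), ∀ x, x ∈ u.support ↔ ∃ y, y ≠ x ∧ u.SameCycle x y := by
    intro u x
    rw [Equiv.Perm.mem_support]
    constructor
    · exact fun hx => ⟨u x, hx, Equiv.Perm.sameCycle_apply_right.2 (Equiv.Perm.SameCycle.refl u x)⟩
    · rintro ⟨y, hy, hxy⟩ hx
      exact hy ((hxy.eq_of_left hx).symm)
  have himage : ∀ u : Equiv.Perm (Fin n),
      u.cycleType = (u.cycleFactorsFinset.image Equiv.Perm.support).val.map Finset.card := by
    intro u
    rw [Equiv.Perm.cycleType_def, Finset.image_val_of_injOn, Multiset.map_map]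
    intro c hc d hd hcd
    by_contra hne
    have h1 := u.cycleFactorsFinset_pairwise_disjoint hc hd hne
    rw [Equiv.Perm.disjoint_iff_disjoint_support, hcd, disjoint_self] at h1
    exact (Equiv.Perm.mem_cycleFactorsFinset_iff.1 hd).1.ne_one
      (Equiv.Perm.support_eq_empty_iff.1 h1)
  have hfac : ∀ u : Equiv.Perm (Fin n), u.cycleFactorsFinset.image Equiv.Perm.support =
      u.support.image fun x => Finset.univ.filter fun y => u.SameCycle x y := by
    intro u
    ext s
    simp only [Finset.mem_image]
    constructor
    · rintro ⟨c, hc, rfl⟩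
      obtain ⟨x, hx⟩ := (Equiv.Perm.mem_cycleFactorsFinset_iff.1 hc).1.nonempty_support
      have hxu := Equiv.Perm.mem_cycleFactorsFinset_support_le hc hx
      refine ⟨x, hxu, ?_⟩
      rw [Equiv.Perm.cycle_is_cycleOf hx hc]
      ext y
      rw [Equiv.Perm.mem_support_cycleOf_iff' (Equiv.Perm.mem_support.1 hxu)]
      simp
    · rintro ⟨x, hx, rfl⟩
      refine ⟨u.cycleOf x, Equiv.Perm.cycleOf_mem_cycleFactorsFinset_iff.2 hx, ?_⟩
      ext y
      rw [Equiv.Perm.mem_support_cycleOf_iff' (Equiv.Perm.mem_support.1 hx)]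
      simp
  rw [himage, himage, hfac, hfac]
  have h1 : v.support = w.support := by
    ext x
    simp only [hsupp, h]
  simp only [h1, h]

/-- A class function is determined by its sums over Young subgroups. -/
theorem eq_zero_of_sum_preserving_eq_zero {n : ℕ} {F : Equiv.Perm (Fin n) → ℂ}
    (hF : ∀ x g, F (x * g * x⁻¹) = F g)
    (h : ∀ f : Fin n → Fin n, (∑ w : Equiv.Perm (Fin n) with ∀ x, f (w x) = f x, F w) = 0) :
    F = 0 := by
  classical
  -- The induction is on the number of pairs that share a cycle.
  let N : Equiv.Perm (Fin n) → ℕ := fun w =>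
    (Finset.univ.filter fun p : Fin n × Fin n => w.SameCycle p.1 p.2).card
  suffices H : ∀ k, ∀ w, N w = k → F w = 0 from funext fun w => H _ w rfl
  intro k
  induction k using Nat.strong_induction_on with
  | _ k ih =>
    rintro w rfl
    -- `f` labels the cycles of `w`, so a permutation that preserves `f` has cycles contained in
    -- those of `w`. Either its cycles are the same and it is conjugate to `w`, or `N` drops and `F`
    -- vanishes by induction. The sum over these permutations is thus a positive multiple of `F w`.
    let f : Fin n → Fin n := fun x => (Quotient.mk (Equiv.Perm.SameCycle.setoid w) x).out
    have hf : ∀ x y, f x = f y ↔ w.SameCycle x y := by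
      intro x y
      rw [Quotient.out_inj]
      exact Quotient.eq
    have hconst : ∀ v ∈ Finset.univ.filter fun v : Equiv.Perm (Fin n) => ∀ x, f (v x) = f x,
        F v = if ∀ x y, v.SameCycle x y ↔ w.SameCycle x y then F w else 0 := by
      intro v hv
      simp only [Finset.mem_filter, Finset.mem_univ, true_and] at hv
      have hle : ∀ x y, v.SameCycle x y → w.SameCycle x y := by
        rintro x _ ⟨i, rfl⟩
        rw [← hf]
        have h1 : ∀ (u : Equiv.Perm (Fin n)), u ∈ Subgroup.zpowers v → ∀ x, f (u x) = f x := by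
          have h2 : Subgroup.zpowers v ≤
              { carrier := {u | ∀ x, f (u x) = f x}
                mul_mem' := fun {a b} ha hb x => (ha (b x)).trans (hb x)
                one_mem' := fun x => rfl
                inv_mem' := fun {a} ha x => by
                  have := ha (a⁻¹ x)
                  rw [← Equiv.Perm.mul_apply, mul_inv_cancel] at this
                  exact this.symm } := by
            rw [Subgroup.zpowers_le]
            exact hv
          exact fun u hu => h2 hu
        exact (h1 _ ⟨i, rfl⟩ x).symm
      split_ifs with heq
      · obtain ⟨c, hc⟩ := isConj_iff.1
          (Equiv.Perm.isConj_iff_cycleType_eq.2 (cycleType_eq_of_sameCycle_iff heq))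
        rw [← hc, hF]
      · refine ih (N v) (Finset.card_lt_card ?_) v rfl
        rw [Finset.ssubset_iff_subset_ne]
        refine ⟨fun p hp => ?_, fun hE => heq fun x y => ?_⟩
        · simp only [Finset.mem_filter, Finset.mem_univ, true_and] at hp ⊢
          exact hle _ _ hp
        · have := congrArg ((x, y) ∈ ·) hE
          simpa using this
    have h1 := h f
    rw [Finset.sum_congr rfl hconst, ← Finset.sum_filter, Finset.sum_const, smul_eq_zero] at h1
    refine h1.resolve_left (Finset.card_ne_zero_of_mem (a := w) ?_)
    simp only [Finset.mem_filter, Finset.mem_univ, true_and, implies_true, and_true]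
    intro x
    rw [hf]
    exact Equiv.Perm.sameCycle_apply_left.2 (Equiv.Perm.SameCycle.refl w x)

/-- The coefficient at the content of `f₀` is the sum of `S f` over all `f` with this content. Any
such `f` is `f₀ ∘ e` for a permutation `e`, so `S f = S f₀` for a class function, and `S f₀ = 0`
follows. -/
theorem frob_eq_zero {n : ℕ} {F : Equiv.Perm (Fin n) → ℂ}
    (hF : ∀ x g, F (x * g * x⁻¹) = F g) (h0 : frob n F = 0) : F = 0 := by
  classical
  refine eq_zero_of_sum_preserving_eq_zero hF fun f₀ => ?_
  let S : (Fin n → Fin n) → ℂ := fun f => ∑ w : Equiv.Perm (Fin n) with ∀ x, f (w x) = f x, F w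
  change S f₀ = 0
  have hS : ∀ f : Fin n → Fin n, (∑ x, Finsupp.single (f x) 1 : Fin n →₀ ℕ) =
      ∑ x, Finsupp.single (f₀ x) 1 → S f = S f₀ := by
    intro f hf
    have h1 : ∀ (f : Fin n → Fin n) (i : Fin n),
        (∑ x, Finsupp.single (f x) 1 : Fin n →₀ ℕ) i = Fintype.card {x // f x = i} := by
      intro f i
      rw [Finsupp.finsetSum_apply, Fintype.card_subtype, Finset.card_filter]
      simp only [Finsupp.single_apply]
    have h2 : ∀ i, Nonempty ({x // f x = i} ≃ {x // f₀ x = i}) := fun i =>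
      Fintype.card_eq.1 (by rw [← h1, ← h1, hf])
    let e : Equiv.Perm (Fin n) := (Equiv.sigmaFiberEquiv f).symm.trans
      ((Equiv.sigmaCongrRight fun i => (h2 i).some).trans (Equiv.sigmaFiberEquiv f₀))
    have he : ∀ x, f₀ (e x) = f x := fun x => ((h2 (f x)).some ⟨x, rfl⟩).2
    refine Finset.sum_bij' (fun w _ => e * w * e⁻¹) (fun w _ => e⁻¹ * w * e) ?_ ?_ ?_ ?_ ?_
    · intro w hw
      simp only [Finset.mem_filter, Finset.mem_univ, true_and, Equiv.Perm.mul_apply] at hw ⊢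
      intro x
      rw [he, hw, ← he, ← Equiv.Perm.mul_apply, mul_inv_cancel, Equiv.Perm.one_apply]
    · intro w hw
      simp only [Finset.mem_filter, Finset.mem_univ, true_and, Equiv.Perm.mul_apply] at hw ⊢
      intro x
      rw [← he, ← Equiv.Perm.mul_apply e, mul_inv_cancel, Equiv.Perm.one_apply, hw, he]
    · intro w _
      group
    · intro w _
      group
    · intro w _
      exact (hF e w).symm
  have h3 := coeff_frob n F (∑ x, Finsupp.single (f₀ x) 1)
  have h4 : ∑ w, F w * (Finset.univ.filter fun f : Fin n → Fin n =>
      (∑ x, Finsupp.single (f x) 1 = (∑ x, Finsupp.single (f₀ x) 1 : Fin n →₀ ℕ)) ∧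
        ∀ x, f (w x) = f x).card =
      ∑ f : Fin n → Fin n with
        (∑ x, Finsupp.single (f x) 1 = (∑ x, Finsupp.single (f₀ x) 1 : Fin n →₀ ℕ)), S f := by
    simp only [S, Finset.sum_filter (s := (Finset.univ : Finset (Equiv.Perm (Fin n))))]
    rw [Finset.sum_comm]
    refine Finset.sum_congr rfl fun w _ => ?_
    rw [← Finset.sum_filter, Finset.filter_filter, Finset.sum_const, nsmul_eq_mul, mul_comm]
  rw [h0, coeff_zero] at h3
  have h5 := h3.trans h4
  rw [Finset.sum_congr rfl fun f hf => hS f (Finset.mem_filter.1 hf).2, Finset.sum_const] at h5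
  refine (smul_eq_zero.1 h5.symm).resolve_left (Finset.card_ne_zero_of_mem (a := f₀) ?_)
  simp

/-- The representation ring of a symmetric group is spanned by the signed Young permutation
characters. -/
theorem repRing_perm_le_closure {n : ℕ} {F : Equiv.Perm (Fin n) → ℂ}
    (hF : F ∈ RepRing (Equiv.Perm (Fin n))) :
    F ∈ AddSubgroup.closure {E | ∃ (J : Type) (_ : Fintype J) (ν : J → ℕ),
      E = signedYoung n ν} := by
  obtain ⟨p, hp⟩ := exists_frob_eq_map hF
  have hn0 : (n.factorial : ℂ) ≠ 0 := Nat.cast_ne_zero.2 n.factorial_ne_zero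
  have hinj : Function.Injective (map (σ := Fin n) (Int.castRingHom ℂ)) :=
    map_injective _ Int.cast_injective
  have hsymm : p.IsSymmetric := by
    intro e
    refine hinj ?_
    have h1 := isSymmetric_frob n F e
    rw [hp, map_smul] at h1
    rw [map_rename]
    exact smul_right_injective _ hn0 h1
  -- Integrality is essential here: the fundamental theorem over `ℤ` writes `p` as an integral
  -- polynomial in the elementary symmetric ones, so the final coefficients are integers.
  obtain ⟨q, hq⟩ := esymmAlgHom_surjective (σ := Fin n) ℤ (n := n) (by simp) ⟨p, hsymm⟩
  have hq' : aeval (fun i : Fin n => esymm (Fin n) ℤ (i + 1)) q = p := by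
    rw [← esymmAlgHom_apply, hq]
  let E : (Fin n →₀ ℕ) → Equiv.Perm (Fin n) → ℂ := fun d =>
    signedYoung n (J := Σ i : Fin n, Fin (d i)) fun j => j.1 + 1
  have hE : ∀ d, frob n (E d) = (n.factorial : ℂ) • homogeneousComponent n
      (∏ i : Fin n, esymm (Fin n) ℂ (i + 1) ^ d i) := by
    intro d
    rw [frob_signedYoung, Fintype.prod_sigma]
    simp
  have hmap : map (Int.castRingHom ℂ) p =
      ∑ d ∈ q.support, ((coeff d q : ℤ) : ℂ) • ∏ i : Fin n, esymm (Fin n) ℂ (i + 1) ^ d i := by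
    rw [← hq', aeval_def, eval₂_eq', map_sum]
    refine Finset.sum_congr rfl fun d _ => ?_
    rw [map_mul, map_prod, smul_eq_C_mul]
    simp only [map_pow, map_esymm]
    congr 1
    simp
  -- `q` may contain monomials of any weight; taking the component of degree `n`, in which `frob n
  -- F` already lies, discards the others.
  have hfrob : frob n F = frob n (∑ d ∈ q.support, ((coeff d q : ℤ) : ℂ) • E d) := by
    rw [map_sum]
    simp only [map_smul, hE]
    have h1 := homogeneousComponent_eq_self (isHomogeneous_frob n F)
    rw [← h1, hp, hmap, map_smul, map_sum, Finset.smul_sum]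
    refine Finset.sum_congr rfl fun d _ => ?_
    rw [map_smul, smul_comm]
  have hclass : ∀ x g, (∑ d ∈ q.support, ((coeff d q : ℤ) : ℂ) • E d) (x * g * x⁻¹) =
      (∑ d ∈ q.support, ((coeff d q : ℤ) : ℂ) • E d) g := by
    intro x g
    simp only [Finset.sum_apply, Pi.smul_apply]
    refine Finset.sum_congr rfl fun d _ => ?_
    rw [show E d (x * g * x⁻¹) = E d g from repRing_conj (signedYoung_mem_repRing n _) x g]
  have hFE : F = ∑ d ∈ q.support, ((coeff d q : ℤ) : ℂ) • E d := by
    rw [← sub_eq_zero]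
    refine frob_eq_zero (fun x g => ?_) (by rw [map_sub, hfrob, sub_self])
    simp only [Pi.sub_apply]
    rw [hclass, repRing_conj hF]
  rw [hFE]
  refine AddSubgroup.sum_mem _ fun d _ => ?_
  rw [Int.cast_smul_eq_zsmul]
  refine AddSubgroup.zsmul_mem _ ?_ _
  exact AddSubgroup.subset_closure ⟨_, _, _, rfl⟩

end HeightOne

namespace HeightOne

/-! ### Isotypic projections for finite abelian groups -/

section Isotypic

theorem addChar_ofMul_mul {B : Type} [CommGroup B] (χ : AddChar (Additive B) ℂ) (a b : B) :
    χ (Additive.ofMul (a * b)) = χ (Additive.ofMul a) * χ (Additive.ofMul b) := by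
  rw [ofMul_mul, AddChar.map_add_eq_mul]

variable {B V : Type} [CommGroup B] [Fintype B] [AddCommGroup V] [Module ℂ V]

/-- The projection of a representation of a finite abelian group onto the isotypic part of a
character. -/
noncomputable def isoProj (ρ : Representation ℂ B V) (χ : AddChar (Additive B) ℂ) :
    Module.End ℂ V :=
  (Fintype.card B : ℂ)⁻¹ • ∑ b : B, χ (Additive.ofMul b⁻¹) • ρ b

theorem card_ne_zero_complex (B : Type) [Group B] [Fintype B] : (Fintype.card B : ℂ) ≠ 0 :=
  Nat.cast_ne_zero.2 Fintype.card_ne_zero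

theorem mul_isoProj (ρ : Representation ℂ B V) (χ : AddChar (Additive B) ℂ) (b : B) :
    ρ b * isoProj ρ χ = χ (Additive.ofMul b) • isoProj ρ χ := by
  rw [isoProj, mul_smul_comm, smul_comm]
  congr 1
  rw [Finset.mul_sum, Finset.smul_sum,
    ← Equiv.sum_comp (Equiv.mulLeft b) fun c => χ (Additive.ofMul b) •
    χ (Additive.ofMul c⁻¹) • ρ c]
  refine Finset.sum_congr rfl fun c _ => ?_
  rw [mul_smul_comm, ← map_mul, smul_smul, ← addChar_ofMul_mul, Equiv.coe_mulLeft, mul_inv,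
    mul_inv_cancel_left]

theorem isoProj_mul_comm (ρ : Representation ℂ B V) (χ : AddChar (Additive B) ℂ) (b : B) :
    isoProj ρ χ * ρ b = ρ b * isoProj ρ χ := by
  rw [isoProj, mul_smul_comm, smul_mul_assoc, Finset.mul_sum, Finset.sum_mul]
  congr 1
  refine Finset.sum_congr rfl fun c _ => ?_
  rw [mul_smul_comm, smul_mul_assoc, ← map_mul, ← map_mul, mul_comm]

theorem isoProj_mul_isoProj (ρ : Representation ℂ B V) (χ ψ : AddChar (Additive B) ℂ) :
    isoProj ρ χ * isoProj ρ ψ = if χ = ψ then isoProj ρ ψ else 0 := by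
  have h1 : ∀ b : B, (χ (Additive.ofMul b⁻¹) • ρ b) * isoProj ρ ψ =
      (ψ - χ) (Additive.ofMul b) • isoProj ρ ψ := by
    intro b
    rw [smul_mul_assoc, mul_isoProj, smul_smul, AddChar.sub_apply, mul_comm]
    rfl
  have h2 : isoProj ρ χ * isoProj ρ ψ =
      (Fintype.card B : ℂ)⁻¹ • ∑ b : B, (ψ - χ) (Additive.ofMul b) • isoProj ρ ψ := by
    conv_lhs => rw [isoProj]
    rw [smul_mul_assoc, Finset.sum_mul]
    simp only [h1]
  have h3 : ∑ b : B, (ψ - χ) (Additive.ofMul b) =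
      if ψ - χ = 0 then (Fintype.card B : ℂ) else 0 := by
    rw [← Fintype.card_additive B, ← AddChar.sum_eq_ite (ψ - χ)]
    exact Equiv.sum_comp Additive.ofMul fun b => (ψ - χ) b
  rw [h2, ← Finset.sum_smul, h3, smul_smul]
  simp only [sub_eq_zero, eq_comm (a := ψ)]
  split_ifs
  · rw [inv_mul_cancel₀ (card_ne_zero_complex B), one_smul]
  · rw [mul_zero, zero_smul]

theorem sum_isoProj (ρ : Representation ℂ B V) : ∑ χ, isoProj ρ χ = 1 := by
  classical
  simp only [isoProj]
  rw [← Finset.smul_sum, Finset.sum_comm]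
  simp only [← Finset.sum_smul]
  have h1 : ∀ b : B, ∑ χ : AddChar (Additive B) ℂ, χ (Additive.ofMul b⁻¹) =
      if b = 1 then (Fintype.card B : ℂ) else 0 := by
    intro b
    rw [AddChar.sum_apply_eq_ite (Additive.ofMul b⁻¹), Fintype.card_additive]
    refine if_congr ?_ rfl rfl
    rw [ofMul_eq_zero, inv_eq_one]
  simp only [h1, ite_smul, zero_smul, Finset.sum_ite_eq', Finset.mem_univ, if_true]
  rw [map_one, smul_smul, inv_mul_cancel₀ (card_ne_zero_complex B), one_smul]

/-- A sum of distinct isotypic projections is idempotent. -/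
theorem sum_isoProj_mul_sum_isoProj (ρ : Representation ℂ B V)
    (s t : Finset (AddChar (Additive B) ℂ)) :
    (∑ χ ∈ s, isoProj ρ χ) * ∑ χ ∈ t, isoProj ρ χ = ∑ χ ∈ s ∩ t, isoProj ρ χ := by
  rw [Finset.sum_mul_sum]
  simp only [isoProj_mul_isoProj, Finset.sum_ite_eq]
  rw [← Finset.sum_filter, Finset.filter_mem_eq_inter]

end Isotypic

/-! ### Characters of wreath products -/

section Wreath

variable {A : Type} [CommGroup A] {l : ℕ}

/-- The action of permutations on the characters of `A^l`. -/
def permChar (σ : Equiv.Perm (Fin l)) (χ : AddChar (Additive (Fin l → A)) ℂ) :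
    AddChar (Additive (Fin l → A)) ℂ :=
  χ.compAddMonoidHom (MonoidHom.toAdditive
    (mulAutArrow (G := Equiv.Perm (Fin l)) (A := Fin l) (M := A) σ⁻¹).toMonoidHom)

theorem permChar_apply (σ : Equiv.Perm (Fin l)) (χ : AddChar (Additive (Fin l → A)) ℂ)
    (b : Fin l → A) :
    permChar σ χ (Additive.ofMul b) = χ (Additive.ofMul fun i => b (σ i)) := by
  change χ (Additive.ofMul fun i => b ((σ⁻¹)⁻¹ i)) = _
  rw [inv_inv]

/-- The coordinates of a character of `A^l`. -/
def coordChar [DecidableEq (Fin l)] (χ : AddChar (Additive (Fin l → A)) ℂ) (i : Fin l) :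
    AddChar (Additive A) ℂ :=
  χ.compAddMonoidHom (MonoidHom.toAdditive (MonoidHom.mulSingle (fun _ : Fin l => A) i))

theorem addChar_eq_prod_coordChar (χ : AddChar (Additive (Fin l → A)) ℂ) (b : Fin l → A) :
    χ (Additive.ofMul b) = ∏ i, coordChar χ i (Additive.ofMul (b i)) := by
  conv_lhs => rw [← Finset.univ_prod_mulSingle b]
  exact map_prod χ.toMonoidHom
    (fun i => Multiplicative.ofAdd (Additive.ofMul (Pi.mulSingle i (b i)))) Finset.univ

theorem coordChar_permChar (σ : Equiv.Perm (Fin l)) (χ : AddChar (Additive (Fin l → A)) ℂ)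
    (i : Fin l) : coordChar (permChar σ χ) i = coordChar χ (σ⁻¹ i) := by
  ext a
  change permChar σ χ (Additive.ofMul (Pi.mulSingle i (Additive.toMul a))) =
    χ (Additive.ofMul (Pi.mulSingle (σ⁻¹ i) (Additive.toMul a)))
  rw [permChar_apply]
  congr 2
  ext j
  simp only [Pi.mulSingle_apply, Equiv.Perm.eq_inv_iff_eq]

open Classical in
/-- The coordinates at which a character of `A^l` takes a value chosen among its values. -/
noncomputable def chosenSet [NeZero l] (χ : AddChar (Additive (Fin l → A)) ℂ) : Finset (Fin l) :=
  Finset.univ.filter fun i => coordChar χ i = (Set.range_nonempty (coordChar χ)).some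

theorem chosenSet_nonempty [NeZero l] (χ : AddChar (Additive (Fin l → A)) ℂ) :
    (chosenSet χ).Nonempty := by
  obtain ⟨i, hi⟩ := (Set.range_nonempty (coordChar χ)).some_mem
  exact ⟨i, by simp [chosenSet, hi]⟩

/-- A permutation of the coordinates does not change the set of their values. The value is chosen
from that set alone, which makes the chosen set equivariant. -/
theorem mem_chosenSet_permChar [NeZero l] (σ : Equiv.Perm (Fin l))
    (χ : AddChar (Additive (Fin l → A)) ℂ) (i : Fin l) :
    i ∈ chosenSet (permChar σ χ) ↔ σ⁻¹ i ∈ chosenSet χ := by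
  have h1 : Set.range (coordChar (permChar σ χ)) = Set.range (coordChar χ) := by
    have h2 : coordChar (permChar σ χ) = coordChar χ ∘ ⇑σ⁻¹ :=
      funext fun i => coordChar_permChar σ χ i
    rw [h2]
    exact (σ⁻¹).surjective.range_comp _
  simp only [chosenSet, Finset.mem_filter, Finset.mem_univ, true_and, coordChar_permChar]
  have h3 : ∀ (s t : Set (AddChar (Additive A) ℂ)) (hs : s.Nonempty) (ht : t.Nonempty), s = t →
      hs.some = ht.some := by
    rintro s _ hs ht rfl
    rfl
  rw [h3 _ _ _ _ h1]

theorem chosenSet_permChar [NeZero l] (σ : Equiv.Perm (Fin l))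
    (χ : AddChar (Additive (Fin l → A)) ℂ) : chosenSet (permChar σ χ) = σ • chosenSet χ := by
  ext i
  rw [mem_chosenSet_permChar, ← Finset.inv_smul_mem_iff]
  rfl

theorem permChar_permChar_inv (σ : Equiv.Perm (Fin l)) (χ : AddChar (Additive (Fin l → A)) ℂ) :
    permChar σ (permChar σ⁻¹ χ) = χ := by
  ext b
  change permChar σ (permChar σ⁻¹ χ) (Additive.ofMul (Additive.toMul b)) = _
  rw [permChar_apply, permChar_apply]
  simp

variable [Fintype A] {V : Type} [AddCommGroup V] [Module ℂ V]

/-- The isotypic projections of the restriction to `A^l` of a representation of `A ≀ Σ_l`. -/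
noncomputable abbrev baseProj (ρ : Representation ℂ (Wreath A l) V)
    (χ : AddChar (Additive (Fin l → A)) ℂ) : Module.End ℂ V :=
  isoProj (ρ.comp SemidirectProduct.inl) χ

theorem mul_baseProj (ρ : Representation ℂ (Wreath A l) V)
    (χ : AddChar (Additive (Fin l → A)) ℂ) (w : Wreath A l) :
    ρ w * baseProj ρ χ = baseProj ρ (permChar w.right χ) * ρ w := by
  rw [baseProj, baseProj, isoProj, isoProj, mul_smul_comm, smul_mul_assoc, Finset.mul_sum,
    Finset.sum_mul]
  congr 1
  refine Finset.sum_equiv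
    (mulAutArrow (G := Equiv.Perm (Fin l)) (A := Fin l) (M := A) w.right).toEquiv
    (by simp) fun b _ => ?_
  rw [mul_smul_comm, smul_mul_assoc]
  have h1 : w * SemidirectProduct.inl b = SemidirectProduct.inl
      (mulAutArrow (G := Equiv.Perm (Fin l)) (A := Fin l) (M := A) w.right b) * w := by
    refine SemidirectProduct.ext ?_ ?_
    · simp [mul_comm]
    · simp
  have h2 : permChar w.right χ (Additive.ofMul
      (mulAutArrow (G := Equiv.Perm (Fin l)) (A := Fin l) (M := A) w.right b)⁻¹) =
      χ (Additive.ofMul b⁻¹) := by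
    rw [permChar_apply]
    congr 2
    ext i
    change (b (w.right.symm (w.right i)))⁻¹ = (b i)⁻¹
    rw [Equiv.symm_apply_apply]
  congr 1
  · exact h2.symm
  · rw [MonoidHom.comp_apply, MonoidHom.comp_apply, ← map_mul, h1, map_mul]
    rfl

open Classical in
/-- The sum of the isotypic projections over the characters with a given chosen set. -/
noncomputable def setProj [NeZero l] (ρ : Representation ℂ (Wreath A l) V) (S : Finset (Fin l)) :
    Module.End ℂ V :=
  ∑ χ with chosenSet χ = S, baseProj ρ χ

variable [NeZero l]

theorem mul_setProj (ρ : Representation ℂ (Wreath A l) V) (S : Finset (Fin l)) (w : Wreath A l) :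
    ρ w * setProj ρ S = setProj ρ (w.right • S) * ρ w := by
  classical
  rw [setProj, setProj, Finset.mul_sum, Finset.sum_mul]
  refine Finset.sum_bij' (fun χ _ => permChar w.right χ) (fun χ _ => permChar w.right⁻¹ χ)
    ?_ ?_ ?_ ?_ ?_
  · intro χ hχ
    simp only [Finset.mem_filter, Finset.mem_univ, true_and] at hχ ⊢
    rw [chosenSet_permChar, hχ]
  · intro χ hχ
    simp only [Finset.mem_filter, Finset.mem_univ, true_and] at hχ ⊢
    rw [chosenSet_permChar, hχ, inv_smul_smul]
  · intro χ _
    have := permChar_permChar_inv w.right⁻¹ χ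
    rwa [inv_inv] at this
  · intro χ _
    exact permChar_permChar_inv _ _
  · intro χ _
    exact mul_baseProj ρ χ w

theorem setProj_mul_setProj (ρ : Representation ℂ (Wreath A l) V) (S T : Finset (Fin l)) :
    setProj ρ S * setProj ρ T = if S = T then setProj ρ S else 0 := by
  classical
  rw [setProj, setProj, sum_isoProj_mul_sum_isoProj]
  split_ifs with h
  · subst h
    rw [Finset.inter_self]
  · refine Finset.sum_eq_zero fun χ hχ => ?_
    simp only [Finset.mem_inter, Finset.mem_filter, Finset.mem_univ, true_and] at hχ
    exact absurd (hχ.1.symm.trans hχ.2) h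

theorem sum_setProj (ρ : Representation ℂ (Wreath A l) V) : ∑ S, setProj ρ S = 1 := by
  classical
  simp only [setProj]
  rw [Finset.sum_fiberwise]
  exact sum_isoProj _

theorem setProj_empty (ρ : Representation ℂ (Wreath A l) V) : setProj ρ ∅ = 0 := by
  rw [setProj, Finset.filter_eq_empty_iff.2, Finset.sum_empty]
  exact fun χ _ h => (chosenSet_nonempty χ).ne_empty h

/-- The trace of `w` on the part of a representation of `A ≀ Σ_l` with a given chosen set. -/
noncomputable def setTrace (ρ : Representation ℂ (Wreath A l) V) (w : Wreath A l)
    (S : Finset (Fin l)) : ℂ :=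
  LinearMap.trace ℂ V (ρ w * setProj ρ S)

theorem setTrace_conj (ρ : Representation ℂ (Wreath A l) V) (x w : Wreath A l)
    (S : Finset (Fin l)) : setTrace ρ (x * w * x⁻¹) (x.right • S) = setTrace ρ w S := by
  have h1 : ρ (x * w * x⁻¹) * setProj ρ (x.right • S) =
      ρ x * (ρ w * (setProj ρ S * ρ x⁻¹)) := by
    rw [map_mul ρ (x * w), map_mul ρ x w, mul_assoc, mul_assoc, mul_setProj,
      SemidirectProduct.inv_right, inv_smul_smul]
  rw [setTrace, h1, LinearMap.trace_mul_comm, mul_assoc, mul_assoc, ← map_mul ρ x⁻¹,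
    inv_mul_cancel, map_one, mul_one]
  rfl

/-- `w` carries the part of `S` into the part of `w.right • S`, and the two projections are
orthogonal, so the block is off the diagonal. -/
theorem setTrace_eq_zero (ρ : Representation ℂ (Wreath A l) V) (w : Wreath A l)
    {S : Finset (Fin l)} (hS : w.right • S ≠ S) : setTrace ρ w S = 0 := by
  have h1 : ρ w * setProj ρ S = setProj ρ (w.right • S) * ρ w * setProj ρ S := by
    rw [← mul_setProj, mul_assoc, setProj_mul_setProj, if_pos rfl]
  rw [setTrace, h1, mul_assoc, LinearMap.trace_mul_comm, mul_assoc, setProj_mul_setProj,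
    if_neg hS.symm, mul_zero, map_zero]

theorem character_eq_sum_setTrace (ρ : Representation ℂ (Wreath A l) V) (w : Wreath A l) :
    ρ.character w = ∑ S, setTrace ρ w S := by
  simp only [setTrace]
  rw [← map_sum, ← Finset.mul_sum, sum_setProj, mul_one]
  rfl

end Wreath

end HeightOne

namespace HeightOne

/-! ### Transfers, and virtual characters of `Σ_l` modulo transfers -/

section Transfers

variable {A : Type} [CommGroup A] {l : ℕ}

/-- The transfer ideal, as a group of functions. -/
def transferSpan (A : Type) [CommGroup A] (l : ℕ) : AddSubgroup (Wreath A l → ℂ) where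
  carrier := {F | ∃ hF : F ∈ RepRing (Wreath A l), ⟨F, hF⟩ ∈ transferIdeal A l}
  add_mem' := by
    rintro a b ⟨ha, ha'⟩ ⟨hb, hb'⟩
    exact ⟨(RepRing _).add_mem ha hb, (transferIdeal A l).add_mem ha' hb'⟩
  zero_mem' := ⟨(RepRing _).zero_mem, (transferIdeal A l).zero_mem⟩
  neg_mem' := by
    rintro a ⟨ha, ha'⟩
    exact ⟨(RepRing _).neg_mem ha, (transferIdeal A l).neg_mem ha'⟩

/-- The set of the first `i` points. -/
def initialSet (l i : ℕ) : Finset (Fin l) := Finset.univ.filter fun k => (k : ℕ) < i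

theorem card_initialSet {l i : ℕ} (hi : i ≤ l) : (initialSet l i).card = i := by
  rw [initialSet, Fin.card_filter_val_lt, min_eq_right hi]

theorem mem_wreathYoung_iff (i : ℕ) (x : Wreath A l) :
    x ∈ wreathYoung A l i ↔ SemidirectProduct.rightHom x • initialSet l i = initialSet l i := by
  rw [← Finset.coe_inj, Finset.coe_smul_finset]
  simp only [initialSet, Finset.coe_filter, Finset.mem_univ, true_and]
  rfl

theorem exists_perm_smul_eq {S T : Finset (Fin l)} (h : S.card = T.card) :
    ∃ σ : Equiv.Perm (Fin l), σ • S = T := by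
  have h1 : Fintype.card {x // x ∈ S} = Fintype.card {x // x ∈ T} := by simpa using h
  let e := Fintype.equivOfCardEq h1
  refine ⟨e.extendSubtype, ?_⟩
  refine Finset.eq_of_subset_of_card_le (fun x hx => ?_) (by rw [Finset.card_smul_finset, h])
  obtain ⟨y, hy, rfl⟩ := Finset.mem_smul_finset.1 hx
  exact e.extendSubtype_mem y hy

-- The subsets of size `k` form one orbit of `Σ_l`, and the stabilizer of the initial one is the
-- Young subgroup. So `induce_eq_sum_fixed` exhibits `F` as the transfer of the summand at the
-- initial subset.
open Classical in
theorem mem_transferSpan_of_eq_sum [Finite A] {k : ℕ} (h0 : 0 < k) (hk : k < l)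
    (t : Wreath A l → Finset (Fin l) → ℂ)
    (ht : ∀ (x w : Wreath A l) S, t (x * w * x⁻¹) (x.right • S) = t w S)
    {F : Wreath A l → ℂ} (hF : F ∈ RepRing (Wreath A l))
    (hFt : ∀ w, F w = ∑ S with S.card = k ∧ w.right • S = S, t w S)
    (hres : (fun h : wreathYoung A l k => t h (initialSet l k)) ∈ RepRing (wreathYoung A l k)) :
    F ∈ transferSpan A l := by
  have : Finite (Wreath A l) := Finite.of_equiv _ SemidirectProduct.equivProd.symm
  refine ⟨hF, Ideal.subset_span ⟨k, h0, hk, ⟨_, hres⟩, ?_⟩⟩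
  ext w
  have h1 := induce_eq_sum_fixed (G := Wreath A l) (P := Equiv.Perm (Fin l))
    SemidirectProduct.rightHom (initialSet l k) (wreathYoung A l k) (mem_wreathYoung_iff k) t ht w
  refine (hFt w).trans (Eq.trans ?_ h1.symm)
  refine Finset.sum_congr ?_ fun _ _ => rfl
  ext S
  simp only [Finset.mem_filter, Finset.mem_univ, true_and]
  refine and_congr_left fun _ => ⟨fun hS => ?_, ?_⟩
  · obtain ⟨σ, hσ⟩ := exists_perm_smul_eq ((card_initialSet hk.le).trans hS.symm)
    exact ⟨SemidirectProduct.inr σ, by simpa using hσ⟩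
  · rintro ⟨x, rfl⟩
    rw [Finset.card_smul_finset, card_initialSet hk.le]

theorem transferSpan_eval {F : Wreath A l → ℂ} (hF : F ∈ transferSpan A l) {w : Wreath A l}
    (hw : OverLongCycle w) : F w = 0 := by
  obtain ⟨h1, h2⟩ := hF
  have h3 : evalAt w hw (Ideal.Quotient.mk _ ⟨F, h1⟩) = F w := rfl
  rw [← h3, Ideal.Quotient.eq_zero_iff_mem.2 h2, map_zero]

theorem mul_mem_transferSpan {F G : Wreath A l → ℂ} (hG : G ∈ RepRing (Wreath A l))
    (hF : F ∈ transferSpan A l) : G * F ∈ transferSpan A l := by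
  obtain ⟨h1, h2⟩ := hF
  exact ⟨(RepRing _).mul_mem hG h1, (transferIdeal A l).mul_mem_left ⟨G, hG⟩ h2⟩

/-- The functions that are pulled back along the norm up to transfers. -/
def normSpan (A : Type) [CommGroup A] (l : ℕ) : AddSubgroup (Wreath A l → ℂ) where
  carrier := {F | ∃ r ∈ RepRing A, (F - fun w => r (wreathNorm A l w)) ∈ transferSpan A l}
  add_mem' := by
    rintro a b ⟨r, hr, ha⟩ ⟨s, hs, hb⟩
    refine ⟨r + s, (RepRing _).add_mem hr hs, ?_⟩
    convert (transferSpan A l).add_mem ha hb using 1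
    ext w
    simp only [Pi.add_apply, Pi.sub_apply]
    ring
  zero_mem' := ⟨0, (RepRing _).zero_mem, by
    convert (transferSpan A l).zero_mem using 1
    ext w
    simp⟩
  neg_mem' := by
    rintro a ⟨r, hr, ha⟩
    refine ⟨-r, (RepRing _).neg_mem hr, ?_⟩
    convert (transferSpan A l).neg_mem ha using 1
    ext w
    simp only [Pi.neg_apply, Pi.sub_apply]
    ring

theorem transferSpan_le_normSpan : transferSpan A l ≤ normSpan A l := by
  intro F hF
  refine ⟨0, (RepRing _).zero_mem, ?_⟩
  convert hF using 1
  ext w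
  simp

theorem pullback_mem_normSpan {r : A → ℂ} (hr : r ∈ RepRing A) :
    (fun w => r (wreathNorm A l w)) ∈ normSpan A l :=
  ⟨r, hr, by rw [sub_self]; exact zero_mem _⟩

theorem pullback_mul_mem_normSpan {r : A → ℂ} (hr : r ∈ RepRing A) {F : Wreath A l → ℂ}
    (hF : F ∈ normSpan A l) : (fun w => r (wreathNorm A l w) * F w) ∈ normSpan A l := by
  obtain ⟨s, hs, hF⟩ := hF
  refine ⟨r * s, (RepRing _).mul_mem hr hs, ?_⟩
  convert mul_mem_transferSpan (comp_mem_repRing (wreathNorm A l) hr) hF using 1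
  ext w
  simp only [Pi.mul_apply, Pi.sub_apply]
  ring

-- Sort the fixed functions `g` by their fibre `S` over `j`. It has `ν j` elements and is preserved
-- by `w`, so the character is induced from the stabilizer of one such set.
open Classical in
theorem signedYoung_mem_transferSpan [Finite A] {J : Type} [Fintype J] (ν : J → ℕ) (j : J)
    (h0 : 0 < ν j) (hl : ν j < l) :
    (fun w : Wreath A l => signedYoung l ν w.right) ∈ transferSpan A l := by
  let t : Wreath A l → Finset (Fin l) → ℂ := fun w S => signHom l w.right *
    (Finset.univ.filter fun g : Fin l → J =>
      ((∀ j, (Finset.univ.filter fun x => g x = j).card = ν j) ∧ ∀ x, g x = j ↔ x ∈ S) ∧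
        permArrow l J w.right g = g).card
  refine mem_transferSpan_of_eq_sum h0 hl t ?_
    (comp_mem_repRing SemidirectProduct.rightHom (signedYoung_mem_repRing l ν)) ?_ ?_
  · intro x w S
    have hsign : signHom l (x * w * x⁻¹).right = signHom l w.right := by
      simp only [SemidirectProduct.mul_right, SemidirectProduct.inv_right, signHom_apply,
        Equiv.Perm.sign_mul, Equiv.Perm.sign_inv]
      rw [mul_comm (Equiv.Perm.sign x.right), mul_assoc, Int.units_mul_self, mul_one]
    simp only [t, hsign]
    congr 2
    symm
    refine Finset.card_equiv (permArrow l J x.right) fun g => ?_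
    simp only [Finset.mem_filter, Finset.mem_univ, true_and, card_fiber_permArrow]
    have h2 : (permArrow l J (x * w * x⁻¹).right) (permArrow l J x.right g) =
        permArrow l J x.right (permArrow l J w.right g) := by
      rw [← Equiv.Perm.mul_apply, ← Equiv.Perm.mul_apply, ← map_mul, ← map_mul]
      simp
    rw [h2, (permArrow l J x.right).injective.eq_iff]
    refine and_congr_left fun _ => and_congr_right fun _ => ?_
    constructor
    · intro h y
      rw [permArrow_apply, h, ← Finset.inv_smul_mem_iff]
      rfl
    · intro h y
      have := h (x.right y)
      rw [permArrow_apply, Equiv.symm_apply_apply, ← Finset.inv_smul_mem_iff,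
        Equiv.Perm.smul_def, ← Equiv.Perm.mul_apply, inv_mul_cancel] at this
      exact this
  · intro w
    rw [signedYoung]
    simp only [t, ← Finset.mul_sum, signHom_apply, permArrow_eq_iff]
    congr 1
    rw [← Nat.cast_sum]
    congr 1
    rw [Finset.card_eq_sum_card_fiberwise
      (f := fun g : Fin l → J => Finset.univ.filter fun x => g x = j)
      (t := Finset.univ.filter fun S : Finset (Fin l) => S.card = ν j ∧ w.right • S = S)]
    · refine Finset.sum_congr rfl fun S _ => ?_
      rw [Finset.filter_filter]
      congr 1
      ext g
      simp only [Finset.mem_filter, Finset.mem_univ, true_and, Finset.ext_iff]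
      tauto
    · intro g hg
      simp only [Finset.coe_filter, Finset.mem_univ, true_and, Set.mem_ofPred_eq] at hg ⊢
      refine ⟨hg.1 j, ?_⟩
      ext y
      rw [← Finset.inv_smul_mem_iff, Finset.mem_filter, Finset.mem_filter,
        ← hg.2 (w.right⁻¹ • y)]
      simp
  · let ψ : wreathYoung A l (ν j) →* Equiv.Perm (Fin l) :=
      SemidirectProduct.rightHom.comp (wreathYoung A l (ν j)).subtype
    have h1 := card_fixed_filter_mem_repRing ((permArrow l J).comp ψ)
      (fun g => (∀ j, (Finset.univ.filter fun x => g x = j).card = ν j) ∧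
        ∀ x, g x = j ↔ x ∈ initialSet l (ν j)) ?_
    · convert (RepRing (wreathYoung A l (ν j))).mul_mem
        (coe_hom_mem_repRing ((signHom l).comp ψ)) h1 using 1
      ext x
      simp only [t, Pi.mul_apply]
      congr!
    intro x g
    have hx := (mem_wreathYoung_iff (ν j) x.1).1 x.2
    have h3 : ∀ y, (SemidirectProduct.rightHom x.1 : Equiv.Perm (Fin l)) y ∈ initialSet l (ν j) ↔
        y ∈ initialSet l (ν j) := by
      intro y
      conv_lhs => rw [← hx]
      exact Finset.smul_mem_smul_finset_iff _
    simp only [ψ, MonoidHom.comp_apply, card_fiber_permArrow]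
    refine and_congr_right fun _ => ?_
    constructor
    · intro h y
      have := h ((SemidirectProduct.rightHom x.1 : Equiv.Perm (Fin l)) y)
      rw [Subgroup.subtype_apply, permArrow_apply, Equiv.symm_apply_apply, h3] at this
      exact this
    · intro h y
      rw [Subgroup.subtype_apply, permArrow_apply, h, ← h3, Equiv.apply_symm_apply]

/-- Up to transfers, every signed Young permutation character is a multiple of the sign. -/
theorem exists_signedYoung_sub_mem [Finite A] {J : Type} [Fintype J] (ν : J → ℕ) :
    ∃ c : ℤ, (fun w : Wreath A l => signedYoung l ν w.right - c * signHom l w.right) ∈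
      transferSpan A l := by
  classical
  by_cases hν : ∃ j, 0 < ν j ∧ ν j < l
  · obtain ⟨j, h0, hj⟩ := hν
    exact ⟨0, by simpa using signedYoung_mem_transferSpan (A := A) ν j h0 hj⟩
  · push Not at hν
    -- Now each part is `0` or at least `l`, so a function with these fibre sizes is constant and
    -- fixed by every permutation. The multiple of the sign is the number of such functions.
    let X : Finset (Fin l → J) := Finset.univ.filter fun g =>
      ∀ j, (Finset.univ.filter fun x => g x = j).card = ν j
    refine ⟨X.card, ?_⟩
    convert (transferSpan A l).zero_mem using 1
    ext w
    have h1 : ∀ g : Fin l → J, (∀ j, (Finset.univ.filter fun x => g x = j).card = ν j) →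
        ∀ x y, g x = g y := by
      intro g hg x y
      have h2 : (Finset.univ.filter fun z => g z = g y) = Finset.univ := by
        refine Finset.eq_univ_of_card _ (le_antisymm (Finset.card_le_univ _) ?_)
        rw [hg, Fintype.card_fin]
        refine hν _ ?_
        rw [← hg]
        exact Finset.card_pos.2 ⟨y, by simp⟩
      have h3 : x ∈ Finset.univ.filter fun z => g z = g y := by
        rw [h2]
        exact Finset.mem_univ x
      exact (Finset.mem_filter.1 h3).2
    have h2 : (Finset.univ.filter fun g : Fin l → J =>
        (∀ j, (Finset.univ.filter fun x => g x = j).card = ν j) ∧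
          ∀ x, g (w.right x) = g x) = X := by
      refine Finset.filter_congr fun g _ => ?_
      exact and_iff_left_of_imp fun hg x => h1 g hg _ _
    rw [signedYoung, h2, signHom_apply]
    simp [mul_comm]

theorem overLongCycle_finRotate (a : Fin l → A) :
    OverLongCycle (⟨a, finRotate l⟩ : Wreath A l) := by
  change (finRotate l).IsCycleOn Set.univ
  -- For `l < 2` the rotation is the identity. It is not a cycle, but it is one on the whole set,
  -- which has at most one point.
  rcases Nat.lt_or_ge l 2 with h | h
  · have : Subsingleton (Fin l) := Fin.subsingleton_iff_le_one.2 (by omega)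
    exact Equiv.Perm.isCycleOn_of_subsingleton _ _
  · convert (isCycle_finRotate_of_le h).isCycleOn using 1
    ext x
    have := support_finRotate_of_le h
    simpa using (Finset.ext_iff.1 this x)

/-- Up to transfers, every virtual character of `Σ_l` is a multiple of the sign. -/
theorem exists_sub_signHom_mem [Finite A] {F : Equiv.Perm (Fin l) → ℂ}
    (hF : F ∈ RepRing (Equiv.Perm (Fin l))) :
    ∃ c : ℤ, (fun w : Wreath A l => F w.right - c * signHom l w.right) ∈ transferSpan A l := by
  let M : AddSubgroup (Equiv.Perm (Fin l) → ℂ) :=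
    { carrier := {F | ∃ c : ℤ, (fun w : Wreath A l => F w.right - c * signHom l w.right) ∈
        transferSpan A l}
      add_mem' := by
        rintro a b ⟨c, hc⟩ ⟨d, hd⟩
        refine ⟨c + d, ?_⟩
        convert (transferSpan A l).add_mem hc hd using 1
        ext w
        simp only [Pi.add_apply, Int.cast_add]
        ring
      zero_mem' := ⟨0, by
        convert (transferSpan A l).zero_mem using 1
        ext w
        simp⟩
      neg_mem' := by
        rintro a ⟨c, hc⟩
        refine ⟨-c, ?_⟩
        convert (transferSpan A l).neg_mem hc using 1
        ext w
        simp only [Pi.neg_apply, Int.cast_neg]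
        ring }
  refine (AddSubgroup.closure_le M).2 ?_ (repRing_perm_le_closure hF)
  rintro _ ⟨J, _, ν, rfl⟩
  exact exists_signedYoung_sub_mem ν

/-- The constant `1` is pulled back along the norm and is congruent to `c` times the sign. At an
`l`-cycle the transfers vanish and the sign is `±1`, so `c = ±1` and the congruence can be inverted.
-/
theorem signHom_mem_normSpan [Finite A] :
    (fun w : Wreath A l => signHom l w.right) ∈ normSpan A l := by
  obtain ⟨c, hc⟩ := exists_sub_signHom_mem (A := A) (RepRing (Equiv.Perm (Fin l))).one_mem
  have h1 := transferSpan_eval hc (overLongCycle_finRotate 1)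
  set s : ℤ := (Equiv.Perm.sign (finRotate l) : ℤ) with hs
  have h2 : (1 : ℂ) - c * (s : ℂ) = 0 := h1
  have h3 : c * s = 1 := by
    have : (1 : ℂ) = ((c * s : ℤ) : ℂ) := by
      push_cast
      linear_combination h2
    exact_mod_cast this.symm
  have h4 : c * c = 1 := by
    rcases Int.isUnit_iff.1 (IsUnit.of_mul_eq_one _ h3) with h | h <;> rw [h] <;> norm_num
  have h5 : (c : ℂ) * c = 1 := by exact_mod_cast h4
  have h6 : (fun w : Wreath A l => signHom l w.right) =
      c • (fun w : Wreath A l => (1 : A → ℂ) (wreathNorm A l w)) - c • (fun w : Wreath A l =>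
        (1 : Equiv.Perm (Fin l) → ℂ) w.right - c * signHom l w.right) := by
    ext w
    rw [Pi.sub_apply, Pi.smul_apply, Pi.smul_apply]
    simp only [zsmul_eq_mul, Pi.one_apply]
    linear_combination (-signHom l w.right) * h5
  rw [h6]
  exact (normSpan A l).sub_mem ((normSpan A l).zsmul_mem
    (pullback_mem_normSpan (RepRing A).one_mem) _)
    ((normSpan A l).zsmul_mem (transferSpan_le_normSpan hc) _)

theorem comp_right_mem_normSpan [Finite A] {F : Equiv.Perm (Fin l) → ℂ}
    (hF : F ∈ RepRing (Equiv.Perm (Fin l))) :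
    (fun w : Wreath A l => F w.right) ∈ normSpan A l := by
  obtain ⟨c, hc⟩ := exists_sub_signHom_mem (A := A) hF
  have h1 := (normSpan A l).add_mem (transferSpan_le_normSpan hc)
    ((normSpan A l).zsmul_mem (signHom_mem_normSpan) c)
  convert h1 using 1
  ext w
  simp

end Transfers

end HeightOne

namespace HeightOne

/-! ### The isomorphism `R(A) ≅ R(A ≀ Σ_l) / I_tr` -/

section WreathRepRing

variable {A : Type} [CommGroup A] {l : ℕ}

theorem eq_of_chosenSet_eq_univ [NeZero l] {χ : AddChar (Additive (Fin l → A)) ℂ}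
    (h : chosenSet χ = Finset.univ) :
    ∃ ψ : AddChar (Additive A) ℂ, ∀ b : Fin l → A,
      χ (Additive.ofMul b) = ψ (Additive.ofMul (∏ i, b i)) := by
  refine ⟨(Set.range_nonempty (coordChar χ)).some, fun b => ?_⟩
  have h1 : ∀ i, coordChar χ i = (Set.range_nonempty (coordChar χ)).some := by
    intro i
    have h2 : i ∈ chosenSet χ := h ▸ Finset.mem_univ i
    simpa [chosenSet] using h2
  rw [addChar_eq_prod_coordChar]
  simp only [h1]
  exact (map_prod (AddChar.toMonoidHom (Set.range_nonempty (coordChar χ)).some)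
    (fun i => Multiplicative.ofAdd (Additive.ofMul (b i))) Finset.univ).symm

/-- These are the characters `ψ ∘ N` of `A^l`, which are invariant under permutations. On the
isotypic part of one of them `A^l` acts through the scalars `ψ(N)` and `Σ_l` acts by itself, so the
trace of `w` is `ψ(N w)` times a virtual character of `Σ_l`. -/
theorem setTrace_univ_mem_normSpan [Fintype A] [NeZero l] {V : Type} [AddCommGroup V] [Module ℂ V]
    [FiniteDimensional ℂ V] (ρ : Representation ℂ (Wreath A l) V) :
    (fun w => setTrace ρ w Finset.univ) ∈ normSpan A l := by
  classical
  have h1 : (fun w => setTrace ρ w Finset.univ) = ∑ χ with chosenSet χ = Finset.univ,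
      fun w => LinearMap.trace ℂ V (ρ w * baseProj ρ χ) := by
    ext w
    rw [setTrace, setProj, Finset.mul_sum, map_sum, Finset.sum_apply]
  rw [h1]
  refine AddSubgroup.sum_mem _ fun χ hχ => ?_
  obtain ⟨ψ, hψ⟩ := eq_of_chosenSet_eq_univ (Finset.mem_filter.1 hχ).2
  have hperm : ∀ σ, permChar σ χ = χ := by
    intro σ
    ext b
    change permChar σ χ (Additive.ofMul (Additive.toMul b)) = χ (Additive.ofMul (Additive.toMul b))
    rw [permChar_apply, hψ, hψ, Equiv.prod_comp σ (Additive.toMul b)]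
  let F : Equiv.Perm (Fin l) → ℂ := fun σ =>
    LinearMap.trace ℂ V ((ρ.comp SemidirectProduct.inr) σ * baseProj ρ χ)
  have hF : F ∈ RepRing (Equiv.Perm (Fin l)) := by
    refine trace_mul_idempotent_mem_repRing (ρ.comp SemidirectProduct.inr) (baseProj ρ χ) ?_ ?_
    · rw [isoProj_mul_isoProj, if_pos rfl]
    · intro σ
      have := mul_baseProj ρ χ (SemidirectProduct.inr σ)
      rw [hperm] at this
      exact this
  have hr : (fun a : A => ψ (Additive.ofMul a)) ∈ RepRing A :=
    coe_hom_mem_repRing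
      { toFun := fun a : A => ψ (Additive.ofMul a)
        map_one' := by rw [ofMul_one, AddChar.map_zero_eq_one]
        map_mul' := addChar_ofMul_mul ψ }
  convert pullback_mul_mem_normSpan hr (comp_right_mem_normSpan hF) using 1
  ext w
  have h2 : ρ w = (ρ.comp SemidirectProduct.inl) w.left *
      (ρ.comp SemidirectProduct.inr) w.right := by
    rw [MonoidHom.comp_apply, MonoidHom.comp_apply, ← map_mul,
      SemidirectProduct.inl_left_mul_inr_right]
  have h3 : LinearMap.trace ℂ V (ρ w * baseProj ρ χ) = χ (Additive.ofMul w.left) * F w.right := by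
    rw [h2, mul_assoc, LinearMap.trace_mul_comm, mul_assoc, isoProj_mul_comm, mul_isoProj,
      mul_smul_comm, map_smul, smul_eq_mul]
  rw [h3, hψ]
  rfl

/-- The parts with chosen sets of size `k` are permuted like these sets. Their sum is induced from
the part of the initial set, a representation of the Young subgroup. -/
theorem sum_setTrace_mem_transferSpan [Fintype A] [NeZero l] {V : Type} [AddCommGroup V]
    [Module ℂ V] [FiniteDimensional ℂ V] (ρ : Representation ℂ (Wreath A l) V) {k : ℕ}
    (h0 : 0 < k) (hk : k < l) :
    (fun w => ∑ S with S.card = k, setTrace ρ w S) ∈ transferSpan A l := by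
  classical
  refine mem_transferSpan_of_eq_sum h0 hk (setTrace ρ) (setTrace_conj ρ) ?_ ?_ ?_
  · have h1 := trace_mul_idempotent_mem_repRing ρ (∑ S with S.card = k, setProj ρ S) ?_ ?_
    · convert h1 using 1
      ext w
      simp only [setTrace]
      rw [Finset.mul_sum, map_sum]
    · rw [Finset.sum_mul_sum]
      refine Finset.sum_congr rfl fun S hS => ?_
      simp only [setProj_mul_setProj]
      rw [Finset.sum_ite_eq, if_pos hS]
    · intro w
      rw [Finset.mul_sum, Finset.sum_mul]
      refine Finset.sum_bij' (fun S _ => w.right • S) (fun S _ => w.right⁻¹ • S) ?_ ?_ ?_ ?_ ?_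
      · intro S hS
        simpa using hS
      · intro S hS
        simpa using hS
      · intro S _
        exact inv_smul_smul _ _
      · intro S _
        exact smul_inv_smul _ _
      · intro S _
        exact mul_setProj ρ S w
  · intro w
    rw [← Finset.filter_filter]
    refine (Finset.sum_filter_of_ne fun S _ hS => ?_).symm
    by_contra h
    exact hS (setTrace_eq_zero ρ w h)
  · refine trace_mul_idempotent_mem_repRing (ρ.comp (wreathYoung A l k).subtype)
      (setProj ρ (initialSet l k)) ?_ ?_
    · rw [setProj_mul_setProj, if_pos rfl]
    · intro x
      have h1 := mul_setProj ρ (initialSet l k) x.1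
      have h2 := (mem_wreathYoung_iff k x.1).1 x.2
      rw [SemidirectProduct.rightHom_eq_right] at h2
      rwa [h2] at h1

/-- Split the character by the size of the chosen set: size `0` does not occur, size `l` gives
pull-backs along the norm up to transfers, and the sizes in between give transfers. -/
theorem repRing_wreath_le_normSpan [Finite A] [NeZero l] {F : Wreath A l → ℂ}
    (hF : F ∈ RepRing (Wreath A l)) : F ∈ normSpan A l := by
  have := Fintype.ofFinite A
  refine repRing_le_of_character_mem _ (fun V _ _ _ ρ => ?_) hF
  have h1 : ρ.character = (fun w => setTrace ρ w Finset.univ) +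
      ∑ k ∈ Finset.Ioo 0 l, fun w => ∑ S with S.card = k, setTrace ρ w S := by
    ext w
    rw [character_eq_sum_setTrace, ← Finset.sum_fiberwise_of_maps_to (g := Finset.card)
      (t := Finset.range (l + 1))]
    · have h2 : Finset.range (l + 1) = insert 0 (insert l (Finset.Ioo 0 l)) := by
        ext k
        have := NeZero.pos l
        simp only [Finset.mem_range, Finset.mem_insert, Finset.mem_Ioo]
        omega
      rw [h2, Finset.sum_insert (by have := NeZero.pos l; simp; omega),
        Finset.sum_insert (by simp), Pi.add_apply, Finset.sum_apply]
      have h3 : (Finset.univ.filter fun S : Finset (Fin l) => S.card = 0) = {∅} := by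
        ext S
        simp
      have h4 : (Finset.univ.filter fun S : Finset (Fin l) => S.card = l) = {Finset.univ} := by
        ext S
        have := Finset.card_eq_iff_eq_univ S
        rw [Fintype.card_fin] at this
        simp [this]
      rw [h3, h4, Finset.sum_singleton, Finset.sum_singleton, setTrace, setProj_empty, mul_zero,
        map_zero, zero_add]
    · intro S _
      rw [Finset.mem_range, Nat.lt_succ_iff]
      simpa using S.card_le_univ
  rw [h1]
  refine (normSpan A l).add_mem (setTrace_univ_mem_normSpan ρ)
    (AddSubgroup.sum_mem _ fun k hk => ?_)
  rw [Finset.mem_Ioo] at hk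
  exact transferSpan_le_normSpan (sum_setTrace_mem_transferSpan ρ hk.1 hk.2)

theorem normPullback_surjective [Finite A] [NeZero l] :
    Function.Surjective (normPullback A l) := by
  intro x
  obtain ⟨⟨F, hF⟩, rfl⟩ := Ideal.Quotient.mk_surjective x
  obtain ⟨r, hr, h1, h2⟩ := repRing_wreath_le_normSpan hF
  refine ⟨⟨r, hr⟩, ?_⟩
  symm
  exact Ideal.Quotient.eq.2 h2

/-- An element over an `l`-cycle with a given norm. -/
def longCycleOf (l : ℕ) [NeZero l] (a : A) : Wreath A l :=
  ⟨Pi.mulSingle 0 a, finRotate l⟩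

theorem overLongCycle_longCycleOf [NeZero l] (a : A) : OverLongCycle (longCycleOf l a) :=
  overLongCycle_finRotate _

theorem wreathNorm_longCycleOf [NeZero l] (a : A) : wreathNorm A l (longCycleOf l a) = a := by
  change ∏ i, (Pi.mulSingle 0 a : Fin l → A) i = a
  rw [Finset.prod_pi_mulSingle']
  simp

theorem evalAt_normPullback (w : Wreath A l) (hw : OverLongCycle w) (r : RepRing A) :
    evalAt w hw (normPullback A l r) = r.1 (wreathNorm A l w) := rfl

theorem normPullback_injective [NeZero l] : Function.Injective (normPullback A l) := by
  intro r s h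
  refine Subtype.ext (funext fun a => ?_)
  have h1 := congrArg (evalAt _ (overLongCycle_longCycleOf (l := l) a)) h
  rwa [evalAt_normPullback, evalAt_normPullback, wreathNorm_longCycleOf] at h1

/-- Elements of `R(A ≀ Σ_l) / I_tr` are determined by their values over `l`-cycles. -/
theorem repQuot_ext [Finite A] [NeZero l] {x y : RepQuot A l}
    (h : ∀ (w : Wreath A l) (hw : OverLongCycle w), evalAt w hw x = evalAt w hw y) : x = y := by
  obtain ⟨r, rfl⟩ := normPullback_surjective x
  obtain ⟨s, rfl⟩ := normPullback_surjective y
  congr 1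
  refine Subtype.ext (funext fun a => ?_)
  have h1 := h _ (overLongCycle_longCycleOf (l := l) a)
  rwa [evalAt_normPullback, evalAt_normPullback, wreathNorm_longCycleOf] at h1

/-- `R(A) ≅ R(A ≀ Σ_l) / I_tr`. -/
noncomputable def normEquiv (A : Type) [CommGroup A] [Finite A] (l : ℕ) [NeZero l] :
    RepRing A ≃+* RepQuot A l :=
  RingEquiv.ofBijective (normPullback A l) ⟨normPullback_injective, normPullback_surjective⟩

end WreathRepRing

end HeightOne

namespace HeightOne

/-! ### Roots of unity -/

theorem expQZ_coe (q : ℚ) : (expQZ (Multiplicative.ofAdd (q : QZ)) : ℂ) =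
    Complex.exp (2 * Real.pi * Complex.I * (q : ℂ)) := rfl

theorem expQZ_injective : Function.Injective expQZ := by
  rw [injective_iff_map_eq_one]
  intro x hx
  obtain ⟨q, hq⟩ := QuotientAddGroup.mk_surjective (Multiplicative.toAdd x)
  have h1 : Complex.exp (2 * Real.pi * Complex.I * (q : ℂ)) = 1 := by
    rw [← expQZ_coe]
    rw [hq, ofAdd_toAdd, hx, Units.val_one]
  obtain ⟨n, hn⟩ := Complex.exp_eq_one_iff.1 h1
  have h2 : (q : ℂ) = n := by
    have h3 : (2 * Real.pi * Complex.I : ℂ) ≠ 0 := Complex.two_pi_I_ne_zero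
    refine mul_left_cancel₀ h3 ?_
    rw [hn, mul_comm]
  have h4 : q = n := by exact_mod_cast h2
  refine Multiplicative.toAdd.injective ?_
  rw [← hq, toAdd_one]
  refine (QuotientAddGroup.eq_zero_iff q).2 (AddSubgroup.mem_zmultiples_iff.2 ⟨n, ?_⟩)
  simp [h4]

theorem exists_expQZ_eq {u : ℂˣ} {n : ℕ} (hn : n ≠ 0) (hu : u ^ n = 1) :
    ∃ q : QZ, expQZ (Multiplicative.ofAdd q) = u := by
  have : NeZero n := ⟨hn⟩
  obtain ⟨i, -, hi⟩ := (Complex.mem_rootsOfUnity n u).1 ((mem_rootsOfUnity n u).2 hu)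
  refine ⟨((i / n : ℚ) : QZ), Units.ext ?_⟩
  rw [expQZ_coe, ← hi]
  push_cast
  ring_nf

/-! ### Pontryagin duals -/

section Dual

variable {A : Type} [CommGroup A]

theorem exists_dual_eq_addChar [Finite A] (χ : AddChar (Additive A) ℂ) :
    ∃ ψ : Dual A, ∀ a, (expQZ (ψ a) : ℂ) = χ (Additive.ofMul a) := by
  let f : A →* ℂˣ := MonoidHom.toHomUnits
    { toFun := fun a : A => χ (Additive.ofMul a)
      map_one' := by rw [ofMul_one, AddChar.map_zero_eq_one]
      map_mul' := addChar_ofMul_mul χ }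
  have h1 : ∀ a, ∃ q : Multiplicative QZ, expQZ q = f a := fun a =>
    exists_expQZ_eq (Nat.card_pos (α := A)).ne' (by rw [← map_pow, pow_card_eq_one', map_one])
  choose g hg using h1
  refine ⟨{ toFun := g, map_one' := ?_, map_mul' := fun a b => ?_ }, fun a => ?_⟩
  · exact expQZ_injective (by rw [hg, map_one, map_one])
  · exact expQZ_injective (by rw [map_mul, hg, hg, hg, map_mul])
  · exact congrArg Units.val (hg a)

/-- The character of `A` with values in `ℂ` that corresponds to an element of the dual. -/
noncomputable def dualToAddChar (ψ : Dual A) : AddChar (Additive A) ℂ where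
  toFun a := expQZ (ψ a.toMul)
  map_zero_eq_one' := by simp
  map_add_eq_mul' := by simp

theorem dualToAddChar_bijective [Finite A] :
    Function.Bijective (dualToAddChar : Dual A → AddChar (Additive A) ℂ) := by
  refine ⟨fun ψ ψ' h => MonoidHom.ext fun a => expQZ_injective (Units.ext ?_), fun χ => ?_⟩
  · exact DFunLike.congr_fun h (Additive.ofMul a)
  · obtain ⟨ψ, hψ⟩ := exists_dual_eq_addChar χ
    exact ⟨ψ, AddChar.ext _ _ fun a => hψ a.toMul⟩

instance [Finite A] : Finite (Dual A) :=
  Finite.of_injective _ dualToAddChar_bijective.injective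

theorem card_dual [Finite A] : Nat.card (Dual A) = Nat.card A := by
  have := Fintype.ofFinite A
  rw [Nat.card_congr (Equiv.ofBijective _ dualToAddChar_bijective), Nat.card_eq_fintype_card,
    AddChar.card_eq, Fintype.card_additive, Nat.card_eq_fintype_card]

end Dual

/-! ### The representation ring of a finite abelian group -/

section Abelian

variable {A : Type} [CommGroup A]

/-- The trace is the value of a virtual character of the trivial group, where the average over the
group has one term. -/
theorem exists_trace_idempotent_eq {V : Type} [AddCommGroup V] [Module ℂ V]
    [FiniteDimensional ℂ V] (P : Module.End ℂ V) (hP : P * P = P) :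
    ∃ k : ℤ, LinearMap.trace ℂ V P = k := by
  obtain ⟨k, hk⟩ := exists_sum_eq_card_mul
    (trace_mul_idempotent_mem_repRing (G := Unit) 1 P hP (fun _ => by simp))
  exact ⟨k, by simpa using hk⟩

/-- The comparison map `ℤ[A^*] → R(A)`. -/
noncomputable def dualAlgHom (A : Type) [CommGroup A] :
    MonoidAlgebra ℤ (Dual A) →ₐ[ℤ] RepRing A :=
  MonoidAlgebra.lift ℤ _ _ (charClass A)

/-- The multiplicity of `χ` in a representation is the trace of its isotypic projection, which is an
integer. -/
theorem dualAlgHom_surjective [Finite A] : Function.Surjective (dualAlgHom A) := by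
  rintro ⟨F, hF⟩
  have := Fintype.ofFinite A
  have h1 : F ∈ ((dualAlgHom A).range.toSubring.map (RepRing A).subtype).toAddSubgroup := by
    refine repRing_le_of_character_mem _ (fun V _ _ _ ρ => ?_) hF
    have h2 : ∀ χ : AddChar (Additive A) ℂ, ∃ k : ℤ,
        LinearMap.trace ℂ V (isoProj ρ χ) = k := fun χ =>
      exists_trace_idempotent_eq _ (by rw [isoProj_mul_isoProj, if_pos rfl])
    choose k hk using h2
    have h3 : ρ.character = ∑ χ, k χ • fun a => χ (Additive.ofMul a) := by
      ext a
      rw [Representation.character, Finset.sum_apply, ← mul_one (ρ a), ← sum_isoProj ρ,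
        Finset.mul_sum, map_sum]
      refine Finset.sum_congr rfl fun χ _ => ?_
      rw [mul_isoProj, map_smul, hk, Pi.smul_apply, zsmul_eq_mul, smul_eq_mul, mul_comm]
    rw [h3]
    refine AddSubgroup.sum_mem _ fun χ _ => AddSubgroup.zsmul_mem _ ?_ _
    obtain ⟨ψ, hψ⟩ := exists_dual_eq_addChar χ
    refine ⟨charClass A ψ, ⟨MonoidAlgebra.of ℤ _ ψ, ?_⟩, funext hψ⟩
    exact MonoidAlgebra.lift_of _ _
  obtain ⟨_, ⟨x, rfl⟩, hx⟩ := h1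
  exact ⟨x, Subtype.ext hx⟩

/-- Distinct elements of `A^*` give distinct homomorphisms to `ℂ`, and these are linearly
independent. -/
theorem dualAlgHom_injective : Function.Injective (dualAlgHom A) := by
  rw [injective_iff_map_eq_zero]
  intro x hx
  let f : Dual A → (A →* ℂ) := fun χ => (Units.coeHom ℂ).comp (expQZ.comp χ)
  have hf : Function.Injective f := fun χ χ' h => MonoidHom.ext fun a =>
    expQZ_injective (Units.ext (DFunLike.congr_fun h a))
  have hli : LinearIndependent ℂ fun χ : Dual A => (f χ : A → ℂ) :=
    (linearIndependent_monoidHom A ℂ).comp f hf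
  have h1 : ∑ χ ∈ x.coeff.support, ((x.coeff χ : ℤ) : ℂ) • (f χ : A → ℂ) = 0 := by
    have h2 := congrArg Subtype.val hx
    rw [dualAlgHom, MonoidAlgebra.lift_apply, Finsupp.sum] at h2
    have h3 : (((∑ χ ∈ x.coeff.support, x.coeff χ • charClass A χ : RepRing A)) : A → ℂ) =
        ∑ χ ∈ x.coeff.support, ((x.coeff χ : ℤ) : ℂ) • (f χ : A → ℂ) := by
      rw [AddSubmonoidClass.coe_finsetSum]
      refine Finset.sum_congr rfl fun χ _ => ?_
      rw [Int.cast_smul_eq_zsmul]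
      rfl
    rw [← h3, h2]
    rfl
  have h4 := linearIndependent_iff'.1 hli x.coeff.support (fun χ => ((x.coeff χ : ℤ) : ℂ)) h1
  ext χ
  by_cases hχ : χ ∈ x.coeff.support
  · exact_mod_cast h4 χ hχ
  · simpa using hχ

/-- `ℤ[A^*] ≅ R(A)`. -/
noncomputable def dualAlgEquiv (A : Type) [CommGroup A] [Finite A] :
    MonoidAlgebra ℤ (Dual A) ≃+* RepRing A :=
  RingEquiv.ofBijective (dualAlgHom A).toRingHom ⟨dualAlgHom_injective, dualAlgHom_surjective⟩

theorem dualAlgEquiv_of [Finite A] (χ : Dual A) :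
    dualAlgEquiv A (MonoidAlgebra.of ℤ _ χ) = charClass A χ :=
  MonoidAlgebra.lift_of _ _

theorem repRing_hom_ext [Finite A] {K : Type} [CommRing K] {f g : RepRing A →+* K}
    (h : ∀ χ, f (charClass A χ) = g (charClass A χ)) : f = g := by
  have h1 : f.comp (dualAlgEquiv A : MonoidAlgebra ℤ (Dual A) →+* RepRing A) =
      g.comp (dualAlgEquiv A : MonoidAlgebra ℤ (Dual A) →+* RepRing A) := by
    refine MonoidAlgebra.ringHom_ext' (Subsingleton.elim _ _) (MonoidHom.ext fun χ => ?_)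
    have h2 := h χ
    rw [← dualAlgEquiv_of] at h2
    exact h2
  refine RingHom.ext fun r => ?_
  obtain ⟨x, rfl⟩ := (dualAlgEquiv A).surjective r
  exact RingHom.congr_fun h1 x

theorem exists_repRing_hom [Finite A] {K : Type} [CommRing K] (φ : Dual A →* Kˣ) :
    ∃ f : RepRing A →+* K, ∀ χ, f (charClass A χ) = φ χ := by
  let g : MonoidAlgebra ℤ (Dual A) →ₐ[ℤ] K :=
    MonoidAlgebra.lift ℤ _ _ ((Units.coeHom K).comp φ)
  refine ⟨g.toRingHom.comp ((dualAlgEquiv A).symm : RepRing A →+* MonoidAlgebra ℤ (Dual A)),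
    fun χ => ?_⟩
  have h1 : (dualAlgEquiv A).symm (charClass A χ) = MonoidAlgebra.of ℤ _ χ := by
    rw [RingEquiv.symm_apply_eq, dualAlgEquiv_of]
  change g ((dualAlgEquiv A).symm (charClass A χ)) = _
  rw [h1]
  exact MonoidAlgebra.lift_of _ _

theorem chiMap_app_bijective [Finite A] (K : CommRingCat.{0}) :
    Function.Bijective ((chiMap A).app K) := by
  constructor
  · intro f g h
    refine repRing_hom_ext fun χ => ?_
    exact congrArg (fun φ : Dual A →* Kˣ => (φ χ : K)) h
  · intro φ
    obtain ⟨f, hf⟩ := exists_repRing_hom (A := A) φ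
    exact ⟨f, MonoidHom.ext fun χ => Units.ext (hf χ)⟩

theorem isIso_of_app_bijective {X Y : CommRingCat.{0} ⥤ Type} (f : X ⟶ Y)
    (h : ∀ K, Function.Bijective (f.app K)) : IsIso f := by
  rw [NatTrans.isIso_iff_isIso_app]
  exact fun K => (isIso_iff_bijective _).2 (h K)

theorem isIso_chiMap [Finite A] : IsIso (chiMap A) :=
  isIso_of_app_bijective _ chiMap_app_bijective

theorem isIso_specMap {R S : Type} [CommRing R] [CommRing S] (e : R ≃+* S) :
    IsIso (specMap (e : R →+* S)) := by
  refine isIso_of_app_bijective _ fun K => ⟨fun f g h => ?_, fun f => ?_⟩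
  · refine RingHom.ext fun s => ?_
    obtain ⟨r, rfl⟩ := e.surjective s
    exact RingHom.congr_fun h r
  · let f' : R →+* K := f
    refine ⟨f'.comp (e.symm : S →+* R), ?_⟩
    refine RingHom.ext fun r => ?_
    change f' (e.symm (e r)) = f' r
    rw [e.symm_apply_apply]

end Abelian

end HeightOne

namespace HeightOne

/-! ### Closed subschemes of `𝔾_m` -/

section Subscheme

variable {K : Type} [CommRing K]

/-- The coordinate of the closed subscheme of `𝔾_m` with ideal `J`. -/
noncomputable def coord (J : Ideal K[T;T⁻¹]) : (K[T;T⁻¹] ⧸ J)ˣ :=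
  Units.map (Ideal.Quotient.mk J : K[T;T⁻¹] →* K[T;T⁻¹] ⧸ J)
    ⟨LaurentPolynomial.T 1, LaurentPolynomial.T (-1),
      by rw [← LaurentPolynomial.T_add, add_neg_cancel, LaurentPolynomial.T_zero],
      by rw [← LaurentPolynomial.T_add, neg_add_cancel, LaurentPolynomial.T_zero]⟩

theorem coord_val (J : Ideal K[T;T⁻¹]) :
    (coord J : K[T;T⁻¹] ⧸ J) = Ideal.Quotient.mk J (LaurentPolynomial.T 1) := rfl

theorem coord_pow (J : Ideal K[T;T⁻¹]) (n : ℕ) :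
    (coord J : K[T;T⁻¹] ⧸ J) ^ n = Ideal.Quotient.mk J (LaurentPolynomial.T n) := by
  rw [coord_val, ← map_pow, LaurentPolynomial.T_pow, mul_one]

theorem ringHom_ext_laurent {S : Type} [CommRing S] {f g : K[T;T⁻¹] →+* S}
    (hC : ∀ a, f (LaurentPolynomial.C a) = g (LaurentPolynomial.C a))
    (hT : f (LaurentPolynomial.T 1) = g (LaurentPolynomial.T 1)) : f = g := by
  have hT' : f (LaurentPolynomial.T (-1)) = g (LaurentPolynomial.T (-1)) := by
    have h1 : ∀ h : K[T;T⁻¹] →+* S,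
        h (LaurentPolynomial.T 1) * h (LaurentPolynomial.T (-1)) = 1 := by
      intro h
      rw [← map_mul, ← LaurentPolynomial.T_add, add_neg_cancel, LaurentPolynomial.T_zero, map_one]
    exact inv_unique (h1 f) (hT ▸ h1 g)
  refine RingHom.ext fun p => ?_
  induction p using LaurentPolynomial.induction_on with
  | h_C a => exact hC a
  | h_add hp hq => rw [map_add, map_add, hp, hq]
  | h_C_mul_T n a h =>
    rw [LaurentPolynomial.T_add, ← mul_assoc, map_mul, map_mul g, h, hT]
  | h_C_mul_T_Z n a h =>
    rw [sub_eq_add_neg, LaurentPolynomial.T_add, ← mul_assoc, map_mul, map_mul g, h, hT']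

theorem eval₂_coord (J : Ideal K[T;T⁻¹]) (f : K[T;T⁻¹]) :
    LaurentPolynomial.eval₂ (algebraMap K (K[T;T⁻¹] ⧸ J)) (coord J) f = Ideal.Quotient.mk J f := by
  have h : LaurentPolynomial.eval₂ (algebraMap K (K[T;T⁻¹] ⧸ J)) (coord J) =
      Ideal.Quotient.mk J := by
    refine ringHom_ext_laurent (fun a => ?_) ?_
    · rw [LaurentPolynomial.eval₂_C]
      rfl
    · rw [LaurentPolynomial.eval₂_T, zpow_one]
      rfl
  rw [h]

/-- This is the tautological point. The subgroup conditions, stated for points in all algebras, are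
exploited by evaluating them at it. -/
theorem coord_mem_points (J : Ideal K[T;T⁻¹]) : coord J ∈ points J (K[T;T⁻¹] ⧸ J) := by
  intro f hf
  rw [eval₂_coord]
  exact Ideal.Quotient.eq_zero_iff_mem.2 hf

theorem eval₂_map {S S' : Type} [CommRing S] [CommRing S'] [Algebra K S] [Algebra K S']
    (g : S →ₐ[K] S') (u : Sˣ) (f : K[T;T⁻¹]) :
    LaurentPolynomial.eval₂ (algebraMap K S') (Units.map (g : S →* S') u) f =
      g (LaurentPolynomial.eval₂ (algebraMap K S) u f) := by
  have h : LaurentPolynomial.eval₂ (algebraMap K S') (Units.map (g : S →* S') u) =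
      (g : S →+* S').comp (LaurentPolynomial.eval₂ (algebraMap K S) u) := by
    refine ringHom_ext_laurent (fun a => ?_) ?_
    · simp
    · simp only [LaurentPolynomial.eval₂_T, RingHom.comp_apply, zpow_one]
      rfl
  rw [h]
  rfl

theorem map_mem_points {J : Ideal K[T;T⁻¹]} {S S' : Type} [CommRing S] [CommRing S'] [Algebra K S]
    [Algebra K S'] (g : S →ₐ[K] S') {u : Sˣ} (hu : u ∈ points J S) :
    Units.map (g : S →* S') u ∈ points J S' := by
  intro f hf
  rw [eval₂_map, hu f hf, map_zero]

/-- A point of a closed subscheme defines a homomorphism on its ring of functions. -/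
noncomputable def pointHom {J : Ideal K[T;T⁻¹]} {S : Type} [CommRing S] [Algebra K S] {u : Sˣ}
    (hu : u ∈ points J S) : (K[T;T⁻¹] ⧸ J) →ₐ[K] S where
  toRingHom := Ideal.Quotient.lift J (LaurentPolynomial.eval₂ (algebraMap K S) u) hu
  commutes' a := by
    change LaurentPolynomial.eval₂ (algebraMap K S) u (algebraMap K K[T;T⁻¹] a) = _
    exact LaurentPolynomial.eval₂_C _ _ _

theorem pointHom_coord {J : Ideal K[T;T⁻¹]} {S : Type} [CommRing S] [Algebra K S] {u : Sˣ}
    (hu : u ∈ points J S) : pointHom hu (coord J : K[T;T⁻¹] ⧸ J) = u := by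
  change LaurentPolynomial.eval₂ (algebraMap K S) u (LaurentPolynomial.T 1) = u
  rw [LaurentPolynomial.eval₂_T, zpow_one]

theorem mem_points_span_sub {S : Type} [CommRing S] [Algebra K S] (l : ℕ) (v : K) (u : Sˣ) :
    u ∈ points (Ideal.span {LaurentPolynomial.T (l : ℤ) - LaurentPolynomial.C v}) S ↔
      (u : S) ^ l = algebraMap K S v := by
  have h1 : u ∈ points (Ideal.span {LaurentPolynomial.T (l : ℤ) - LaurentPolynomial.C v}) S ↔
      Ideal.span {LaurentPolynomial.T (l : ℤ) - LaurentPolynomial.C v} ≤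
        RingHom.ker (LaurentPolynomial.eval₂ (algebraMap K S) u) := Iff.rfl
  rw [h1, Ideal.span_singleton_le_iff_mem, RingHom.mem_ker, map_sub, LaurentPolynomial.eval₂_T_n,
    LaurentPolynomial.eval₂_C, sub_eq_zero]

/-- The span of the powers of the coordinate. -/
theorem span_zpow_coord (J : Ideal K[T;T⁻¹]) :
    Submodule.span K (Set.range fun n : ℤ => ((coord J ^ n : (K[T;T⁻¹] ⧸ J)ˣ) : K[T;T⁻¹] ⧸ J)) =
      ⊤ := by
  rw [eq_top_iff]
  rintro x -
  obtain ⟨f, rfl⟩ := Ideal.Quotient.mk_surjective x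
  rw [← eval₂_coord]
  induction f using LaurentPolynomial.induction_on' with
  | add p q hp hq =>
    rw [map_add]
    exact add_mem hp hq
  | C_mul_T n a =>
    rw [LaurentPolynomial.eval₂_C_mul_T, ← Algebra.smul_def]
    exact Submodule.smul_mem _ _ (Submodule.subset_span ⟨n, rfl⟩)

/-- The map `K^l → K[T, T⁻¹] / J` given by `1, T, …, T^{l-1}`. -/
noncomputable def powMap (l : ℕ) (J : Ideal K[T;T⁻¹]) :
    (Fin l → K) →ₗ[K] K[T;T⁻¹] ⧸ J :=
  Fintype.linearCombination K fun i : Fin l => (coord J : K[T;T⁻¹] ⧸ J) ^ (i : ℕ)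

theorem powMap_apply (l : ℕ) (J : Ideal K[T;T⁻¹]) (c : Fin l → K) :
    powMap l J c = ∑ i, c i • (coord J : K[T;T⁻¹] ⧸ J) ^ (i : ℕ) := rfl

theorem range_powMap (l : ℕ) (J : Ideal K[T;T⁻¹]) : LinearMap.range (powMap l J) =
    Submodule.span K (Set.range fun i : Fin l => (coord J : K[T;T⁻¹] ⧸ J) ^ (i : ℕ)) :=
  Fintype.range_linearCombination K _

theorem coord_pow_span_sub (l : ℕ) (v : K) :
    (coord (Ideal.span {LaurentPolynomial.T (l : ℤ) - LaurentPolynomial.C v}) :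
      K[T;T⁻¹] ⧸ Ideal.span {LaurentPolynomial.T (l : ℤ) - LaurentPolynomial.C v}) ^ l =
      algebraMap K _ v :=
  (mem_points_span_sub l v _).1 (coord_mem_points _)

/-- In the quotient `T^n` is `v^(n / l) T^(n % l)`; this covers negative `n` as well because `v` is
a unit. -/
theorem powMap_span_sub_surjective {l : ℕ} (hl : 0 < l) (v : Kˣ) :
    Function.Surjective
      (powMap l (Ideal.span {LaurentPolynomial.T (l : ℤ) - LaurentPolynomial.C (v : K)})) := by
  set J := Ideal.span {LaurentPolynomial.T (l : ℤ) - LaurentPolynomial.C (v : K)} with hJ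
  rw [← LinearMap.range_eq_top, eq_top_iff, ← span_zpow_coord J, Submodule.span_le]
  rintro _ ⟨n, rfl⟩
  have hl0 : (l : ℤ) ≠ 0 := by exact_mod_cast hl.ne'
  obtain ⟨r, hr⟩ := Int.eq_ofNat_of_zero_le (Int.emod_nonneg n hl0)
  have hrl : r < l := by
    have := Int.emod_lt_of_pos n (by exact_mod_cast hl : (0 : ℤ) < l)
    omega
  have h1 : coord J ^ l = Units.map (algebraMap K (K[T;T⁻¹] ⧸ J) : K →* _) v :=
    Units.ext (coord_pow_span_sub l (v : K))
  have h2 : ((coord J ^ n : (K[T;T⁻¹] ⧸ J)ˣ) : K[T;T⁻¹] ⧸ J) =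
      ((v ^ (n / l) : Kˣ) : K) • (coord J : K[T;T⁻¹] ⧸ J) ^ r := by
    conv_lhs => rw [← Int.mul_ediv_add_emod n l, hr]
    rw [zpow_add, zpow_mul, Units.val_mul, zpow_natCast, h1, ← map_zpow]
    exact (Algebra.smul_def ((v ^ (n / l) : Kˣ) : K) ((coord J : K[T;T⁻¹] ⧸ J) ^ r)).symm
  change ((coord J ^ n : (K[T;T⁻¹] ⧸ J)ˣ) : K[T;T⁻¹] ⧸ J) ∈ _
  rw [h2, range_powMap]
  exact Submodule.smul_mem _ _ (Submodule.subset_span ⟨⟨r, hrl⟩, rfl⟩)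

/-- The root of `X^l - v` in `AdjoinRoot` is a unit, since its `l`-th power is, and so defines a
point there. A relation among the first `l` powers then becomes a polynomial of degree below `l`
divisible by a monic one of degree `l`. -/
theorem powMap_span_sub_injective {l : ℕ} (hl : 0 < l) (v : Kˣ) :
    Function.Injective
      (powMap l (Ideal.span {LaurentPolynomial.T (l : ℤ) - LaurentPolynomial.C (v : K)})) := by
  rcases subsingleton_or_nontrivial K with hK | hK
  · exact Function.injective_of_subsingleton _
  rw [injective_iff_map_eq_zero]
  intro c hc
  let g : Polynomial K := Polynomial.X ^ l - Polynomial.C (v : K)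
  have hg : g.Monic := Polynomial.monic_X_pow_sub_C _ hl.ne'
  have hroot : (AdjoinRoot.root g) ^ l = algebraMap K (AdjoinRoot g) v := by
    have h1 : AdjoinRoot.mk g g = 0 := AdjoinRoot.mk_self
    rw [map_sub, map_pow, AdjoinRoot.mk_X, AdjoinRoot.mk_C, sub_eq_zero] at h1
    exact h1
  have hunit : IsUnit (AdjoinRoot.root g) := by
    rw [← isUnit_pow_iff hl.ne', hroot]
    exact v.isUnit.map _
  obtain ⟨u, hu⟩ := hunit
  have hp := (mem_points_span_sub (K := K) l (v : K) u).2 (by rw [hu, hroot])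
  have h2 := congrArg (pointHom hp) hc
  rw [powMap_apply, map_sum, map_zero] at h2
  simp only [map_smul, map_pow, pointHom_coord, hu] at h2
  let p : Polynomial K := ∑ i : Fin l, Polynomial.C (c i) * Polynomial.X ^ (i : ℕ)
  have hpz : AdjoinRoot.mk g p = 0 := by
    rw [map_sum, ← h2]
    refine Finset.sum_congr rfl fun i _ => ?_
    rw [map_mul, map_pow, AdjoinRoot.mk_X, AdjoinRoot.mk_C, Algebra.smul_def]
    rfl
  have hdeg : p.degree < g.degree := by
    rw [Polynomial.degree_X_pow_sub_C hl]
    exact Polynomial.degree_sum_fin_lt c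
  have hp0 : p = 0 := by
    by_contra hne
    exact hg.not_dvd_of_degree_lt hne hdeg (AdjoinRoot.mk_eq_zero.1 hpz)
  ext i
  have h3 := congrArg (fun q => Polynomial.coeff q (i : ℕ)) hp0
  simp only [p, Polynomial.finsetSum_coeff, Polynomial.coeff_C_mul_X_pow,
    Polynomial.coeff_zero] at h3
  simpa [Fin.val_inj] using h3

theorem powMap_span_sub_bijective {l : ℕ} (hl : 0 < l) (v : Kˣ) :
    Function.Bijective
      (powMap l (Ideal.span {LaurentPolynomial.T (l : ℤ) - LaurentPolynomial.C (v : K)})) :=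
  ⟨powMap_span_sub_injective hl v, powMap_span_sub_surjective hl v⟩

/-! ### Bases of powers -/

/-- In a finite-dimensional algebra, the powers of a unit lie in the span of the first ones. -/
theorem zpow_mem_span {F D : Type} [Field F] [CommRing D] [Algebra F D] [FiniteDimensional F D]
    (t : Dˣ) {l : ℕ} (h : Module.finrank F D = l) (n : ℤ) :
    ((t ^ n : Dˣ) : D) ∈ Submodule.span F (Set.range fun i : Fin l => (t : D) ^ (i : ℕ)) := by
  rcases subsingleton_or_nontrivial D with hD | hD
  · rw [Subsingleton.elim (((t ^ n : Dˣ) : D)) 0]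
    exact zero_mem _
  have hl : 0 < l := h ▸ Module.finrank_pos
  set N := Submodule.span F (Set.range fun i : Fin l => (t : D) ^ (i : ℕ)) with hN
  -- Cayley–Hamilton for multiplication by `t` expresses `t^l` through lower powers, so `N` is
  -- stable under `t`.
  let p := (Algebra.lmul F D (t : D)).charpoly
  have hmonic : p.Monic := LinearMap.charpoly_monic _
  have hdeg : p.natDegree = l := by rw [LinearMap.charpoly_natDegree, h]
  have hroot : Polynomial.aeval (t : D) p = 0 := by
    have h1 : Polynomial.aeval (Algebra.lmul F D (t : D)) p = 0 := LinearMap.aeval_self_charpoly _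
    rw [Polynomial.aeval_algHom_apply] at h1
    have h2 := LinearMap.congr_fun h1 1
    simpa using h2
  have hpow : (t : D) ^ l ∈ N := by
    rw [hmonic.as_sum, hdeg, map_add, map_pow, Polynomial.aeval_X, map_sum] at hroot
    rw [eq_neg_of_add_eq_zero_left hroot]
    refine neg_mem (sum_mem fun i hi => ?_)
    rw [map_mul, Polynomial.aeval_C, map_pow, Polynomial.aeval_X, ← Algebra.smul_def]
    exact Submodule.smul_mem _ _ (Submodule.subset_span ⟨⟨i, Finset.mem_range.1 hi⟩, rfl⟩)
  have hmul : ∀ x ∈ N, (t : D) * x ∈ N := by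
    intro x hx
    induction hx using Submodule.span_induction with
    | mem x hx =>
      obtain ⟨i, rfl⟩ := hx
      change (t : D) * (t : D) ^ (i : ℕ) ∈ N
      rw [← pow_succ']
      rcases Nat.lt_or_ge ((i : ℕ) + 1) l with hi | hi
      · exact Submodule.subset_span ⟨⟨i + 1, hi⟩, rfl⟩
      · rw [show (i : ℕ) + 1 = l by omega]
        exact hpow
    | zero => rw [mul_zero]; exact zero_mem _
    | add x y _ _ hx hy => rw [mul_add]; exact add_mem hx hy
    | smul a x _ hx => rw [mul_smul_comm]; exact Submodule.smul_mem _ _ hx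
  -- Multiplication by `t` is injective on the finite-dimensional `N`, hence onto, so `N` is stable
  -- under `t⁻¹` too.
  let g : N →ₗ[F] N := (Algebra.lmul F D (t : D)).restrict hmul
  have hg : Function.Injective g := by
    intro x y hxy
    exact Subtype.ext ((Units.mul_right_inj t).1 (congrArg Subtype.val hxy))
  have hinv : ∀ x ∈ N, ((t⁻¹ : Dˣ) : D) * x ∈ N := by
    intro x hx
    obtain ⟨y, hy⟩ := (LinearMap.injective_iff_surjective.1 hg) ⟨x, hx⟩
    have h1 : (t : D) * y = x := congrArg Subtype.val hy
    rw [← h1, Units.inv_mul_cancel_left]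
    exact y.2
  induction n with
  | zero => exact Submodule.subset_span ⟨⟨0, hl⟩, by simp⟩
  | succ n ih =>
    rw [zpow_add, zpow_one, mul_comm, Units.val_mul]
    exact hmul _ ih
  | pred n ih =>
    rw [zpow_sub, zpow_one, mul_comm, Units.val_mul]
    exact hinv _ ih

/-- The cokernel is a finite module, so by Nakayama it is enough that it vanishes over every residue
field, where `zpow_mem_span` applies. -/
theorem powMap_surjective_of_rank (l : ℕ) (J : Ideal K[T;T⁻¹])
    [Module.Finite K (K[T;T⁻¹] ⧸ J)] [Module.Projective K (K[T;T⁻¹] ⧸ J)]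
    (hrank : ∀ q : PrimeSpectrum K, Module.rankAtStalk (K[T;T⁻¹] ⧸ J) q = l) :
    Function.Surjective (powMap l J) := by
  rw [← LinearMap.range_eq_top, ← Submodule.Quotient.subsingleton_iff,
    ← Module.support_eq_empty_iff (R := K), Set.eq_empty_iff_forall_notMem]
  intro q hq
  rw [Module.mem_support_iff_nontrivial_residueField_tensorProduct] at hq
  let κ := q.asIdeal.ResidueField
  let D := κ ⊗[K] (K[T;T⁻¹] ⧸ J)
  let t : Dˣ := Units.map
    ((Algebra.TensorProduct.includeRight : (K[T;T⁻¹] ⧸ J) →ₐ[K] D) : _ →* D) (coord J)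
  have hfin : Module.finrank κ D = l := by rw [← hrank q, Module.rankAtStalk_eq]
  have hN : Submodule.span κ (Set.range fun i : Fin l => (t : D) ^ (i : ℕ)) = ⊤ := by
    rw [eq_top_iff]
    rintro x -
    induction x using TensorProduct.induction_on with
    | zero => exact zero_mem _
    | add x y hx hy => exact add_mem hx hy
    | tmul a m =>
      have h1 : (a ⊗ₜ[K] m : D) = a • ((1 : κ) ⊗ₜ[K] m) := by
        rw [TensorProduct.smul_tmul', smul_eq_mul, mul_one]
      rw [h1]
      refine Submodule.smul_mem _ _ ?_
      clear h1
      have h2 : m ∈ Submodule.span K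
          (Set.range fun n : ℤ => ((coord J ^ n : (K[T;T⁻¹] ⧸ J)ˣ) : K[T;T⁻¹] ⧸ J)) := by
        rw [span_zpow_coord]
        trivial
      induction h2 using Submodule.span_induction with
      | mem x hx =>
        obtain ⟨n, rfl⟩ := hx
        have h3 := zpow_mem_span (F := κ) (D := D) t hfin n
        rw [← map_zpow] at h3
        exact h3
      | zero => rw [TensorProduct.tmul_zero]; exact zero_mem _
      | add x y _ _ hx hy =>
        rw [TensorProduct.tmul_add]
        exact add_mem hx hy
      | smul b x _ hx =>
        rw [TensorProduct.tmul_smul, ← algebraMap_smul κ b]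
        exact Submodule.smul_mem _ _ hx
  let f := LinearMap.baseChange κ (LinearMap.range (powMap l J)).mkQ
  have hf : Function.Surjective f :=
    LinearMap.lTensor_surjective κ (Submodule.mkQ_surjective _)
  have hf0 : f = 0 := by
    refine LinearMap.ext_on_range hN fun i => ?_
    have h1 : (t : D) ^ (i : ℕ) = (1 : κ) ⊗ₜ[K] ((coord J : K[T;T⁻¹] ⧸ J) ^ (i : ℕ)) := by
      change ((1 : κ) ⊗ₜ[K] (coord J : K[T;T⁻¹] ⧸ J)) ^ (i : ℕ) = _
      rw [Algebra.TensorProduct.tmul_pow, one_pow]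
    rw [h1, LinearMap.baseChange_tmul, LinearMap.zero_apply]
    have h2 : (LinearMap.range (powMap l J)).mkQ ((coord J : K[T;T⁻¹] ⧸ J) ^ (i : ℕ)) = 0 := by
      rw [← LinearMap.mem_ker, Submodule.ker_mkQ, range_powMap]
      exact Submodule.subset_span ⟨i, rfl⟩
    rw [h2, TensorProduct.tmul_zero]
  obtain ⟨x, y, hxy⟩ := hq
  obtain ⟨a, rfl⟩ := hf x
  obtain ⟨b, rfl⟩ := hf y
  exact hxy (by rw [hf0]; rfl)

/-- The surjection splits, so its kernel is a finite projective module of rank `l - l = 0`. -/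
theorem injective_of_surjective_of_rank {l : ℕ} {M : Type} [AddCommGroup M] [Module K M]
    [Module.Finite K M] [Module.Projective K M] (f : (Fin l → K) →ₗ[K] M)
    (hf : Function.Surjective f) (hrank : ∀ q : PrimeSpectrum K, Module.rankAtStalk M q = l) :
    Function.Injective f := by
  obtain ⟨s, hs⟩ := Module.projective_lifting_property f LinearMap.id hf
  have hs' : ∀ x, f (s x) = x := fun x => LinearMap.congr_fun hs x
  let pr : (Fin l → K) →ₗ[K] LinearMap.ker f :=
    (LinearMap.id - s ∘ₗ f).codRestrict _ fun x => by simp [hs']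
  let e : (Fin l → K) ≃ₗ[K] M × LinearMap.ker f :=
    LinearEquiv.ofLinearMap (f.prod pr) (s.coprod (LinearMap.ker f).subtype)
      (by
        ext x
        · simp [hs']
        · simp [pr, hs']
        · simp
        · simp [pr])
      (by
        refine LinearMap.ext fun x => ?_
        simp [pr])
  have : Module.Projective K (LinearMap.ker f) := by
    refine Module.Projective.of_split (LinearMap.ker f).subtype pr ?_
    ext x
    simp [pr]
  have : Module.Finite K (LinearMap.ker f) := Module.Finite.of_surjective pr fun x =>
    ⟨x, Subtype.ext (by simp [pr])⟩
  have h0 : Module.rankAtStalk (R := K) (LinearMap.ker f) = 0 := by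
    ext q
    have := q.nontrivial
    have h1 := congrFun (Module.rankAtStalk_eq_of_equiv e) q
    rw [Module.rankAtStalk_prod, Module.rankAtStalk_eq_finrank_of_free, Pi.add_apply, hrank] at h1
    simpa using h1
  rw [← LinearMap.ker_eq_bot, ← Submodule.subsingleton_iff_eq_bot]
  exact Module.rankAtStalk_eq_zero_iff_subsingleton.1 h0

end Subscheme

end HeightOne

namespace HeightOne

/-! ### The dual of a surjection -/

theorem hom_ext_single {ι : Type} [Finite ι] [DecidableEq ι] {M : Type} [CommMonoid M]
    {f g : Multiplicative (ι → ℤ) →* M}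
    (h : ∀ i, f (.ofAdd (Pi.single i 1)) = g (.ofAdd (Pi.single i 1))) : f = g := by
  have h1 : MonoidHom.toAdditiveRight f = MonoidHom.toAdditiveRight g := by
    refine AddMonoidHom.functions_ext' _ _ _ fun i => ?_
    refine AddMonoidHom.ext_int ?_
    exact congrArg Additive.ofMul (h i)
  exact MonoidHom.toAdditiveRight.injective h1

theorem dualMap_injective {ι : Type} [Finite ι] [DecidableEq ι] {A : Type} [Group A]
    {p : Multiplicative (ι → ℤ) →* A} (hp : Function.Surjective p) :
    Function.Injective (dualMap p) := by
  intro χ ψ h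
  have h1 : (Additive.toMul χ).comp p = (Additive.toMul ψ).comp p :=
    hom_ext_single fun i => congrFun h i
  exact congrArg Additive.ofMul ((MonoidHom.cancel_right hp).1 h1)

/-! ### The map `c` is well defined -/

section Pullback

variable {h : ℕ} {A : Type} [CommGroup A] {p : Multiplicative (Fin h → ℤ) →* A}
  {K : Type} [CommRing K]

/-- The dual of a surjection is injective, so exactly one `χ` enters the infimum. -/
theorem pullbackSubscheme_dualMap (hp : Function.Surjective p) (l : ℕ) (φ : Dual A →* Kˣ)
    (χ : Dual A) : pullbackSubscheme p l φ (dualMap p (.ofMul χ)) =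
      Ideal.span {LaurentPolynomial.T (l : ℤ) - LaurentPolynomial.C (φ χ : K)} := by
  refine le_antisymm (iInf_le_of_le χ (iInf_le _ rfl)) (le_iInf fun ψ => le_iInf fun hψ => ?_)
  rw [Additive.ofMul.injective (dualMap_injective hp hψ)]

theorem pullbackSubscheme_eq_top (l : ℕ) (φ : Dual A →* Kˣ) {x : Fin h → QZ}
    (hx : x ∉ (dualMap p).range) : pullbackSubscheme p l φ x = ⊤ := by
  refine iInf₂_eq_top.2 fun χ hχ => ?_
  exact (hx ⟨_, hχ⟩).elim

theorem subsingleton_of_mem_points_top {S : Type} [CommRing S] [Algebra K S] {u : Sˣ}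
    (hu : u ∈ points (⊤ : Ideal K[T;T⁻¹]) S) : Subsingleton S := by
  have h1 := hu 1 trivial
  rw [map_one] at h1
  exact subsingleton_of_zero_eq_one h1.symm

theorem mem_points_of_subsingleton {S : Type} [CommRing S] [Algebra K S] [Subsingleton S]
    (J : Ideal K[T;T⁻¹]) (u : Sˣ) : u ∈ points J S :=
  fun _ _ => Subsingleton.elim _ _

/-- The ring of functions of the closed subscheme `T ^ l = v` is free of rank `l`. -/
noncomputable def spanSubEquiv {l : ℕ} (hl : 0 < l) (v : Kˣ) : (Fin l → K) ≃ₗ[K]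
    K[T;T⁻¹] ⧸ Ideal.span {LaurentPolynomial.T (l : ℤ) - LaurentPolynomial.C (v : K)} :=
  LinearEquiv.ofBijective _ (powMap_span_sub_bijective hl v)

theorem rankAtStalk_span_sub {l : ℕ} (hl : 0 < l) (v : Kˣ) (q : PrimeSpectrum K) :
    Module.rankAtStalk
      (K[T;T⁻¹] ⧸ Ideal.span {LaurentPolynomial.T (l : ℤ) - LaurentPolynomial.C (v : K)}) q =
      l := by
  have := q.nontrivial
  rw [← congrFun (Module.rankAtStalk_eq_of_equiv (spanSubEquiv hl v)) q,
    Module.rankAtStalk_eq_finrank_of_free]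
  simp

theorem hasProjection_pullbackSubscheme (hp : Function.Surjective p) {l : ℕ} (hl : 0 < l)
    (φ : Dual A →* Kˣ) : HasProjection K (dualMap p).range (pullbackSubscheme p l φ) := by
  refine ⟨fun x hx => pullbackSubscheme_eq_top l φ hx, ?_⟩
  rintro _ ⟨χ, rfl⟩
  have := pullbackSubscheme_dualMap hp l φ χ.toMul
  rw [ofMul_toMul] at this
  rw [this]
  have : Nonempty (Fin l) := ⟨⟨0, hl⟩⟩
  exact Module.FaithfullyFlat.of_linearEquiv _ _
    ((spanSubEquiv hl (φ χ.toMul)).symm.trans (Finsupp.linearEquivFunOnFinite K K (Fin l)).symm)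

theorem finsum_range_dualMap [Finite A] (hp : Function.Surjective p) {f : (Fin h → QZ) → ℕ} {r : ℕ}
    (h0 : ∀ x, x ∉ (dualMap p).range → f x = 0) (hr : ∀ x, x ∈ (dualMap p).range → f x = r) :
    ∑ᶠ x, f x = r * Nat.card A := by
  have h1 : Function.support f ⊆ Set.range (dualMap p) := by
    intro x hx
    by_contra hx'
    exact hx (h0 x hx')
  rw [← finsum_mem_univ, ← finsum_mem_inter_support_eq' f (Set.range (dualMap p)) Set.univ
    (fun x hx => ⟨fun _ => trivial, fun _ => h1 hx⟩), finsum_mem_range (dualMap_injective hp),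
    finsum_congr fun χ => hr _ ⟨χ, rfl⟩]
  have : Fintype (Additive (Dual A)) := Fintype.ofFinite _
  rw [finsum_eq_sum_of_fintype, Finset.sum_const, Finset.card_univ, smul_eq_mul, mul_comm,
    ← Nat.card_eq_fintype_card]
  exact congrArg (r * ·) card_dual

theorem isSubgroupOfOrder_pullbackSubscheme [Finite A] (hp : Function.Surjective p) {l : ℕ}
    (hl : 0 < l) (φ : Dual A →* Kˣ) :
    IsSubgroupOfOrder K (l * Nat.card A) (pullbackSubscheme p l φ) := by
  have hcase : ∀ (P : Ideal K[T;T⁻¹] → Prop), P ⊤ → (∀ v : Kˣ, P (Ideal.span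
      {LaurentPolynomial.T (l : ℤ) - LaurentPolynomial.C (v : K)})) →
      ∀ x, P (pullbackSubscheme p l φ x) := by
    intro P h1 h2 x
    by_cases hx : x ∈ (dualMap p).range
    · obtain ⟨χ, rfl⟩ := hx
      exact (pullbackSubscheme_dualMap hp l φ χ.toMul) ▸ h2 _
    · rw [pullbackSubscheme_eq_top l φ hx]
      exact h1
  have htop : Subsingleton (K[T;T⁻¹] ⧸ (⊤ : Ideal K[T;T⁻¹])) :=
    Ideal.Quotient.subsingleton_iff.2 rfl
  -- The zero ring is set apart: it has points even over the empty fibres.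
  have hval : ∀ (S : Type) [CommRing S] [Algebra K S] (x : Fin h → QZ) (u : Sˣ),
      u ∈ points (pullbackSubscheme p l φ x) S → Subsingleton S ∨
        ∃ χ : Dual A, dualMap p (.ofMul χ) = x ∧ (u : S) ^ l = algebraMap K S (φ χ) := by
    intro S _ _ x u hu
    by_cases hx : x ∈ (dualMap p).range
    · obtain ⟨χ, rfl⟩ := hx
      refine Or.inr ⟨χ.toMul, rfl, ?_⟩
      rw [← mem_points_span_sub, ← pullbackSubscheme_dualMap hp]
      exact hu
    · rw [pullbackSubscheme_eq_top l φ hx] at hu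
      exact Or.inl (subsingleton_of_mem_points_top hu)
  refine ⟨?_, ?_, ?_, fun q => ?_, fun S _ _ => ?_, fun S _ _ x y u v hu hv => ?_,
    fun S _ _ x u hu => ?_⟩
  · refine (Set.finite_range (dualMap p)).subset fun x hx => ?_
    by_contra hx'
    exact hx (pullbackSubscheme_eq_top l φ hx')
  · refine hcase (fun J => Module.Finite K (K[T;T⁻¹] ⧸ J)) inferInstance fun v => ?_
    exact Module.Finite.equiv (spanSubEquiv hl v)
  · refine hcase (fun J => Module.Projective K (K[T;T⁻¹] ⧸ J)) inferInstance fun v => ?_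
    exact Module.Projective.of_equiv (spanSubEquiv hl v)
  · refine finsum_range_dualMap hp (fun x hx => ?_) ?_
    · rw [pullbackSubscheme_eq_top l φ hx, Module.rankAtStalk_eq_zero_of_subsingleton]
      rfl
    · rintro _ ⟨χ, rfl⟩
      have := pullbackSubscheme_dualMap hp l φ χ.toMul
      rw [ofMul_toMul] at this
      rw [this]
      exact rankAtStalk_span_sub hl _ q
  · have h1 := pullbackSubscheme_dualMap hp l φ 1
    rw [ofMul_one, map_zero] at h1
    rw [h1, mem_points_span_sub]
    simp
  · rcases hval S x u hu with hS | ⟨χ, rfl, hχ⟩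
    · exact mem_points_of_subsingleton _ _
    rcases hval S y v hv with hS | ⟨ψ, rfl, hψ⟩
    · exact mem_points_of_subsingleton _ _
    rw [← map_add, ← ofMul_mul, pullbackSubscheme_dualMap hp, mem_points_span_sub, map_mul,
      Units.val_mul, Units.val_mul, mul_pow, hχ, hψ, map_mul]
  · rcases hval S x u hu with hS | ⟨χ, rfl, hχ⟩
    · exact mem_points_of_subsingleton _ _
    rw [← map_neg, ← ofMul_inv, pullbackSubscheme_dualMap hp, mem_points_span_sub, map_inv,
      ← Units.val_pow_eq_pow_val, inv_pow]
    have h1 : u ^ l = Units.map (algebraMap K S : K →* S) (φ χ) := Units.ext hχ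
    rw [h1, ← map_inv]
    rfl

theorem idealMap_pullbackSubscheme (hp : Function.Surjective p) (l : ℕ) (φ : Dual A →* Kˣ)
    {K' : Type} [CommRing K'] (θ : K →+* K') (x : Fin h → QZ) :
    idealMap θ (pullbackSubscheme p l φ x) =
      pullbackSubscheme p l ((Units.map (θ : K →* K')).comp φ) x := by
  by_cases hx : x ∈ (dualMap p).range
  · obtain ⟨χ, rfl⟩ := hx
    have h1 := fun (F : Type) [CommRing F] (ψ : Dual A →* Fˣ) =>
      pullbackSubscheme_dualMap hp l ψ χ.toMul
    simp only [ofMul_toMul] at h1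
    rw [h1, h1, idealMap, Ideal.map_span, Set.image_singleton, map_sub]
    congr 3
    · rw [LaurentPolynomial.T, AddMonoidAlgebra.mapRingHom_single, map_one]
      rfl
    · exact AddMonoidAlgebra.mapRingHom_single _ _ _
  · rw [pullbackSubscheme_eq_top l _ hx, pullbackSubscheme_eq_top l _ hx, idealMap, Ideal.map_top]

/-- In the common quotient `T^l` equals both constants, and constants can be compared there because
`1` belongs to a basis. -/
theorem span_sub_injective {l : ℕ} (hl : 0 < l) {u v : Kˣ}
    (huv : Ideal.span {LaurentPolynomial.T (l : ℤ) - LaurentPolynomial.C (u : K)} =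
      Ideal.span {LaurentPolynomial.T (l : ℤ) - LaurentPolynomial.C (v : K)}) : u = v := by
  have h1 := coord_pow_span_sub l (u : K)
  have h2 : (coord (Ideal.span {LaurentPolynomial.T (l : ℤ) - LaurentPolynomial.C (u : K)}) :
      K[T;T⁻¹] ⧸ Ideal.span {LaurentPolynomial.T (l : ℤ) - LaurentPolynomial.C (u : K)}) ^ l =
      algebraMap K _ (v : K) := by
    rw [← mem_points_span_sub, ← huv]
    exact coord_mem_points _
  have h3 : powMap l (Ideal.span {LaurentPolynomial.T (l : ℤ) - LaurentPolynomial.C (u : K)})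
      (Pi.single ⟨0, hl⟩ (u : K)) =
      powMap l _ (Pi.single ⟨0, hl⟩ (v : K)) := by
    rw [powMap, Fintype.linearCombination_apply_single, Fintype.linearCombination_apply_single,
      pow_zero, ← Algebra.algebraMap_eq_smul_one, ← Algebra.algebraMap_eq_smul_one, ← h1, h2]
  exact Units.ext (Pi.single_injective _ (powMap_span_sub_injective hl u h3))

theorem pullbackSubscheme_injective (hp : Function.Surjective p) {l : ℕ} (hl : 0 < l) :
    Function.Injective fun φ : Dual A →* Kˣ => pullbackSubscheme p l φ := by
  intro φ ψ hφψ
  refine MonoidHom.ext fun χ => span_sub_injective hl ?_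
  rw [← pullbackSubscheme_dualMap hp, ← pullbackSubscheme_dualMap hp]
  exact congrFun hφψ _

end Pullback

end HeightOne

namespace HeightOne

/-! ### Subgroups over `A^*` are given by equations `T^l = φ(χ)` -/

section Classification

variable {K : Type} [CommRing K]

theorem algHom_ext_coord {J : Ideal K[T;T⁻¹]} {S : Type} [CommRing S] [Algebra K S]
    {f g : (K[T;T⁻¹] ⧸ J) →ₐ[K] S} (h : f (coord J : K[T;T⁻¹] ⧸ J) = g (coord J : K[T;T⁻¹] ⧸ J)) :
    f = g := by
  have h1 : (f : (K[T;T⁻¹] ⧸ J) →+* S) = g := by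
    refine Ideal.Quotient.ringHom_ext (ringHom_ext_laurent (fun a => ?_) h)
    exact (f.commutes a).trans (g.commutes a).symm
  exact AlgHom.ext fun x => RingHom.congr_fun h1 x

theorem pointHom_pow_coord {J : Ideal K[T;T⁻¹]} {S : Type} [CommRing S] [Algebra K S] {u : Sˣ}
    (hu : u ∈ points J S) (n : ℕ) : pointHom hu ((coord J : K[T;T⁻¹] ⧸ J) ^ n) = (u : S) ^ n := by
  rw [map_pow, pointHom_coord]

theorem pointHom_powMap {J : Ideal K[T;T⁻¹]} {S : Type} [CommRing S] [Algebra K S] {u : Sˣ}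
    (hu : u ∈ points J S) {l : ℕ} (c : Fin l → K) :
    pointHom hu (powMap l J c) = ∑ i, c i • (u : S) ^ (i : ℕ) := by
  rw [powMap_apply, map_sum]
  exact Finset.sum_congr rfl fun i _ => by rw [map_smul, pointHom_pow_coord]

/-! ### Translations -/

variable {h m : ℕ} {I : (Fin h → QZ) → Ideal K[T;T⁻¹]}

/-- Translation by a point `t` over `x` identifies the fibre over `0` with the fibre over `x`. -/
noncomputable def translateEquiv (hI : IsSubgroupOfOrder K m I) {x : Fin h → QZ} {t : Kˣ}
    (ht : t ∈ points (I x) K) : (K[T;T⁻¹] ⧸ I x) ≃ₐ[K] (K[T;T⁻¹] ⧸ I 0) :=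
  -- The two inverse maps are the points `t · T` over `x` and `t⁻¹ · T` over `0`, with `T` the
  -- tautological point of the other fibre.
  have h0 := map_mem_points (Algebra.ofId K (K[T;T⁻¹] ⧸ I 0)) ht
  have hx := map_mem_points (Algebra.ofId K (K[T;T⁻¹] ⧸ I x)) (hI.inv_mem K x t ht)
  have h1 := hI.mul_mem _ _ _ _ _ h0 (coord_mem_points (I 0))
  have h2 := hI.mul_mem _ _ _ _ _ hx (coord_mem_points (I x))
  AlgEquiv.ofAlgHom
    (pointHom (J := I x) (u := Units.map
      (Algebra.ofId K (K[T;T⁻¹] ⧸ I 0) : K →* K[T;T⁻¹] ⧸ I 0) t * coord (I 0)) (by simpa using h1))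
    (pointHom (J := I 0) (u := Units.map
      (Algebra.ofId K (K[T;T⁻¹] ⧸ I x) : K →* K[T;T⁻¹] ⧸ I x) t⁻¹ * coord (I x))
      (by simpa using h2))
    (by
      refine algHom_ext_coord ?_
      rw [AlgHom.comp_apply, pointHom_coord, Units.val_mul, map_mul, pointHom_coord, Units.val_mul,
        ← mul_assoc]
      have : pointHom (J := I x) (u := Units.map
        (Algebra.ofId K (K[T;T⁻¹] ⧸ I 0) : K →* K[T;T⁻¹] ⧸ I 0) t * coord (I 0)) (by simpa using h1)
          (Units.map (Algebra.ofId K (K[T;T⁻¹] ⧸ I x) : K →* K[T;T⁻¹] ⧸ I x) t⁻¹ :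
            (K[T;T⁻¹] ⧸ I x)ˣ) =
          (Units.map (Algebra.ofId K (K[T;T⁻¹] ⧸ I 0) : K →* K[T;T⁻¹] ⧸ I 0) t⁻¹ :
            (K[T;T⁻¹] ⧸ I 0)ˣ) := AlgHom.commutes _ _
      rw [this, ← Units.val_mul, ← map_mul, inv_mul_cancel, map_one, Units.val_one, one_mul]
      rfl)
    (by
      refine algHom_ext_coord ?_
      rw [AlgHom.comp_apply, pointHom_coord, Units.val_mul, map_mul, pointHom_coord, Units.val_mul,
        ← mul_assoc]
      have : pointHom (J := I 0) (u := Units.map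
        (Algebra.ofId K (K[T;T⁻¹] ⧸ I x) : K →* K[T;T⁻¹] ⧸ I x) t⁻¹ * coord (I x))
          (by simpa using h2)
          (Units.map (Algebra.ofId K (K[T;T⁻¹] ⧸ I 0) : K →* K[T;T⁻¹] ⧸ I 0) t :
            (K[T;T⁻¹] ⧸ I 0)ˣ) =
          (Units.map (Algebra.ofId K (K[T;T⁻¹] ⧸ I x) : K →* K[T;T⁻¹] ⧸ I x) t :
            (K[T;T⁻¹] ⧸ I x)ˣ) := AlgHom.commutes _ _
      rw [this, ← Units.val_mul, ← map_mul, mul_inv_cancel, map_one, Units.val_one, one_mul]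
      rfl)

theorem rankAtStalk_idealMap [∀ x, Module.Finite K (K[T;T⁻¹] ⧸ I x)]
    [∀ x, Module.Projective K (K[T;T⁻¹] ⧸ I x)] {K' : Type} [CommRing K'] [Algebra K K']
    (x : Fin h → QZ) (q : PrimeSpectrum K') :
    Module.rankAtStalk (K'[T;T⁻¹] ⧸ idealMap (algebraMap K K') (I x)) q =
      Module.rankAtStalk (K[T;T⁻¹] ⧸ I x) (q.comap (algebraMap K K')) :=
  (congrFun (Module.rankAtStalk_eq_of_equiv (quotBaseChange K K' (I x))) q).symm.trans
    (Module.rankAtStalk_baseChange q)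

/-- The fibre over `x` may have no point over `K`, but it acquires the tautological one after base
change to its own ring of functions, and translation by it identifies the two fibres. This base
change is faithfully flat, so every prime of `K` is reached. -/
theorem rankAtStalk_eq_zero_fibre (hI : IsSubgroupOfOrder K m I) (x : Fin h → QZ)
    [Module.FaithfullyFlat K (K[T;T⁻¹] ⧸ I x)] (q : PrimeSpectrum K) :
    Module.rankAtStalk (K[T;T⁻¹] ⧸ I x) q = Module.rankAtStalk (K[T;T⁻¹] ⧸ I 0) q := by
  have := hI.finite
  have := hI.projective
  obtain ⟨P, rfl⟩ := PrimeSpectrum.comap_surjective_of_faithfullyFlat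
    (A := K) (B := K[T;T⁻¹] ⧸ I x) q
  rw [← rankAtStalk_idealMap, ← rankAtStalk_idealMap]
  have hI' := hI.baseChange (algebraMap K (K[T;T⁻¹] ⧸ I x))
  have ht := (mem_points_idealMap (K' := K[T;T⁻¹] ⧸ I x) (I x) (K[T;T⁻¹] ⧸ I x) _).2
    (coord_mem_points (I x))
  exact congrFun (Module.rankAtStalk_eq_of_equiv (translateEquiv hI' ht).toLinearEquiv) P

variable {A : Type} [CommGroup A] {p : Multiplicative (Fin h → ℤ) →* A} [Finite A] {l : ℕ}

/-- The fibres over the `|A|` points of `A^*` have equal ranks with sum `l|A|`. -/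
theorem rankAtStalk_eq (hp : Function.Surjective p)
    (hI : IsSubgroupOfOrder K (l * Nat.card A) I) (hL : HasProjection K (dualMap p).range I)
    {x : Fin h → QZ} (hx : x ∈ (dualMap p).range) (q : PrimeSpectrum K) :
    Module.rankAtStalk (K[T;T⁻¹] ⧸ I x) q = l := by
  have h1 : ∀ x ∈ (dualMap p).range, Module.rankAtStalk (K[T;T⁻¹] ⧸ I x) q =
      Module.rankAtStalk (K[T;T⁻¹] ⧸ I 0) q := by
    intro x hx
    have := hL.faithfullyFlat x hx
    exact rankAtStalk_eq_zero_fibre hI x q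
  have h2 := finsum_range_dualMap hp
    (f := fun x => Module.rankAtStalk (K[T;T⁻¹] ⧸ I x) q) (fun x hx => ?_) h1
  · rw [hI.degree q] at h2
    rw [h1 x hx]
    exact (Nat.eq_of_mul_eq_mul_right Nat.card_pos h2).symm
  · have : Subsingleton (K[T;T⁻¹] ⧸ I x) := Ideal.Quotient.subsingleton_iff.2 (hL.eq_top x hx)
    rw [Module.rankAtStalk_eq_zero_of_subsingleton]
    rfl

theorem powMap_bijective (hp : Function.Surjective p)
    (hI : IsSubgroupOfOrder K (l * Nat.card A) I) (hL : HasProjection K (dualMap p).range I)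
    {x : Fin h → QZ} (hx : x ∈ (dualMap p).range) : Function.Bijective (powMap l (I x)) := by
  have := hI.finite x
  have := hI.projective x
  have hr := rankAtStalk_eq hp hI hL hx
  have hs := powMap_surjective_of_rank l (I x) hr
  exact ⟨injective_of_surjective_of_rank _ hs hr, hs⟩

/-! ### The equations of a subgroup -/

/-- The basis of powers of the coordinate. -/
noncomputable def powBasis {J : Ideal K[T;T⁻¹]} (hJ : Function.Bijective (powMap l J)) :
    Module.Basis (Fin l) K (K[T;T⁻¹] ⧸ J) :=
  Module.Basis.ofEquivFun (LinearEquiv.ofBijective _ hJ).symm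

theorem powBasis_apply {J : Ideal K[T;T⁻¹]} (hJ : Function.Bijective (powMap l J)) (i : Fin l) :
    powBasis hJ i = (coord J : K[T;T⁻¹] ⧸ J) ^ (i : ℕ) := by
  have h1 : powBasis hJ i = powMap l J (Pi.single i 1) := by
    rw [powBasis, Module.Basis.coe_ofEquivFun]
    rfl
  rw [h1, powMap, Fintype.linearCombination_apply_single, one_smul]

/-- Multiplication of points sends the coordinate `T₃` to `T₁ ⊗ T₂`. Expand `(T₁ ⊗ T₂)^l` both as
the product of the first two equations and as the image of the third, and compare coefficients in
the basis `T₁^i ⊗ T₂^j`. -/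
theorem coeff_mul_coeff {J₁ J₂ J₃ : Ideal K[T;T⁻¹]} (hJ₁ : Function.Bijective (powMap l J₁))
    (hJ₂ : Function.Bijective (powMap l J₂)) {c d e : Fin l → K}
    (hc : powMap l J₁ c = (coord J₁ : K[T;T⁻¹] ⧸ J₁) ^ l)
    (hd : powMap l J₂ d = (coord J₂ : K[T;T⁻¹] ⧸ J₂) ^ l)
    (he : powMap l J₃ e = (coord J₃ : K[T;T⁻¹] ⧸ J₃) ^ l)
    (hmul : ∀ (S : Type) [CommRing S] [Algebra K S] (u v : Sˣ),
      u ∈ points J₁ S → v ∈ points J₂ S → u * v ∈ points J₃ S) (i j : Fin l) :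
    c i * d j = if i = j then e i else 0 := by
  let B₁ := K[T;T⁻¹] ⧸ J₁
  let B₂ := K[T;T⁻¹] ⧸ J₂
  let g₁ : B₁ →ₐ[K] B₁ ⊗[K] B₂ := Algebra.TensorProduct.includeLeft
  let g₂ : B₂ →ₐ[K] B₁ ⊗[K] B₂ := Algebra.TensorProduct.includeRight
  have hm := hmul _ _ _ (map_mem_points (S' := B₁ ⊗[K] B₂) g₁ (coord_mem_points J₁))
    (map_mem_points (S' := B₁ ⊗[K] B₂) g₂ (coord_mem_points J₂))
  have hco : ((Units.map (g₁ : B₁ →* B₁ ⊗[K] B₂) (coord J₁) *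
      Units.map (g₂ : B₂ →* B₁ ⊗[K] B₂) (coord J₂) : (B₁ ⊗[K] B₂)ˣ) : B₁ ⊗[K] B₂) =
      (coord J₁ : B₁) ⊗ₜ[K] (coord J₂ : B₂) := by
    change ((coord J₁ : B₁) ⊗ₜ[K] (1 : B₂)) * ((1 : B₁) ⊗ₜ[K] (coord J₂ : B₂)) = _
    rw [Algebra.TensorProduct.tmul_mul_tmul, mul_one, one_mul]
  let b := (powBasis hJ₁).tensorProduct (powBasis hJ₂)
  have hb : ∀ i j : Fin l, b (i, j) =
      ((coord J₁ : B₁) ^ (i : ℕ)) ⊗ₜ[K] ((coord J₂ : B₂) ^ (j : ℕ)) := by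
    intro i j
    rw [Module.Basis.tensorProduct_apply, powBasis_apply, powBasis_apply]
  have h1 : ∑ x : Fin l × Fin l, (c x.1 * d x.2) • b x = ∑ x : Fin l × Fin l,
      (if x.1 = x.2 then e x.1 else 0) • b x := by
    have h2 := congrArg (pointHom hm) he
    rw [pointHom_pow_coord, pointHom_powMap, hco, Algebra.TensorProduct.tmul_pow, ← hc, ← hd,
      powMap_apply, powMap_apply, TensorProduct.sum_tmul] at h2
    rw [Fintype.sum_prod_type, Fintype.sum_prod_type]
    refine Eq.trans ?_ (h2.symm.trans ?_)
    · refine Finset.sum_congr rfl fun i _ => ?_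
      rw [TensorProduct.tmul_sum]
      refine Finset.sum_congr rfl fun j _ => ?_
      rw [TensorProduct.smul_tmul_smul, hb]
    · refine Finset.sum_congr rfl fun i _ => ?_
      rw [Algebra.TensorProduct.tmul_pow]
      simp only [ite_smul, zero_smul]
      rw [Finset.sum_ite_eq, if_pos (Finset.mem_univ _), hb]
  have h2 := Fintype.linearIndependent_iff.1 b.linearIndependent
    (fun x => c x.1 * d x.2 - if x.1 = x.2 then e x.1 else 0)
    (by simp only [sub_smul, Finset.sum_sub_distrib, h1, sub_self]) (i, j)
  exact sub_eq_zero.1 h2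

/-- The equation of the fibre over `0`. -/
theorem coord_pow_eq_one {J : Ideal K[T;T⁻¹]} (hl : 0 < l)
    (hJ : Function.Bijective (powMap l J)) {e : Fin l → K}
    (he : powMap l J e = (coord J : K[T;T⁻¹] ⧸ J) ^ l) (hone : (1 : Kˣ) ∈ points J K)
    (hmul : ∀ (S : Type) [CommRing S] [Algebra K S] (u v : Sˣ),
      u ∈ points J S → v ∈ points J S → u * v ∈ points J S) :
    e = Pi.single ⟨0, hl⟩ 1 := by
  -- The `e i` are orthogonal idempotents; evaluating the equation at the unit point gives their sum
  -- `1`.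
  have horth := coeff_mul_coeff hJ hJ he he he hmul
  have hsum : ∑ i, e i = 1 := by
    have h1 := congrArg (pointHom hone) he
    rw [pointHom_pow_coord, pointHom_powMap] at h1
    simpa using h1
  have hzero : ∀ i : Fin l, i ≠ ⟨0, hl⟩ → e i = 0 := by
    intro i hi
    have hi0 : 0 < (i : ℕ) := by
      rcases Nat.eq_zero_or_pos (i : ℕ) with h0 | h0
      · exact (hi (Fin.ext h0)).elim
      · exact h0
    -- Multiplied by `e i` the equation reads `T^l = T^i`, hence `T^(l-i) = 1` as `T` is a unit. For
    -- `0 < i` both sides are distinct basis elements, so `e i` must vanish.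
    have h1 : e i • (coord J : K[T;T⁻¹] ⧸ J) ^ l = e i • (coord J : K[T;T⁻¹] ⧸ J) ^ (i : ℕ) := by
      rw [← he, powMap_apply, Finset.smul_sum, Finset.sum_eq_single i]
      · rw [smul_smul, horth, if_pos rfl]
      · intro j _ hj
        rw [smul_smul, horth, if_neg hj.symm, zero_smul]
      · exact fun h => (h (Finset.mem_univ _)).elim
    have h2 : e i • (coord J : K[T;T⁻¹] ⧸ J) ^ (l - i) =
        e i • (coord J : K[T;T⁻¹] ⧸ J) ^ (0 : ℕ) := by
      have h3 := congrArg
        (fun z => (((coord J)⁻¹ ^ (i : ℕ) : (K[T;T⁻¹] ⧸ J)ˣ) : K[T;T⁻¹] ⧸ J) * z) h1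
      simp only [mul_smul_comm] at h3
      rw [← Units.val_pow_eq_pow_val, ← Units.val_pow_eq_pow_val, ← Units.val_mul,
        ← Units.val_mul] at h3
      rw [← Units.val_pow_eq_pow_val, ← Units.val_pow_eq_pow_val]
      have h4 : (coord J)⁻¹ ^ (i : ℕ) * coord J ^ l = coord J ^ (l - (i : ℕ)) := by
        rw [inv_pow, inv_mul_eq_iff_eq_mul, ← pow_add]
        congr 1
        omega
      rw [h4, inv_pow, inv_mul_cancel] at h3
      simpa using h3
    have h5 := powBasis_apply hJ ⟨l - i, by omega⟩
    have h6 := powBasis_apply hJ ⟨0, hl⟩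
    simp only at h5 h6
    rw [← h5, ← h6] at h2
    have h7 := congrArg (fun z => (powBasis hJ).repr z ⟨0, hl⟩) h2
    simp only [map_smul, Module.Basis.repr_self, Finsupp.smul_apply, Finsupp.single_apply,
      smul_eq_mul] at h7
    have : ¬ ((⟨l - i, by omega⟩ : Fin l) = ⟨0, hl⟩) := by
      rw [Fin.mk.injEq]
      omega
    simpa [this] using h7.symm
  have h0 : e ⟨0, hl⟩ = 1 := by
    rw [← hsum, Finset.sum_eq_single (⟨0, hl⟩ : Fin l) (fun j _ hj => hzero j hj)
      (fun h => (h (Finset.mem_univ _)).elim)]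
  funext i
  rcases eq_or_ne i ⟨0, hl⟩ with rfl | hi
  · rw [Pi.single_eq_same, h0]
  · rw [Pi.single_eq_of_ne hi, hzero i hi]

/-- `T^l - v` lies in `J`. Modulo it, an element of `J` is a combination of the first `l` powers,
and these are independent modulo `J`. -/
theorem span_sub_eq_of_powMap_bijective (hl : 0 < l) {J : Ideal K[T;T⁻¹]}
    (hJ : Function.Injective (powMap l J)) (v : Kˣ)
    (hv : (coord J : K[T;T⁻¹] ⧸ J) ^ l = algebraMap K _ (v : K)) :
    J = Ideal.span {LaurentPolynomial.T (l : ℤ) - LaurentPolynomial.C (v : K)} := by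
  have hmem := (mem_points_span_sub l (v : K) (coord J)).2 hv
  refine le_antisymm (fun f hf => ?_) ?_
  · obtain ⟨c, hc⟩ := powMap_span_sub_surjective hl v (Ideal.Quotient.mk _ f)
    have h1 := congrArg (pointHom hmem) hc
    have h2 : pointHom hmem (Ideal.Quotient.mk _ f) = 0 := by
      change LaurentPolynomial.eval₂ (algebraMap K _) (coord J) f = 0
      rw [eval₂_coord]
      exact Ideal.Quotient.eq_zero_iff_mem.2 hf
    have h3 : powMap l J c = 0 := by
      rw [← h2, ← h1, pointHom_powMap, powMap_apply]
    have h4 : c = 0 := hJ (h3.trans (map_zero _).symm)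
    rw [h4, map_zero] at hc
    exact Ideal.Quotient.eq_zero_iff_mem.1 hc.symm
  · rw [Ideal.span_singleton_le_iff_mem, ← Ideal.Quotient.eq_zero_iff_mem, map_sub, sub_eq_zero,
      ← coord_pow, hv]
    rfl

/-- Every subgroup of order `l |A|` over `A^*` is a pull-back. -/
theorem exists_eq_pullbackSubscheme (hp : Function.Surjective p) (hl : 0 < l)
    (hI : IsSubgroupOfOrder K (l * Nat.card A) I) (hL : HasProjection K (dualMap p).range I) :
    ∃ φ : Dual A →* Kˣ, pullbackSubscheme p l φ = I := by
  have hbij : ∀ χ : Dual A, Function.Bijective (powMap l (I (dualMap p (.ofMul χ)))) :=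
    fun χ => powMap_bijective hp hI hL ⟨_, rfl⟩
  have hex := fun χ : Dual A => (hbij χ).2
    ((coord (I (dualMap p (.ofMul χ))) : K[T;T⁻¹] ⧸ I (dualMap p (.ofMul χ))) ^ l)
  choose c hc using hex
  have hadd : ∀ χ ψ : Dual A, dualMap p (.ofMul (χ * ψ)) =
      dualMap p (.ofMul χ) + dualMap p (.ofMul ψ) := fun χ ψ => map_add (dualMap p) _ _
  have hmul : ∀ (χ ψ : Dual A) (i j : Fin l),
      c χ i * c ψ j = if i = j then c (χ * ψ) i else 0 := by
    intro χ ψ i j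
    refine coeff_mul_coeff (hbij χ) (hbij ψ) (hc χ) (hc ψ) (hc (χ * ψ)) ?_ i j
    intro S _ _ u v hu hv
    rw [hadd]
    exact hI.mul_mem S _ _ u v hu hv
  have hzero : dualMap p (.ofMul (1 : Dual A)) = 0 := map_zero (dualMap p)
  have hone : c 1 = Pi.single ⟨0, hl⟩ 1 := by
    refine coord_pow_eq_one hl (hbij 1) (hc 1) ?_ ?_
    · rw [hzero]
      exact hI.one_mem K
    · intro S _ _ u v hu hv
      rw [hzero] at hu hv ⊢
      simpa using hI.mul_mem S 0 0 u v hu hv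
  have hone' : c 1 ⟨0, hl⟩ = 1 := by rw [hone, Pi.single_eq_same]
  -- The diagonal relation at index `0` makes the constant coefficients multiplicative; they are
  -- units because `Dual A` is a group.
  let u : Dual A →* K :=
    { toFun := fun χ => c χ ⟨0, hl⟩
      map_one' := hone'
      map_mul' := fun χ ψ => by rw [hmul, if_pos rfl] }
  have hsingle : ∀ χ, c χ = Pi.single ⟨0, hl⟩ (u χ) := by
    intro χ
    funext i
    rcases eq_or_ne i ⟨0, hl⟩ with rfl | hi
    · rw [Pi.single_eq_same]
      rfl
    · have h1 := hmul χ 1 i ⟨0, hl⟩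
      rw [if_neg hi, hone', mul_one] at h1
      rw [Pi.single_eq_of_ne hi, h1]
  refine ⟨u.toHomUnits, funext fun x => ?_⟩
  by_cases hx : x ∈ (dualMap p).range
  · obtain ⟨χ, rfl⟩ := hx
    have h1 := pullbackSubscheme_dualMap hp l u.toHomUnits χ.toMul
    rw [ofMul_toMul] at h1
    rw [h1]
    refine (span_sub_eq_of_powMap_bijective hl (hbij χ.toMul).1 _ ?_).symm
    rw [← hc, hsingle, powMap, Fintype.linearCombination_apply_single, pow_zero,
      ← Algebra.algebraMap_eq_smul_one]
    rfl
  · rw [pullbackSubscheme_eq_top l _ hx, hL.eq_top x hx]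

end Classification

/-! ### The isomorphism `c` -/

section Iso

variable {h m l : ℕ} {A : Type} [CommGroup A] [Finite A] {p : Multiplicative (Fin h → ℤ) →* A}

/-- The isomorphism `c_{m,A}`. -/
noncomputable def pullbackIso (hp : Function.Surjective p) (hl : 0 < l) (hm : m = l * Nat.card A) :
    HomGm (Dual A) ≅ SubFunctor m (dualMap p).range :=
  NatIso.ofComponents
    (fun K => Equiv.toIso (Equiv.ofBijective
      (fun φ : Dual A →* Kˣ => (⟨pullbackSubscheme p l φ,
        hm ▸ isSubgroupOfOrder_pullbackSubscheme hp hl φ,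
        hasProjection_pullbackSubscheme hp hl φ⟩ : (SubFunctor m (dualMap p).range).obj K))
      ⟨fun φ ψ hφψ => pullbackSubscheme_injective hp hl (congrArg Subtype.val hφψ), by
        rintro ⟨I, hI, hL⟩
        obtain ⟨φ, hφ⟩ := exists_eq_pullbackSubscheme hp hl (hm ▸ hI) hL
        exact ⟨φ, Subtype.ext hφ⟩⟩))
    (by
      intro K K' θ
      refine ConcreteCategory.hom_ext _ _ fun φ => Subtype.ext (funext fun x => ?_)
      exact (idealMap_pullbackSubscheme hp l _ θ.hom x).symm)

end Iso

end HeightOne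

namespace HeightOne

/-! ### Monotypical maps are free over their image -/

theorem IsMonotypical.pos {h m : ℕ} {α : Multiplicative (Fin h → ℤ) →* Equiv.Perm (Fin m)}
    (hα : IsMonotypical α) : 0 < m := by
  obtain ⟨S, hS⟩ := Set.ncard_eq_one.1 hα
  obtain ⟨x, -⟩ : S ∈ Set.range fun x : Fin m =>
    (MulAction.stabilizer (Equiv.Perm (Fin m)) x).comap α := hS ▸ rfl
  exact x.pos

/-- All points have the same stabilizer, so an element of the image that fixes one point fixes all
and is the identity. The image thus acts freely and each orbit has its size. -/
theorem IsMonotypical.card_dvd {h m : ℕ} {α : Multiplicative (Fin h → ℤ) →* Equiv.Perm (Fin m)}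
    (hα : IsMonotypical α) : Nat.card α.range ∣ m := by
  obtain ⟨S, hS⟩ := Set.ncard_eq_one.1 hα
  have hS' : ∀ x : Fin m, (MulAction.stabilizer (Equiv.Perm (Fin m)) x).comap α = S := by
    intro x
    have : (MulAction.stabilizer (Equiv.Perm (Fin m)) x).comap α ∈ ({S} : Set _) := hS ▸ ⟨x, rfl⟩
    exact this
  have hfree : ∀ x : Fin m, MulAction.stabilizer α.range x = ⊥ := by
    intro x
    rw [eq_bot_iff]
    rintro ⟨_, z, rfl⟩ hz
    refine Subtype.ext (Equiv.ext fun y => ?_)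
    have h1 : z ∈ (MulAction.stabilizer (Equiv.Perm (Fin m)) x).comap α := hz
    rw [hS', ← hS' y] at h1
    exact h1
  have h1 := Nat.card_congr (MulAction.selfEquivOrbitsQuotientProd hfree)
  rw [Nat.card_prod, Nat.card_eq_fintype_card, Fintype.card_fin] at h1
  exact ⟨_, h1.trans (mul_comm _ _)⟩

/-! ### Functors represented by a ring -/

section Represented

variable {R : Type} [CommRing R] {X : CommRingCat.{0} ⥤ Type} (e : SpecFunctor R ≅ X)

/-- The homomorphism on `R` that corresponds to a point of a functor represented by `R`. -/
def pointOf {K : CommRingCat.{0}} (x : X.obj K) : R →+* K := e.inv.app K x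

theorem hom_app_pointOf {K : CommRingCat.{0}} (x : X.obj K) : e.hom.app K (pointOf e x) = x :=
  ConcreteCategory.congr_hom (e.inv_hom_id_app K) x

theorem pointOf_hom_app {K : CommRingCat.{0}} (φ : R →+* K) :
    pointOf e (e.hom.app K φ) = φ :=
  ConcreteCategory.congr_hom (e.hom_inv_id_app K) φ

/-- The functions on a functor represented by `R` are the elements of `R`. -/
def gamHom : Gam X →+* R :=
  evalPoint (K := CommRingCat.of R) (e.hom.app (CommRingCat.of R) (RingHom.id R))

/-- Yoneda: `x` is the image of the universal point under the homomorphism that classifies it, and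
`f` is natural along this homomorphism. -/
theorem pointOf_gamHom {K : CommRingCat.{0}} (x : X.obj K) (f : Gam X) :
    pointOf e x (gamHom e f) = evalPoint x f := by
  have h1 := f.2 (CommRingCat.of R) K (CommRingCat.ofHom (pointOf e x))
    (e.hom.app (CommRingCat.of R) (RingHom.id R))
  have h2 : X.map (CommRingCat.ofHom (pointOf e x))
      (e.hom.app (CommRingCat.of R) (RingHom.id R)) = x := by
    have h3 := ConcreteCategory.congr_hom
      (e.hom.naturality (CommRingCat.ofHom (pointOf e x))) (RingHom.id R)
    exact h3.symm.trans (hom_app_pointOf e x)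
  rw [h2] at h1
  exact h1.symm

theorem gamHom_bijective : Function.Bijective (gamHom e) := by
  refine ⟨fun f f' hf => ?_, fun r => ?_⟩
  · refine Subtype.ext (funext fun K => funext fun x => ?_)
    have h1 := pointOf_gamHom e x f
    rw [hf, pointOf_gamHom] at h1
    exact h1.symm
  · refine ⟨⟨fun K x => pointOf e x r, fun K K' θ x => ?_⟩, ?_⟩
    · have h1 := ConcreteCategory.congr_hom (e.inv.naturality θ) x
      exact congrArg (fun φ : R →+* K' => φ r) h1
    · exact congrArg (fun φ : R →+* R => φ r) (pointOf_hom_app e (K := CommRingCat.of R) _)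

theorem isAffineFunctor_of_iso (e : SpecFunctor R ≅ X) : IsAffineFunctor X := by
  refine fun K => ⟨fun x y hxy => ?_, fun φ => ?_⟩
  · have h1 : pointOf e x = pointOf e y := by
      refine RingHom.ext fun r => ?_
      obtain ⟨f, rfl⟩ := (gamHom_bijective e).2 r
      rw [pointOf_gamHom, pointOf_gamHom]
      exact RingHom.congr_fun hxy f
    rw [← hom_app_pointOf e x, ← hom_app_pointOf e y, h1]
  · let E := RingEquiv.ofBijective (gamHom e) (gamHom_bijective e)
    refine ⟨e.hom.app K (φ.comp (E.symm : R →+* Gam X)), RingHom.ext fun f => ?_⟩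
    change evalPoint _ f = φ f
    rw [← pointOf_gamHom e, pointOf_hom_app]
    exact congrArg φ (E.symm_apply_apply f)

end Represented

/-! ### The subgroup attached to an element over a long cycle -/

section Cycle

variable {A : Type} [CommGroup A] {l : ℕ}

theorem OverLongCycle.right_zpow_eq_one [NeZero l] {w : Wreath A l} (hw : OverLongCycle w)
    {n : ℤ} (hn : w.right ^ n = 1) : (l : ℤ) ∣ n := by
  have hw' : w.right.IsCycleOn (Finset.univ : Finset (Fin l)) := by
    rw [Finset.coe_univ]
    exact hw
  have h1 := hw'.zpow_apply_eq (Finset.mem_univ (0 : Fin l)) (n := n)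
  rw [Finset.card_univ, Fintype.card_fin] at h1
  exact h1.1 (by rw [hn]; rfl)

theorem wreath_pow_left (w : Wreath A l) (n : ℕ) (i : Fin l) :
    (w ^ n).left i = ∏ k ∈ Finset.range n, w.left ((w.right⁻¹ ^ k) i) := by
  induction n generalizing i with
  | zero => rfl
  | succ n ih =>
    rw [pow_succ', SemidirectProduct.mul_left, Finset.prod_range_succ', mul_comm, Pi.mul_apply]
    congr 1
    change (w ^ n).left (w.right⁻¹ i) = _
    rw [ih]
    rfl

/-- A coordinate of `w^l` is the product of the entries of `w` along an orbit of the cycle, which is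
the whole index set. This ties the norm to the `l`-th power in the pull-back. -/
theorem OverLongCycle.pow_eq {w : Wreath A l} (hw : OverLongCycle w) :
    w ^ l = wreathDiag A l (wreathNorm A l w) := by
  have hw' : w.right.IsCycleOn (Finset.univ : Finset (Fin l)) := by
    rw [Finset.coe_univ]
    exact hw
  have hwi : (w.right⁻¹).IsCycleOn (Finset.univ : Finset (Fin l)) := hw'.inv
  refine SemidirectProduct.ext (funext fun i => ?_) ?_
  · rw [wreath_pow_left]
    change _ = ∏ j, w.left j
    refine Finset.prod_nbij (fun k => (w.right⁻¹ ^ k) i) (fun _ _ => Finset.mem_univ _) ?_ ?_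
      fun _ _ => rfl
    · intro k hk k' hk' hkk
      have h1 := (hwi.pow_apply_eq_pow_apply (Finset.mem_univ i)).1 hkk
      rw [Finset.card_univ, Fintype.card_fin] at h1
      exact h1.eq_of_lt_of_lt (Finset.mem_range.1 hk) (Finset.mem_range.1 hk')
    · intro j _
      obtain ⟨n, hn, hnj⟩ := hwi.exists_pow_eq (Finset.mem_univ i) (Finset.mem_univ j)
      rw [Finset.card_univ, Fintype.card_fin] at hn
      exact ⟨n, Finset.mem_coe.2 (Finset.mem_range.2 hn), hnj⟩
  · change SemidirectProduct.rightHom (w ^ l) = 1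
    rw [map_pow]
    refine Equiv.ext fun i => ?_
    have h1 := hw'.pow_card_apply (Finset.mem_univ i)
    rwa [Finset.card_univ, Fintype.card_fin] at h1

theorem wreathPerm_injective : Function.Injective (wreathPerm A l) := by
  rw [injective_iff_map_eq_one]
  intro w hw
  have h1 : ∀ i, w.left (w.right i) = 1 ∧ w.right i = i := by
    intro i
    have h2 := congrArg (fun σ : Equiv.Perm (A × Fin l) => σ (1, i)) hw
    have h3 : (w.left (w.right i) * 1, w.right i) = ((1, i) : A × Fin l) := h2
    rw [mul_one, Prod.mk.injEq] at h3
    exact h3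
  refine SemidirectProduct.ext (funext fun i => ?_) (Equiv.ext fun i => (h1 i).2)
  have h4 := h1 i
  rw [h4.2] at h4
  exact h4.1

theorem wreathDiag_injective [NeZero l] : Function.Injective (wreathDiag A l) := fun _ _ hab =>
  congrArg (fun w : Wreath A l => w.left 0) hab

variable {h : ℕ} {p : Multiplicative (Fin h → ℤ) →* A}

theorem tail_single_zero : Fin.tail (Pi.single 0 1 : Fin (h + 1) → ℤ) = 0 := by
  funext j
  simp [Fin.tail]

theorem tail_single_succ (i : Fin h) :
    Fin.tail (Pi.single i.succ 1 : Fin (h + 1) → ℤ) = Pi.single i 1 := by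
  funext j
  simp [Fin.tail, Pi.single_apply]

theorem single_succ_zero (i : Fin h) : (Pi.single i.succ 1 : Fin (h + 1) → ℤ) 0 = 0 :=
  Pi.single_eq_of_ne (Fin.succ_ne_zero i).symm _

theorem wreathTuple_single_succ (w : Wreath A l) (i : Fin h) :
    wreathTuple p w (.ofAdd (Pi.single i.succ 1)) =
      wreathPerm A l (wreathDiag A l (p (.ofAdd (Pi.single i 1)))) := by
  change wreathPerm A l (w ^ ((Pi.single i.succ 1 : Fin (h + 1) → ℤ) 0) *
    wreathDiag A l (p (.ofAdd (Fin.tail (Pi.single i.succ 1 : Fin (h + 1) → ℤ))))) = _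
  rw [tail_single_succ, single_succ_zero, zpow_zero, one_mul]

theorem wreathTuple_single_zero (w : Wreath A l) :
    wreathTuple p w (.ofAdd (Pi.single 0 1)) = wreathPerm A l w := by
  change wreathPerm A l (w ^ ((Pi.single 0 1 : Fin (h + 1) → ℤ) 0) *
    wreathDiag A l (p (.ofAdd (Fin.tail (Pi.single 0 1 : Fin (h + 1) → ℤ))))) = _
  rw [tail_single_zero, Pi.single_eq_same, zpow_one, ofAdd_zero, map_one, map_one, mul_one]

theorem wreathTuple_cons (w : Wreath A l) (n : ℤ) (v : Fin h → ℤ) :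
    wreathTuple p w (.ofAdd (Fin.cons n v)) =
      wreathPerm A l (w ^ n * wreathDiag A l (p (.ofAdd v))) := rfl

/-- `B_w` is generated by `w` and the diagonal copy of `A`, which commute. A power of `w` is
diagonal only if `l` divides the exponent, so `w^l = N(w)` is the only further relation. A character
of `B_w` is then a character `χ` of `A` with an `l`-th root of `χ(N w)`. -/
theorem mem_cycleSubgroup_iff [NeZero l] (hp : Function.Surjective p) {w : Wreath A l}
    (hw : OverLongCycle w) (y : Fin (h + 1) → QZ) : y ∈ cycleSubgroup p w ↔
      ∃ χ : Dual A, dualMap p (.ofMul χ) = Fin.tail y ∧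
        .ofAdd (y 0) ^ l = χ (wreathNorm A l w) := by
  constructor
  · rintro ⟨χ', rfl⟩
    have hmem : ∀ a : A, wreathPerm A l (wreathDiag A l a) ∈ (wreathTuple p w).range := by
      intro a
      obtain ⟨v, rfl⟩ := hp a
      refine ⟨.ofAdd (Fin.cons 0 v.toAdd), ?_⟩
      rw [wreathTuple_cons, zpow_zero, one_mul]
      rfl
    let ψ : Dual (wreathTuple p w).range := χ'.toMul
    let χ : Dual A := ψ.comp (((wreathPerm A l).comp (wreathDiag A l)).codRestrict _ hmem)
    refine ⟨χ, funext fun i => ?_, ?_⟩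
    · change ψ ⟨_, _⟩ = ψ ⟨_, _⟩
      congr 2
      exact (wreathTuple_single_succ w i).symm
    · change ψ _ ^ l = ψ ⟨_, _⟩
      rw [← map_pow]
      congr 1
      refine Subtype.ext ?_
      change (wreathTuple p w (.ofAdd (Pi.single 0 1))) ^ l = _
      rw [wreathTuple_single_zero, ← map_pow, hw.pow_eq]
      rfl
  · rintro ⟨χ, hχ, hy⟩
    let f : Multiplicative (Fin (h + 1) → ℤ) →* Multiplicative QZ :=
      { toFun := fun v => .ofAdd (y 0) ^ (v.toAdd 0) * χ (p (.ofAdd (Fin.tail v.toAdd)))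
        map_one' := by
          have : Fin.tail (0 : Fin (h + 1) → ℤ) = 0 := rfl
          simp [this]
        map_mul' := by
          intro u v
          have : Fin.tail (Multiplicative.toAdd u + Multiplicative.toAdd v) =
            Fin.tail (Multiplicative.toAdd u) + Fin.tail (Multiplicative.toAdd v) := rfl
          simp only [toAdd_mul, this, ofAdd_add, map_mul, Pi.add_apply, zpow_add]
          exact mul_mul_mul_comm _ _ _ _ }
    have hker : (wreathTuple p w).rangeRestrict.ker ≤ f.ker := by
      intro v hv
      rw [MonoidHom.ker_rangeRestrict] at hv
      have h1 : w ^ (v.toAdd 0) * wreathDiag A l (p (.ofAdd (Fin.tail v.toAdd))) = 1 :=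
        wreathPerm_injective ((MonoidHom.mem_ker.1 hv).trans (map_one _).symm)
      have h2 : w.right ^ (v.toAdd 0) = 1 := by
        have h3 := congrArg SemidirectProduct.rightHom h1
        rw [map_mul, map_zpow, map_one] at h3
        have h4 : SemidirectProduct.rightHom (wreathDiag A l (p (.ofAdd (Fin.tail v.toAdd)))) = 1 :=
          rfl
        rwa [h4, mul_one] at h3
      obtain ⟨k, hk⟩ := hw.right_zpow_eq_one h2
      rw [hk, zpow_mul, zpow_natCast, hw.pow_eq, ← map_zpow, ← map_mul] at h1
      have h5 := wreathDiag_injective (h1.trans (map_one _).symm)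
      change .ofAdd (y 0) ^ (v.toAdd 0) * χ (p (.ofAdd (Fin.tail v.toAdd))) = 1
      rw [hk, zpow_mul, zpow_natCast, hy, ← map_zpow, ← map_mul, h5, map_one]
    have hsurj := (wreathTuple p w).rangeRestrict_surjective
    refine ⟨.ofMul ((wreathTuple p w).rangeRestrict.liftOfSurjective hsurj ⟨f, hker⟩),
      funext fun i => ?_⟩
    change ((wreathTuple p w).rangeRestrict.liftOfSurjective hsurj ⟨f, hker⟩
      ((wreathTuple p w).rangeRestrict (.ofAdd (Pi.single i 1)))).toAdd = y i
    rw [MonoidHom.liftOfRightInverse_comp_apply]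
    change (.ofAdd (y 0) ^ ((Pi.single i 1 : Fin (h + 1) → ℤ) 0) *
      χ (p (.ofAdd (Fin.tail (Pi.single i 1 : Fin (h + 1) → ℤ)))) : Multiplicative QZ).toAdd = y i
    induction i using Fin.cases with
    | zero =>
      rw [tail_single_zero, Pi.single_eq_same, zpow_one, ofAdd_zero, map_one, map_one, mul_one]
      rfl
    | succ i =>
      rw [tail_single_succ, single_succ_zero, zpow_zero, one_mul]
      exact congrFun hχ i

theorem mem_complexPoints_iff (hp : Function.Surjective p) (φ : Dual A →* ℂˣ)
    (y : Fin (h + 1) → QZ) : y ∈ complexPoints (pullbackSubscheme p l φ) ↔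
      ∃ χ : Dual A, dualMap p (.ofMul χ) = Fin.tail y ∧ expQZ (.ofAdd (y 0)) ^ l = φ χ := by
  have h1 : y ∈ complexPoints (pullbackSubscheme p l φ) ↔
    expQZ (.ofAdd (y 0)) ∈ points (pullbackSubscheme p l φ (Fin.tail y)) ℂ := Iff.rfl
  have h2 : ∀ χ : Dual A, expQZ (.ofAdd (y 0)) ∈
      points (pullbackSubscheme p l φ (dualMap p (.ofMul χ))) ℂ ↔
        expQZ (.ofAdd (y 0)) ^ l = φ χ := by
    intro χ
    rw [pullbackSubscheme_dualMap hp, mem_points_span_sub, Units.ext_iff]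
    rfl
  rw [h1]
  constructor
  · intro hy
    by_cases hx : Fin.tail y ∈ (dualMap p).range
    · obtain ⟨χ, hχ⟩ := hx
      rw [← hχ] at hy
      exact ⟨χ.toMul, hχ, (h2 χ.toMul).1 hy⟩
    · rw [pullbackSubscheme_eq_top l φ hx] at hy
      exact (not_subsingleton ℂ (subsingleton_of_mem_points_top hy)).elim
  · rintro ⟨χ, hχ, hy⟩
    rw [← hχ]
    exact (h2 χ).2 hy

/-- Evaluation at `a`, as a homomorphism `A^* → ℂˣ`. -/
noncomputable def dualEval (a : A) : Dual A →* ℂˣ :=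
  expQZ.comp (MonoidHom.eval a)

theorem dualEval_apply (a : A) (χ : Dual A) : dualEval a χ = expQZ (χ a) := rfl

theorem complexPoints_dualEval [NeZero l] (hp : Function.Surjective p) {w : Wreath A l}
    (hw : OverLongCycle w) :
    complexPoints (pullbackSubscheme p l (dualEval (wreathNorm A l w))) = cycleSubgroup p w := by
  ext y
  rw [mem_complexPoints_iff hp, SetLike.mem_coe, mem_cycleSubgroup_iff hp hw]
  refine exists_congr fun χ => and_congr_right fun _ => ?_
  rw [dualEval_apply, ← map_pow, expQZ_injective.eq_iff]

/-- `A^*` is finite, so `φ χ` is a root of unity and its `l`-th roots are torsion. Any of them is a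
point over `χ` whose `l`-th power recovers `φ χ`. -/
theorem eq_of_complexPoints_eq [Finite A] [NeZero l] (hp : Function.Surjective p)
    {φ ψ : Dual A →* ℂˣ}
    (hφψ : complexPoints (pullbackSubscheme p l φ) = complexPoints (pullbackSubscheme p l ψ)) :
    φ = ψ := by
  refine MonoidHom.ext fun χ => ?_
  obtain ⟨v, hv⟩ := IsAlgClosed.exists_pow_nat_eq (φ χ : ℂ) (NeZero.pos l)
  have hv0 : v ≠ 0 := by
    rintro rfl
    rw [zero_pow (NeZero.ne l)] at hv
    exact (φ χ).ne_zero hv.symm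
  have hu : Units.mk0 v hv0 ^ l = φ χ := Units.ext hv
  obtain ⟨q, hq⟩ := exists_expQZ_eq (u := Units.mk0 v hv0) (n := l * Nat.card (Dual A))
    (mul_ne_zero (NeZero.ne l) Nat.card_pos.ne')
    (by rw [pow_mul, hu, ← map_pow, pow_card_eq_one', map_one])
  have hmem : (Fin.cons q (dualMap p (.ofMul χ)) : Fin (h + 1) → QZ) ∈
      complexPoints (pullbackSubscheme p l φ) :=
    (mem_complexPoints_iff hp φ _).2 ⟨χ, rfl, by rw [Fin.cons_zero, hq, hu]⟩
  rw [hφψ] at hmem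
  obtain ⟨χ', hχ', hq'⟩ := (mem_complexPoints_iff hp ψ _).1 hmem
  rw [Fin.tail_cons] at hχ'
  have : χ' = χ := Additive.ofMul.injective (dualMap_injective hp hχ')
  rw [this, Fin.cons_zero, hq, hu] at hq'
  exact hq'

end Cycle

/-! ### The character-theoretic map -/

section CharacterMap

variable {h m l : ℕ} {A : Type} [CommGroup A] [Finite A] {p : Multiplicative (Fin h → ℤ) →* A}

/-- Evaluation of virtual characters at `a`. -/
noncomputable def charEval (a : A) : RepRing A →+* ℂ :=
  (Pi.evalRingHom (fun _ : A => ℂ) a).comp (RepRing A).subtype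

/-- `Spec R(A)` is isomorphic to the scheme of subgroups. -/
noncomputable def specIso (hp : Function.Surjective p) (hl : 0 < l) (hm : m = l * Nat.card A) :
    SpecFunctor (RepRing A) ≅ SubFunctor m (dualMap p).range :=
  have := isIso_chiMap (A := A)
  asIso (chiMap A) ≪≫ pullbackIso hp hl hm

theorem specIso_charEval (hp : Function.Surjective p) (hl : 0 < l) (hm : m = l * Nat.card A)
    (a : A) : ((specIso hp hl hm).hom.app (CommRingCat.of ℂ) (charEval a)).1 =
      pullbackSubscheme p l (dualEval a) := by
  change pullbackSubscheme p l _ = _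
  congr 1
  exact MonoidHom.ext fun χ => Units.ext rfl

/-- Every `H` is the pull-back along some `φ`, which its torsion points determine; those for
evaluation at the norm of `w` are `B_w^*`. -/
theorem isPointOf_iff (hp : Function.Surjective p) (hl : 0 < l) (hm : m = l * Nat.card A)
    {w : Wreath A l} (hw : OverLongCycle w)
    (H : (SubFunctor m (dualMap p).range).obj (CommRingCat.of ℂ)) : IsPointOf p w H ↔
      H = (specIso hp hl hm).hom.app (CommRingCat.of ℂ) (charEval (wreathNorm A l w)) := by
  have : NeZero l := ⟨hl.ne'⟩
  have h1 : IsPointOf p w H ↔ complexPoints H.1 = cycleSubgroup p w := Iff.rfl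
  rw [h1, ← complexPoints_dualEval hp hw, ← specIso_charEval hp hl hm]
  constructor
  · intro hH
    obtain ⟨I, hI, hL⟩ := H
    obtain ⟨φ, rfl⟩ := exists_eq_pullbackSubscheme hp hl (hm ▸ hI) hL
    refine Subtype.ext ?_
    rw [specIso_charEval] at hH ⊢
    exact congrArg (fun φ : Dual A →* ℂˣ => pullbackSubscheme p l φ) (eq_of_complexPoints_eq hp hH)
  · rintro rfl
    rfl

/-- The character-theoretic map `g_{m,A}`. -/
noncomputable def characterMap (hp : Function.Surjective p) (hl : 0 < l) (hm : m = l * Nat.card A) :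
    Gam (SubFunctor m (dualMap p).range) →+* RepQuot A l :=
  (normPullback A l).comp (gamHom (specIso hp hl hm))

theorem isCharacterMap_characterMap (hp : Function.Surjective p) (hl : 0 < l)
    (hm : m = l * Nat.card A) : IsCharacterMap p (characterMap hp hl hm) := by
  intro w hw H hH f
  rw [(isPointOf_iff hp hl hm hw H).1 hH, ← pointOf_gamHom (specIso hp hl hm), pointOf_hom_app]
  exact evalAt_normPullback w hw _

theorem IsCharacterMap.unique (hp : Function.Surjective p) (hl : 0 < l)
    (hm : m = l * Nat.card A) {g g' : Gam (SubFunctor m (dualMap p).range) →+* RepQuot A l}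
    (hg : IsCharacterMap p g) (hg' : IsCharacterMap p g') : g' = g := by
  have : NeZero l := ⟨hl.ne'⟩
  refine RingHom.ext fun f => repQuot_ext fun w hw => ?_
  have hH := (isPointOf_iff hp hl hm hw _).2 rfl
  rw [hg w hw _ hH, hg' w hw _ hH]

theorem characterMap_injective (hp : Function.Surjective p) (hl : 0 < l)
    (hm : m = l * Nat.card A) : Function.Injective (characterMap hp hl hm) := by
  have : NeZero l := ⟨hl.ne'⟩
  exact normPullback_injective.comp (gamHom_bijective _).1

end CharacterMap

end HeightOne

/-! ### The commutative square -/

theorem mainTheorem9 (h m : ℕ) (α : Multiplicative (Fin h → ℤ) →* Equiv.Perm (Fin m))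
    (hα : HeightOne.IsMonotypical α) (l : ℕ) (hl : l = m / Nat.card α.range) :
    -- the left vertical map `N_A` is an isomorphism
    IsIso (HeightOne.specMap (HeightOne.normPullback α.range l)) ∧
    -- the upper horizontal map `χ_A` is an isomorphism
    IsIso (HeightOne.chiMap α.range) ∧
    -- the right vertical map `c_{m,A}`, given by the pull-back construction, is an isomorphism
    ∃ c : HeightOne.HomGm (HeightOne.Dual α.range) ≅
        HeightOne.SubFunctor m (HeightOne.dualMap α.rangeRestrict).range,
      (∀ (K : CommRingCat.{0}) (φ : HeightOne.Dual α.range →* Kˣ),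
        (c.hom.app K φ).1 = HeightOne.pullbackSubscheme α.rangeRestrict l φ) ∧
      -- `Sub_m^{A^*}` is affine
      HeightOne.IsAffineFunctor
        (HeightOne.SubFunctor m (HeightOne.dualMap α.rangeRestrict).range) ∧
      -- each element over an `l`-cycle defines a complex point of `Sub_m^{A^*}`
      (∀ w : HeightOne.Wreath α.range l, HeightOne.OverLongCycle w →
        ∃! H : (HeightOne.SubFunctor m (HeightOne.dualMap α.rangeRestrict).range).obj
          (CommRingCat.of ℂ), HeightOne.IsPointOf α.rangeRestrict w H) ∧
      -- the character-theoretic map `g_{m,A}` exists, is unique, and is injective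
      ∃ g : HeightOne.Gam (HeightOne.SubFunctor m (HeightOne.dualMap α.rangeRestrict).range) →+*
          HeightOne.RepQuot α.range l,
        HeightOne.IsCharacterMap α.rangeRestrict g ∧
        (∀ g', HeightOne.IsCharacterMap α.rangeRestrict g' → g' = g) ∧
        Function.Injective g ∧
        -- the lower horizontal map `g_{m,A}^*` is the map of schemes induced by `g_{m,A}`,
        -- and the square commutes
        ∃ gstar : HeightOne.SpecFunctor (HeightOne.RepQuot α.range l) ⟶
            HeightOne.SubFunctor m (HeightOne.dualMap α.rangeRestrict).range,
          (∀ (K : CommRingCat.{0}) (φ : HeightOne.RepQuot α.range l →+* K),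
            HeightOne.evalPoint (gstar.app K φ) = φ.comp g) ∧
          HeightOne.specMap (HeightOne.normPullback α.range l) ≫ HeightOne.chiMap α.range ≫ c.hom =
            gstar := by
  have hdvd := hα.card_dvd
  have hA : 0 < Nat.card α.range := Nat.card_pos
  have hm : m = l * Nat.card α.range := by rw [hl, Nat.div_mul_cancel hdvd]
  have hl0 : 0 < l := hl ▸ Nat.div_pos (Nat.le_of_dvd hα.pos hdvd) hA
  have : NeZero l := ⟨hl0.ne'⟩
  have hp := α.rangeRestrict_surjective
  -- `gstar` is taken to be the composite around the square, which then commutes by definition. What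
  -- needs proof is that this composite is induced by `g`.
  refine ⟨HeightOne.isIso_specMap (HeightOne.normEquiv α.range l), HeightOne.isIso_chiMap,
    HeightOne.pullbackIso hp hl0 hm, fun K φ => rfl,
    HeightOne.isAffineFunctor_of_iso (HeightOne.specIso hp hl0 hm), fun w hw => ?_,
    HeightOne.characterMap hp hl0 hm, HeightOne.isCharacterMap_characterMap hp hl0 hm,
    fun g' hg' => (HeightOne.isCharacterMap_characterMap hp hl0 hm).unique hp hl0 hm hg',
    HeightOne.characterMap_injective hp hl0 hm, _, fun K φ => ?_, rfl⟩
  · exact ⟨_, (HeightOne.isPointOf_iff hp hl0 hm hw _).2 rfl,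
      fun H hH => (HeightOne.isPointOf_iff hp hl0 hm hw H).1 hH⟩
  · refine RingHom.ext fun f => ?_
    rw [← HeightOne.pointOf_gamHom (HeightOne.specIso hp hl0 hm)]
    exact congrArg (fun ψ : HeightOne.RepRing α.range →+* K =>
      ψ (HeightOne.gamHom (HeightOne.specIso hp hl0 hm) f))
      (HeightOne.pointOf_hom_app (HeightOne.specIso hp hl0 hm)
        (φ.comp (HeightOne.normPullback α.range l)))
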